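/- Let $A_0\in\mathbb R^{2\times2}$ and $B_0\in\mathbb R^2$. For $T>0$ put $Q=(0,\pi)\times(0,T)$ and consider the control system $$y_t-y_{xx}=A_0y\ \text{ in }Q,\qquad y(0,\cdot)=B_0u,\quad y(\pi,\cdot)=0\ \text{ in }(0,T),\qquad y(\cdot,0)=y_0,\tag{1}$$ with $y_0\in L^2(0,\pi)^2$ and $u\in L^2(0,T)$ real. A solution by transposition of (1) is a function $y\in L^2(Q)^2$ such that for every $g\in L^2(Q)^2$ $$\int_Q y\cdot g\,dx\,dt=\langle y_0,\phi(\cdot,0)\rangle+\int_0^T B_0\cdot\phi_x(0,t)\,u(t)\,dt,$$ where $\phi\in L^2(0,T;H^2(0,\pi)^2)\cap C([0,T];H^1_0(0,\pi)^2)$ is the strong solution of $-\phi_t-\phi_{xx}=A_0^*\phi+g$ in $Q$, $\phi(0,\cdot)=\phi(\pi,\cdot)=0$, $\phi(\cdot,T)=0$. Let $H=L^2(0,\pi;\mathbb C)^2$, $U=\mathbb C$, $Af=f''+A_0f$ with $\mathrm{dom}\,A=H^2(0,\pi;\mathbb C)^2\cap H^1_0(0,\pi;\mathbb C)^2$. Give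 $\mathrm{dom}\,A^*$ the graph norm, identify $H$ with a subspace of the dual $(\mathrm{dom}\,A^*)'$ (sesquilinear pairing), and let $\mathcal A=(A^*)':H\to(\mathrm{dom}\,A^*)'$ be the extension of $A$. Then $A$ generates a $C_0$-semigroup $e^{At}$ on $H$, $\mathcal A$ (with domain $H$) generates a $C_0$-semigroup $e^{\mathcal At}$ on $(\mathrm{dom}\,A^*)'$, and there is $B\in\mathcal L(U,(\mathrm{dom}\,A^*)')$ such that the following hold. 1. Let $\omega\in\mathbb C$ be such that no $\omega+k^2$ ($k=1,2,\dots$) is an eigenvalue of $A_0$. Then $\omega\in\rho(A)$; for each $a\in\mathbb C$ the problem $h''+A_0h=\omega h$ in $(0,\pi)$, $h(0)=aB_0$, $h(\pi)=0$ has a unique solution $h=:D_\omega a\in C^2([0,\pi];\mathbb C^2)$; the map $D_\omega:\mathbb C\to H$ is linear and continuous, and $$B=(\omega I-\mathcal A)D_\omega .$$ In particular $B=-\mathcal AC$ with $C=D_0$ whenever no $k^2$, $k\ge1$, is an eigenvalue of $A_0$. Moreover, for all $\theta\in(0,1/4)$ and $T>0$ there is $M$ such that $e^{At}D_\omega a\in\mathrm{dom}\,A$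 and $\|Ae^{At}D_\omega a\|_H\le M|a|\,t^{-(1-\theta)}$ for all $t\in(0,T)$, $a\in\mathbb C$. 2. For all $T>0$, $y_0\in L^2(0,\pi)^2$ and $u\in L^2(0,T)$, system (1) has a unique solution by transposition $y$, and $y$ is the solution of $\dot y=\mathcal Ay+Bu$, $y(0)=y_0$, that is, for a.e. $t\in(0,T)$ $$y(t)=e^{At}y_0+\int_0^te^{\mathcal A(t-s)}Bu(s)\,ds .$$ 3. For every $T>0$ the transformation $u\mapsto\int_0^{\cdot}e^{\mathcal A(\cdot-s)}Bu(s)\,ds$ is linear and continuous from $L^2(0,T;U)$ into $L^2(0,T;H)$. 4. $A$ has compact resolvent, and there are closed subspaces $H_s,H_1$ of $H$ with $H=H_s\oplus H_1$ such that $e^{At}x\to0$ as $t\to+\infty$ for all $x\in H_s$, $H_1$ is invariant for $e^{At}$, and the generalized eigenvectors of $A$ contained in $H_1$ are linearly dense in $H_1$ (with $H_1=\{0\}$ if $\sigma(A)=\emptyset$). -/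

import Mathlib

open MeasureTheory Set Filter Topology

noncomputable section

namespace BoundaryControl

/-! ## Abstract setting: semigroups, generators, resolvents, extrapolation space -/

/-- A strongly continuous semigroup `(S t)_{t ≥ 0}` of bounded operators on `X`
(the values at negative times are irrelevant). -/
structure C0Semigroup (X : Type*) [NormedAddCommGroup X] [NormedSpace ℂ X] where
  op : ℝ → X →L[ℂ] X
  op_zero : op 0 = ContinuousLinearMap.id ℂ X
  op_add : ∀ s t : ℝ, 0 ≤ s → 0 ≤ t → op (s + t) = (op s).comp (op t)
  tendsto_zero : ∀ x : X, Tendsto (fun t : ℝ => op t x) (𝓝[>] 0) (𝓝 x)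

/-- The infinitesimal generator of `S` is the operator whose graph is `G`: one has `(x, y) ∈ G`
if and only if `(S t x - x) / t → y` as `t ↓ 0`. -/
def C0Semigroup.HasGenerator {X : Type*} [NormedAddCommGroup X] [NormedSpace ℂ X]
    (S : C0Semigroup X) (G : Set (X × X)) : Prop :=
  ∀ x y : X, (x, y) ∈ G ↔
    Tendsto (fun t : ℝ => ((t⁻¹ : ℝ) : ℂ) • (S.op t x - x)) (𝓝[>] 0) (𝓝 y)

section Abstract

variable {H : Type*} [NormedAddCommGroup H] [InnerProductSpace ℂ H]

/-- `R` is the bounded everywhere defined inverse of `ω I - A : dom A → H`. -/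
def IsResolventAt (A : H →ₗ.[ℂ] H) (ω : ℂ) (R : H →L[ℂ] H) : Prop :=
  (∀ x : H, ∃ h : R x ∈ A.domain, ω • R x - A ⟨R x, h⟩ = x) ∧
    ∀ x : A.domain, R (ω • (x : H) - A x) = x

/-- The resolvent set `ρ(A)`. -/
def resolventSet (A : H →ₗ.[ℂ] H) : Set ℂ := {ω | ∃ R, IsResolventAt A ω R}

/-- The spectrum `σ(A)`. -/
def spectrumSet (A : H →ₗ.[ℂ] H) : Set ℂ := (resolventSet A)ᶜ

/-- `A` has compact resolvent. -/
def HasCompactResolvent (A : H →ₗ.[ℂ] H) : Prop :=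
  (resolventSet A).Nonempty ∧ ∀ ω R, IsResolventAt A ω R → IsCompactOperator R

/-- `IsInKerPow A lam k x` means `x ∈ Ker (lam I - A)^k` (including `x ∈ dom A^k`). -/
def IsInKerPow (A : H →ₗ.[ℂ] H) (lam : ℂ) : ℕ → H → Prop
  | 0, x => x = 0
  | k + 1, x => ∃ h : x ∈ A.domain, IsInKerPow A lam k (lam • x - A ⟨x, h⟩)

/-- `x` is a generalized eigenvector of `A`. (The zero vector is included; this is harmless since
the notion is only used through linear spans.) -/
def IsGenEigenvector (A : H →ₗ.[ℂ] H) (x : H) : Prop :=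
  ∃ lam : ℂ, ∃ k : ℕ, 1 ≤ k ∧ IsInKerPow A lam k x

/-- The spectral hypothesis on the semigroup `S = e^{At}`: the space `H` is the direct sum of
closed subspaces `Hs` and `H1` such that `e^{At} x → 0` for `x ∈ Hs`, and such that `H1` is
invariant and the generalized eigenvectors contained in `H1` are linearly dense in it;
`H1 = 0` if the spectrum is empty. -/
def SpectralHypothesis (A : H →ₗ.[ℂ] H) (S : C0Semigroup H) : Prop :=
  ∃ Hs H1 : Submodule ℂ H,
    IsClosed (Hs : Set H) ∧ IsClosed (H1 : Set H) ∧ IsCompl Hs H1 ∧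
    (∀ x ∈ Hs, Tendsto (fun t : ℝ => S.op t x) atTop (𝓝 0)) ∧
    (∀ x ∈ H1, ∀ t : ℝ, 0 ≤ t → S.op t x ∈ H1) ∧
    H1 = (Submodule.span ℂ {x | x ∈ H1 ∧ IsGenEigenvector A x}).topologicalClosure ∧
    (spectrumSet A = ∅ → H1 = ⊥)

/-- The domain of an operator `T`, as a space of its own that carries the graph norm. -/
def GraphDom (T : H →ₗ.[ℂ] H) : Type _ := T.domain

namespace GraphDom

variable (T : H →ₗ.[ℂ] H)

instance : AddCommGroup (GraphDom T) := inferInstanceAs (AddCommGroup T.domain)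

instance : Module ℂ (GraphDom T) := inferInstanceAs (Module ℂ T.domain)

/-- The inclusion of `dom T` into `H`. -/
def inclₗ : GraphDom T →ₗ[ℂ] H := T.domain.subtype

/-- `T` as a linear map on its domain. -/
def applyₗ : GraphDom T →ₗ[ℂ] H := T.toFun

/-- The map `v ↦ (v, T v)`. -/
def toGraphₗ : GraphDom T →ₗ[ℂ] WithLp 2 (H × H) :=
  (WithLp.linearEquiv 2 ℂ (H × H)).symm.toLinearMap ∘ₗ (inclₗ T).prod (applyₗ T)

theorem toGraphₗ_injective : Function.Injective (toGraphₗ T) := by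
  intro x y hxy
  have h : ((inclₗ T).prod (applyₗ T)) x = ((inclₗ T).prod (applyₗ T)) y :=
    (WithLp.linearEquiv 2 ℂ (H × H)).symm.injective hxy
  exact Subtype.ext (congrArg Prod.fst h)

/-- The graph norm `‖v‖² = |v|² + |T v|²`. -/
instance : NormedAddCommGroup (GraphDom T) :=
  NormedAddCommGroup.induced (GraphDom T) (WithLp 2 (H × H)) (toGraphₗ T) (toGraphₗ_injective T)

instance : NormedSpace ℂ (GraphDom T) :=
  NormedSpace.induced ℂ (GraphDom T) (WithLp 2 (H × H)) (toGraphₗ T)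

theorem norm_sq (v : GraphDom T) : ‖v‖ ^ 2 = ‖inclₗ T v‖ ^ 2 + ‖applyₗ T v‖ ^ 2 :=
  WithLp.prod_norm_sq_eq_of_L2 (toGraphₗ T v)

/-- The inclusion of `dom T` into `H`, as a bounded operator. -/
def incl : GraphDom T →L[ℂ] H :=
  (inclₗ T).mkContinuous 1 fun v => by
    have h := norm_sq T v
    have h0 := norm_nonneg v
    rw [one_mul]
    exact abs_le_of_sq_le_sq' (by nlinarith [sq_nonneg ‖applyₗ T v‖]) h0 |>.2

/-- `T` as a bounded operator from `dom T` to `H`. -/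
def apply : GraphDom T →L[ℂ] H :=
  (applyₗ T).mkContinuous 1 fun v => by
    have h := norm_sq T v
    have h0 := norm_nonneg v
    rw [one_mul]
    exact abs_le_of_sq_le_sq' (by nlinarith [sq_nonneg ‖inclₗ T v‖]) h0 |>.2

end GraphDom

variable [CompleteSpace H]

/-- The space `(dom A^*)'`, the dual of `dom A^*` with the graph norm. It is realised by continuous
antilinear functionals, so that the embedding of `H` (identified with its dual) is linear. -/
abbrev Extrap (A : H →ₗ.[ℂ] H) : Type _ := GraphDom A.adjoint →L⋆[ℂ] ℂ

/-- The embedding `H → (dom A^*)'`, `(j x)(v) = ⟨v, x⟩` (antilinear in `v`, linear in `x`). -/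
def embed (A : H →ₗ.[ℂ] H) : H →L[ℂ] Extrap A :=
  ((ContinuousLinearMap.compSL (GraphDom A.adjoint) H ℂ (RingHom.id ℂ) (starRingEnd ℂ)).flip
    (GraphDom.incl A.adjoint)).comp (innerSLFlip ℂ)

/-- The extension `𝒜 = (A^*)' : H → (dom A^*)'` of `A`, `(𝒜 x)(v) = ⟨A^* v, x⟩`. -/
def extend (A : H →ₗ.[ℂ] H) : H →L[ℂ] Extrap A :=
  ((ContinuousLinearMap.compSL (GraphDom A.adjoint) H ℂ (RingHom.id ℂ) (starRingEnd ℂ)).flip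
    (GraphDom.apply A.adjoint)).comp (innerSLFlip ℂ)

theorem embed_apply (A : H →ₗ.[ℂ] H) (x : H) (v : GraphDom A.adjoint) :
    embed A x v = inner ℂ (GraphDom.incl A.adjoint v) x := rfl

theorem extend_apply (A : H →ₗ.[ℂ] H) (x : H) (v : GraphDom A.adjoint) :
    extend A x v = inner ℂ (GraphDom.apply A.adjoint v) x := rfl

/-- The graph of `𝒜`, as an unbounded operator in `(dom A^*)'` with domain `H`. -/
def extendGraph (A : H →ₗ.[ℂ] H) : Set (Extrap A × Extrap A) :=
  Set.range fun x : H => (embed A x, extend A x)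

variable {U : Type*} [NormedAddCommGroup U] [InnerProductSpace ℂ U]

/-- The regularity hypothesis on the pair `(A, B)`, where `S' = e^{𝒜t}`: for every `T > 0` the
transformation `u ↦ ∫_0^t e^{𝒜(t-s)} B u(s) ds` is linear and continuous from `L²(0,T;U)` to
`L²(0,T;H)`. (The integral is a Bochner integral in `(dom A^*)'`.) -/
def RegularityHypothesis (A : H →ₗ.[ℂ] H) (S' : C0Semigroup (Extrap A)) (B : U →L[ℂ] Extrap A) :
    Prop :=
  ∀ T : ℝ, 0 < T →
    ∃ L : Lp U 2 (volume.restrict (Ioo 0 T)) →L[ℂ] Lp H 2 (volume.restrict (Ioo 0 T)),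
      ∀ u : Lp U 2 (volume.restrict (Ioo 0 T)), ∀ᵐ t ∂(volume.restrict (Ioo 0 T)),
        IntervalIntegrable (fun s => S'.op (t - s) (B (u s))) volume 0 t ∧
        embed A (L u t) = ∫ s in (0)..t, S'.op (t - s) (B (u s))

/-- `y ∈ L²(0,T;H)` is the solution of `ẏ = 𝒜 y + B u`, `y(0) = y₀` on `(0,T)`:
`y(t) = e^{At} y₀ + ∫_0^t e^{𝒜(t-s)} B u(s) ds` in `(dom A^*)'`. -/
def IsMildSolution (A : H →ₗ.[ℂ] H) (S : C0Semigroup H) (S' : C0Semigroup (Extrap A))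
    (B : U →L[ℂ] Extrap A) (T : ℝ) (y₀ : H) (u : ℝ → U) (y : ℝ → H) : Prop :=
  MemLp y 2 (volume.restrict (Ioo 0 T)) ∧
    ∀ᵐ t ∂(volume.restrict (Ioo 0 T)),
      IntervalIntegrable (fun s => S'.op (t - s) (B (u s))) volume 0 t ∧
      embed A (y t) = embed A (S.op t y₀) + ∫ s in (0)..t, S'.op (t - s) (B (u s))

end Abstract

/-! ## The coupled parabolic system -/

/-- `L²(0,π;E)`. -/
abbrev L2 (E : Type*) [NormedAddCommGroup E] : Type _ :=
  Lp E 2 (volume.restrict (Ioo (0 : ℝ) Real.pi))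

/-- `g ∈ L²(0,π;E)` is the weak derivative of `f ∈ L²(0,π;E)`. -/
def IsWeakDeriv {E : Type*} [NormedAddCommGroup E] [NormedSpace ℝ E] (f g : L2 E) : Prop :=
  ∀ η : ℝ → ℝ, ContDiff ℝ ((⊤ : ℕ∞) : WithTop ℕ∞) η → HasCompactSupport η → tsupport η ⊆ Ioo 0 Real.pi →
    ∫ x in Ioo (0 : ℝ) Real.pi, deriv η x • f x = -∫ x in Ioo (0 : ℝ) Real.pi, η x • g x

/-- `f` has a representative that is continuous on `[0,π]` and takes the value `v` at `x`. -/
def HasTrace {E : Type*} [NormedAddCommGroup E] (f : L2 E) (x : ℝ) (v : E) : Prop :=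
  ∃ F : ℝ → E, ContinuousOn F (Icc 0 Real.pi) ∧
    (f =ᵐ[volume.restrict (Ioo (0 : ℝ) Real.pi)] F) ∧ F x = v

/-- `f ∈ H²(0,π;E) ∩ H¹₀(0,π;E)`, with weak derivatives `f'` and `f''`. -/
structure IsH2H10 {E : Type*} [NormedAddCommGroup E] [NormedSpace ℝ E] (f f' f'' : L2 E) :
    Prop where
  deriv₁ : IsWeakDeriv f f'
  deriv₂ : IsWeakDeriv f' f''
  trace_zero : HasTrace f 0 0
  trace_pi : HasTrace f Real.pi 0

/-- Pointwise multiplication by a constant `2 × 2` matrix on `L²(0,π)²`. -/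
def matMul {𝕜 : Type*} [RCLike 𝕜] (M : Matrix (Fin 2) (Fin 2) 𝕜) :
    L2 (EuclideanSpace 𝕜 (Fin 2)) →L[𝕜] L2 (EuclideanSpace 𝕜 (Fin 2)) :=
  (Matrix.toEuclideanCLM (n := Fin 2) (𝕜 := 𝕜) M).compLpL 2 _

/-- The state space `H = L²(0,π;ℂ)²`. -/
abbrev StateC : Type := L2 (EuclideanSpace ℂ (Fin 2))

/-- The real space `L²(0,π)²`. -/
abbrev StateR : Type := L2 (EuclideanSpace ℝ (Fin 2))

/-- A real matrix, seen as a complex one. -/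
def matC (A₀ : Matrix (Fin 2) (Fin 2) ℝ) : Matrix (Fin 2) (Fin 2) ℂ := A₀.map Complex.ofReal

/-- The inclusion `ℝ² → ℂ²`. -/
def vecC : EuclideanSpace ℝ (Fin 2) →L[ℝ] EuclideanSpace ℂ (Fin 2) :=
  LinearMap.toContinuousLinearMap
    { toFun := fun v => WithLp.toLp 2 fun i => (v i : ℂ)
      map_add' := fun v w => by ext i; simp
      map_smul' := fun c v => by ext i; simp }

/-- The inclusion `L²(0,π)² → L²(0,π;ℂ)²`. -/
def stateC : StateR →L[ℝ] StateC := vecC.compLpL 2 _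

section WeakDeriv

variable {E : Type*} [NormedAddCommGroup E] [NormedSpace ℝ E]

theorem integrableOn_smul {η : ℝ → ℝ} (hη : Continuous η) (hc : HasCompactSupport η) (f : L2 E) :
    Integrable (fun x => η x • f x) (volume.restrict (Ioo (0 : ℝ) Real.pi)) := by
  have hf : Integrable f (volume.restrict (Ioo (0 : ℝ) Real.pi)) :=
    (Lp.memLp f).integrable (by norm_num)
  obtain ⟨C, hC⟩ := hη.bounded_above_of_compact_support hc
  exact hf.bdd_smul C hη.aestronglyMeasurable (Eventually.of_forall hC)

theorem IsWeakDeriv.add {f g f' g' : L2 E} (hf : IsWeakDeriv f f') (hg : IsWeakDeriv g g') :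
    IsWeakDeriv (f + g) (f' + g') := by
  intro η h1 h2 h3
  have hd : Continuous (deriv η) := h1.continuous_deriv (by simp)
  have e1 : ∫ x in Ioo (0 : ℝ) Real.pi, deriv η x • (f + g) x =
      ∫ x in Ioo (0 : ℝ) Real.pi, (deriv η x • f x + deriv η x • g x) := by
    refine integral_congr_ae ?_
    filter_upwards [Lp.coeFn_add f g] with x hx
    rw [hx, Pi.add_apply, smul_add]
  have e2 : ∫ x in Ioo (0 : ℝ) Real.pi, η x • (f' + g') x =
      ∫ x in Ioo (0 : ℝ) Real.pi, (η x • f' x + η x • g' x) := by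
    refine integral_congr_ae ?_
    filter_upwards [Lp.coeFn_add f' g'] with x hx
    rw [hx, Pi.add_apply, smul_add]
  rw [e1, e2, integral_add (integrableOn_smul hd h2.deriv f) (integrableOn_smul hd h2.deriv g),
    integral_add (integrableOn_smul h1.continuous h2 f') (integrableOn_smul h1.continuous h2 g'),
    hf η h1 h2 h3, hg η h1 h2 h3, neg_add]

theorem IsWeakDeriv.smul {𝕜 : Type*} [RCLike 𝕜] [NormedSpace 𝕜 E] [SMulCommClass ℝ 𝕜 E]
    {f f' : L2 E} (hf : IsWeakDeriv f f') (c : 𝕜) : IsWeakDeriv (c • f) (c • f') := by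
  intro η h1 h2 h3
  have e1 : ∫ x in Ioo (0 : ℝ) Real.pi, deriv η x • (c • f) x =
      ∫ x in Ioo (0 : ℝ) Real.pi, c • (deriv η x • f x) := by
    refine integral_congr_ae ?_
    filter_upwards [Lp.coeFn_smul c f] with x hx
    rw [hx, Pi.smul_apply, smul_comm]
  have e2 : ∫ x in Ioo (0 : ℝ) Real.pi, η x • (c • f') x =
      ∫ x in Ioo (0 : ℝ) Real.pi, c • (η x • f' x) := by
    refine integral_congr_ae ?_
    filter_upwards [Lp.coeFn_smul c f'] with x hx
    rw [hx, Pi.smul_apply, smul_comm]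
  rw [e1, e2, integral_smul, integral_smul, hf η h1 h2 h3, smul_neg]

theorem IsWeakDeriv.zero : IsWeakDeriv (0 : L2 E) 0 := by
  have h0 : ∀ ζ : ℝ → ℝ, ∫ x in Ioo (0 : ℝ) Real.pi, ζ x • (0 : L2 E) x = 0 := by
    intro ζ
    refine integral_eq_zero_of_ae ?_
    filter_upwards [Lp.coeFn_zero E 2 (volume.restrict (Ioo (0 : ℝ) Real.pi))] with x hx
    rw [hx]
    simp
  intro η _ _ _
  rw [h0, h0, neg_zero]

/-- A weak derivative of `0` vanishes. -/
theorem IsWeakDeriv.eq_zero [CompleteSpace E] {g : L2 E} (h : IsWeakDeriv (0 : L2 E) g) :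
    g = 0 := by
  have hint : Integrable g (volume.restrict (Ioo (0 : ℝ) Real.pi)) :=
    (Lp.memLp g).integrable (by norm_num)
  have key : ∀ᵐ x : ℝ, x ∈ Ioo (0 : ℝ) Real.pi → g x = 0 := by
    refine isOpen_Ioo.ae_eq_zero_of_integral_contDiff_smul_eq_zero
      (IntegrableOn.locallyIntegrableOn hint) ?_
    intro η h1 h2 h3
    have h4 := h η h1 h2 h3
    have h5 : ∫ x in Ioo (0 : ℝ) Real.pi, deriv η x • (0 : L2 E) x = 0 := by
      refine integral_eq_zero_of_ae ?_
      filter_upwards [Lp.coeFn_zero E 2 (volume.restrict (Ioo (0 : ℝ) Real.pi))] with x hx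
      rw [hx]
      simp
    rw [h5, eq_comm, neg_eq_zero] at h4
    rw [← h4, setIntegral_eq_integral_of_forall_compl_eq_zero]
    intro x hx
    have : η x = 0 := by
      by_contra hne
      exact hx (h3 (subset_tsupport η hne))
    rw [this, zero_smul]
  refine Lp.ext ?_
  have key' := (ae_restrict_iff' (μ := volume) measurableSet_Ioo).2 key
  filter_upwards [key', Lp.coeFn_zero E 2 (volume.restrict (Ioo (0 : ℝ) Real.pi))] with x hx hx0
  rw [hx, hx0, Pi.zero_apply]

end WeakDeriv

section Trace

variable {E : Type*} [NormedAddCommGroup E]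

theorem HasTrace.add {f g : L2 E} {x : ℝ} {v w : E} (hf : HasTrace f x v) (hg : HasTrace g x w) :
    HasTrace (f + g) x (v + w) := by
  obtain ⟨F, hF, hfF, rfl⟩ := hf
  obtain ⟨G, hG, hgG, rfl⟩ := hg
  exact ⟨F + G, hF.add hG, (Lp.coeFn_add f g).trans (hfF.add hgG), rfl⟩

theorem HasTrace.smul {𝕜 : Type*} [RCLike 𝕜] [NormedSpace 𝕜 E] {f : L2 E} {x : ℝ} {v : E}
    (hf : HasTrace f x v) (c : 𝕜) : HasTrace (c • f) x (c • v) := by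
  obtain ⟨F, hF, hfF, rfl⟩ := hf
  exact ⟨c • F, hF.const_smul c, (Lp.coeFn_smul c f).trans (hfF.const_smul c), rfl⟩

theorem HasTrace.zero (x : ℝ) : HasTrace (0 : L2 E) x 0 :=
  ⟨0, continuousOn_const, Lp.coeFn_zero E 2 _, rfl⟩

end Trace

/-- The graph of the operator `A f = f'' + A₀ f` with
`dom A = H²(0,π;ℂ)² ∩ H¹₀(0,π;ℂ)²`. -/
def parabolicGraph (A₀ : Matrix (Fin 2) (Fin 2) ℝ) : Submodule ℂ (StateC × StateC) where
  carrier := {p | ∃ f' f'' : StateC, IsH2H10 p.1 f' f'' ∧ p.2 = f'' + matMul (matC A₀) p.1}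
  add_mem' := by
    rintro p q ⟨f', f'', hf, hp⟩ ⟨g', g'', hg, hq⟩
    refine ⟨f' + g', f'' + g'', ⟨hf.deriv₁.add hg.deriv₁, hf.deriv₂.add hg.deriv₂, ?_, ?_⟩, ?_⟩
    · simpa using hf.trace_zero.add hg.trace_zero
    · simpa using hf.trace_pi.add hg.trace_pi
    · rw [Prod.snd_add, Prod.fst_add, hp, hq, map_add]
      abel
  zero_mem' := ⟨0, 0, ⟨IsWeakDeriv.zero, IsWeakDeriv.zero, HasTrace.zero _, HasTrace.zero _⟩,
    by simp⟩
  smul_mem' := by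
    rintro c p ⟨f', f'', hf, hp⟩
    refine ⟨c • f', c • f'', ⟨hf.deriv₁.smul c, hf.deriv₂.smul c, ?_, ?_⟩, ?_⟩
    · simpa using hf.trace_zero.smul c
    · simpa using hf.trace_pi.smul c
    · rw [Prod.smul_snd, Prod.smul_fst, hp, map_smul, smul_add]

/-- The operator `A f = f'' + A₀ f` in `H = L²(0,π;ℂ)²` with
`dom A = H²(0,π;ℂ)² ∩ H¹₀(0,π;ℂ)²`. -/
def parabolicOp (A₀ : Matrix (Fin 2) (Fin 2) ℝ) : StateC →ₗ.[ℂ] StateC :=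
  (parabolicGraph A₀).toLinearPMap

/-- The graph of `parabolicOp A₀` is the prescribed one. -/
theorem parabolicOp_graph (A₀ : Matrix (Fin 2) (Fin 2) ℝ) :
    (parabolicOp A₀).graph = parabolicGraph A₀ := by
  refine Submodule.toLinearPMap_graph_eq _ ?_
  rintro ⟨f, g⟩ ⟨f', f'', hf, hg⟩ h0
  obtain rfl : f = 0 := h0
  have h1 : f' = 0 := hf.deriv₁.eq_zero
  subst h1
  have h2 : f'' = 0 := hf.deriv₂.eq_zero
  subst h2
  simpa using hg

/-- No number `ω + k²`, `k = 1, 2, …`, is an eigenvalue of `A₀`. -/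
def NonResonant (A₀ : Matrix (Fin 2) (Fin 2) ℝ) (ω : ℂ) : Prop :=
  ∀ k : ℕ, 1 ≤ k → (Matrix.scalar (Fin 2) (ω + (k : ℂ) ^ 2) - matC A₀).det ≠ 0

/-- `h ∈ C²([0,π];ℂ²)` solves `h'' + A₀ h = ω h` in `(0,π)`, `h(0) = a B₀`, `h(π) = 0`. -/
structure IsDirichletLift (A₀ : Matrix (Fin 2) (Fin 2) ℝ) (B₀ : EuclideanSpace ℝ (Fin 2)) (ω a : ℂ)
    (h : ℝ → EuclideanSpace ℂ (Fin 2)) : Prop where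
  contDiffOn : ContDiffOn ℝ 2 h (Icc 0 Real.pi)
  ode : ∀ x ∈ Ioo (0 : ℝ) Real.pi,
    deriv (deriv h) x + Matrix.toEuclideanCLM (n := Fin 2) (𝕜 := ℂ) (matC A₀) (h x) = ω • h x
  at_zero : h 0 = a • vecC B₀
  at_pi : h Real.pi = 0

/-- `φ ∈ L²(0,T;H²(0,π)²) ∩ C([0,T];H¹₀(0,π)²)` is the strong solution of the backward problem
`-φ_t - φ_xx = A₀^* φ + g` in `(0,π) × (0,T)`, `φ(0,·) = φ(π,·) = 0`, `φ(·,T) = 0`,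
with spatial derivative `φx`; functions on `(0,π) × (0,T)` are regarded as functions of
`t` with values in `L²(0,π)²`. -/
structure IsStrongAdjointSolution (A₀ : Matrix (Fin 2) (Fin 2) ℝ) (T : ℝ)
    (g φ φx : ℝ → StateR) : Prop where
  /-- `φ ∈ C([0,T];H¹₀)` -/
  deriv_x : ∀ t ∈ Icc 0 T, IsWeakDeriv (φ t) (φx t)
  trace_zero : ∀ t ∈ Icc 0 T, HasTrace (φ t) 0 0
  trace_pi : ∀ t ∈ Icc 0 T, HasTrace (φ t) Real.pi 0
  cont : ContinuousOn φ (Icc 0 T)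
  cont_x : ContinuousOn φx (Icc 0 T)
  /-- `φ ∈ L²(0,T;H²)`, `φ_t ∈ L²(0,T;L²)` and the equation holds almost everywhere -/
  eqn : ∃ φxx φt : ℝ → StateR,
    MemLp φxx 2 (volume.restrict (Ioo 0 T)) ∧ MemLp φt 2 (volume.restrict (Ioo 0 T)) ∧
    (∀ᵐ t ∂(volume.restrict (Ioo 0 T)), IsWeakDeriv (φx t) (φxx t)) ∧
    (∀ t ∈ Icc 0 T, φ t = φ 0 + ∫ s in (0)..t, φt s) ∧
    ∀ᵐ t ∂(volume.restrict (Ioo 0 T)), -φt t - φxx t = matMul A₀.transpose (φ t) + g t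
  final : φ T = 0

/-- `y ∈ L²(0,T;L²(0,π)²) = L²(Q)²` is a solution by transposition of the boundary control system
`y_t - y_xx = A₀ y` in `Q = (0,π) × (0,T)`, `y(0,·) = B₀ u`, `y(π,·) = 0`, `y(·,0) = y₀`:
`∫_Q y · g dx dt = ⟨y₀, φ(·,0)⟩ + ∫_0^T B₀ · φ_x(0,t) u(t) dt` for every `g ∈ L²(Q)²`, where `φ` is
the strong solution of the backward problem with right-hand side `g`. -/
def IsTranspositionSolution (A₀ : Matrix (Fin 2) (Fin 2) ℝ) (B₀ : EuclideanSpace ℝ (Fin 2))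
    (T : ℝ) (y₀ : StateR) (u : ℝ → ℝ) (y : ℝ → StateR) : Prop :=
  MemLp y 2 (volume.restrict (Ioo 0 T)) ∧
    ∀ g : ℝ → StateR, MemLp g 2 (volume.restrict (Ioo 0 T)) →
      ∀ (φ φx : ℝ → StateR) (p : ℝ → EuclideanSpace ℝ (Fin 2)),
        IsStrongAdjointSolution A₀ T g φ φx →
        (∀ᵐ t ∂(volume.restrict (Ioo 0 T)), HasTrace (φx t) 0 (p t)) →
        ∫ t in Ioo 0 T, inner ℝ (y t) (g t) =
          inner ℝ y₀ (φ 0) + ∫ t in Ioo 0 T, inner ℝ B₀ (p t) * u t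

end BoundaryControl

end

open MeasureTheory Set Filter Topology

noncomputable section

set_option linter.unusedSectionVars false

namespace BoundaryControl

/-! ## Integration by parts for primitives -/

section IntegrationByParts

variable {E F G : Type*} [NormedAddCommGroup E] [NormedSpace ℝ E] [NormedAddCommGroup F] [NormedSpace ℝ F] [CompleteSpace F]
  [NormedAddCommGroup G] [NormedSpace ℝ G] [CompleteSpace G]

/-! Everything is diagonalised by the orthonormal functions √(2/π) sin((k+1)x), complete in L² by
Weierstrass approximation. In sine coefficients, A is the sequence of 2×2 blocks a - (k+1)² with a =
A₀ (`mem_parabolicGraph_iff`). Hence e^{At} has blocks e^{t(a-(k+1)²)} (`heatOp`). The resolvent has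
blocks of size O((k+1)⁻²) and is a norm limit of finite rank operators
(`NonResonant.exists_resolvent`). The modes with large k decay and form H_s. The finitely many
others form H_1, where generalized eigenvectors of the matrix a span each mode
(`spectralHypothesis_parabolicOp`).

For ω in the resolvent set, ω - 𝒜 is an isomorphism of H onto (dom A^*)' by Riesz representation
(`shiftEquiv`), and e^{𝒜t} is e^{At} conjugated by it. Green's formula shows that the coefficients
d_k of D_ω 1 satisfy (ω - a + (k+1)²) d_k = √(2/π)(k+1) B₀. The right-hand side does not involve ω,
so neither does B = (ω - 𝒜)D_ω (`IsDirichletMap.shift_comp_eq`).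

For t > 0, e^{𝒜t}B is a genuine element of H, the `boundaryKernel` with coefficients e^{t(a-(k+1)²)}
√(2/π)(k+1) B₀. From e^{-x} ≤ x^{-(1-θ)} these are bounded by a constant times t^{-(1-θ)}
(k+1)^{-1+2θ}, which is square summable in k when θ < 1/4. This yields the singular estimate. It
also makes the kernel integrable in time, so Young's inequality L¹ * L² ⊆ L² gives the regularity of
u ↦ ∫ e^{𝒜(t-s)}Bu(s) ds.

The transposition identity is integration by parts in time on each mode (`integral_inner_mode`),
summed by Parseval. The trace φ_x(0,t) enters through φ_x(0) = -∫ (1 - x/π) φ_xx dx, which makes the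
boundary term an L² pairing. For uniqueness it suffices to test with g = η(t) sin((k+1)x) c, whose
adjoint solution is explicit and lives on one mode. -/

theorem intervalIntegral_eq_integral_indicator_Iic (h : ℝ → E) {a b t : ℝ} (ht : t ∈ Ioc a b) :
    ∫ s in a..t, h s = ∫ s in Ioc a b, (Iic t).indicator h s := by
  rw [intervalIntegral.integral_of_le ht.1.le, integral_indicator measurableSet_Iic,
    Measure.restrict_restrict measurableSet_Iic]
  congr 2
  ext s
  simp only [mem_Ioc, mem_inter_iff, mem_Iic]
  exact ⟨fun h => ⟨h.2, h.1, h.2.trans ht.2⟩, fun h => ⟨h.2.1, h.1⟩⟩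

/-- The diagonal is a null set. The strict version is needed so that the two triangles in
`integral_bilin_primitive` are exact complements. -/
theorem intervalIntegral_eq_integral_indicator_Iio (h : ℝ → E) {a b t : ℝ} (ht : t ∈ Ioc a b) :
    ∫ s in a..t, h s = ∫ s in Ioc a b, (Iio t).indicator h s := by
  rw [intervalIntegral_eq_integral_indicator_Iic h ht, integral_indicator measurableSet_Iic,
    integral_indicator measurableSet_Iio]
  refine setIntegral_congr_set ?_
  exact ae_restrict_of_ae (Iio_ae_eq_Iic (μ := volume) (a := t)).symm

variable [CompleteSpace E]

/-- Fubini: the square splits into the triangle s ≤ t and its complement, and the two terms on the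
left are the integrals of B(f'(t), g'(s)) over these pieces. -/
theorem integral_bilin_primitive (B : E →L[ℝ] F →L[ℝ] G) {a b : ℝ} (hab : a ≤ b)
    {f' : ℝ → E} {g' : ℝ → F}
    (hf : IntervalIntegrable f' volume a b) (hg : IntervalIntegrable g' volume a b) :
    (∫ t in a..b, B (f' t) (∫ s in a..t, g' s)) + (∫ t in a..b, B (∫ s in a..t, f' s) (g' t)) =
      B (∫ t in a..b, f' t) (∫ t in a..b, g' t) := by
  have hf1 : Integrable f' (volume.restrict (Ioc a b)) :=
    (intervalIntegrable_iff_integrableOn_Ioc_of_le hab).1 hf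
  have hg1 : Integrable g' (volume.restrict (Ioc a b)) :=
    (intervalIntegrable_iff_integrableOn_Ioc_of_le hab).1 hg
  set μ : Measure ℝ := volume.restrict (Ioc a b) with hμ
  have hint : Integrable (fun p : ℝ × ℝ => B (f' p.1) (g' p.2)) (μ.prod μ) :=
    hf1.op_fst_snd (op := fun x y => B x y) (by fun_prop) ⟨‖B‖, B.le_opNorm₂⟩ hg1
  have hS : MeasurableSet {p : ℝ × ℝ | p.2 ≤ p.1} := measurableSet_le measurable_snd measurable_fst
  have hint1 := hint.indicator hS
  have hint2 := hint.indicator hS.compl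
  have e1 : (∫ t in a..b, B (f' t) (∫ s in a..t, g' s)) =
      ∫ p, {p : ℝ × ℝ | p.2 ≤ p.1}.indicator (fun p : ℝ × ℝ => B (f' p.1) (g' p.2)) p ∂(μ.prod μ) := by
    rw [intervalIntegral.integral_of_le hab, integral_prod _ hint1]
    refine setIntegral_congr_fun measurableSet_Ioc fun t ht => ?_
    rw [intervalIntegral_eq_integral_indicator_Iic g' ht, ← ContinuousLinearMap.integral_comp_comm _ (hg1.indicator measurableSet_Iic)]
    refine integral_congr_ae (Eventually.of_forall fun s => ?_)
    by_cases hs : s ≤ t <;> simp [indicator, hs]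
  have e2 : (∫ t in a..b, B (∫ s in a..t, f' s) (g' t)) =
      ∫ p, {p : ℝ × ℝ | p.2 ≤ p.1}ᶜ.indicator (fun p : ℝ × ℝ => B (f' p.1) (g' p.2)) p ∂(μ.prod μ) := by
    rw [intervalIntegral.integral_of_le hab, integral_prod_symm _ hint2]
    refine setIntegral_congr_fun measurableSet_Ioc fun t ht => ?_
    rw [intervalIntegral_eq_integral_indicator_Iio f' ht]
    have := ContinuousLinearMap.integral_comp_comm (B.flip (g' t)) (hf1.indicator (measurableSet_Iio (a := t)))
    rw [ContinuousLinearMap.flip_apply] at this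
    rw [← this]
    refine integral_congr_ae (Eventually.of_forall fun s => ?_)
    by_cases hs : s < t
    · simp [indicator, hs]
    · simp [indicator, hs, not_lt.1 hs]
  rw [e1, e2, ← integral_add hint1 hint2]
  have e3 : ∀ p, {p : ℝ × ℝ | p.2 ≤ p.1}.indicator (fun p : ℝ × ℝ => B (f' p.1) (g' p.2)) p +
      {p : ℝ × ℝ | p.2 ≤ p.1}ᶜ.indicator (fun p : ℝ × ℝ => B (f' p.1) (g' p.2)) p =
      B (f' p.1) (g' p.2) := fun p => by
    by_cases hp : p ∈ {p : ℝ × ℝ | p.2 ≤ p.1}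
    · rw [indicator_of_mem hp, indicator_of_notMem (by simpa using hp), add_zero]
    · rw [indicator_of_notMem hp, indicator_of_mem hp, zero_add]
  simp_rw [e3]
  rw [integral_prod _ hint, intervalIntegral.integral_of_le hab, intervalIntegral.integral_of_le hab]
  have e4 : ∀ t, ∫ s, B (f' t) (g' s) ∂μ = B (f' t) (∫ s, g' s ∂μ) := fun t =>
    ContinuousLinearMap.integral_comp_comm _ hg1
  simp_rw [e4]
  exact ContinuousLinearMap.integral_comp_comm (B.flip (∫ s, g' s ∂μ)) hf1

/-- Integration by parts for a bilinear map and two absolutely continuous functions. -/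
theorem integral_bilin_by_parts (B : E →L[ℝ] F →L[ℝ] G) {a b : ℝ} (hab : a ≤ b)
    {f f' : ℝ → E} {g g' : ℝ → F}
    (hf : IntervalIntegrable f' volume a b) (hg : IntervalIntegrable g' volume a b)
    (hf1 : ∀ t ∈ Icc a b, f t = f a + ∫ s in a..t, f' s)
    (hg1 : ∀ t ∈ Icc a b, g t = g a + ∫ s in a..t, g' s) :
    (∫ t in a..b, (B (f' t) (g t) + B (f t) (g' t))) = B (f b) (g b) - B (f a) (g a) := by
  have hab' : uIcc a b = Icc a b := uIcc_of_le hab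
  have cf : ContinuousOn (fun t => ∫ s in a..t, f' s) (uIcc a b) :=
    intervalIntegral.continuousOn_primitive_interval (by rwa [← intervalIntegrable_iff'])
  have cg : ContinuousOn (fun t => ∫ s in a..t, g' s) (uIcc a b) :=
    intervalIntegral.continuousOn_primitive_interval (by rwa [← intervalIntegrable_iff'])
  have i0 : ∀ y : F, IntervalIntegrable (fun t => B (f' t) y) volume a b := fun y =>
    ⟨(B.flip y).integrable_comp hf.1, (B.flip y).integrable_comp hf.2⟩
  have i0' : ∀ y : E, IntervalIntegrable (fun t => B y (g' t)) volume a b := fun y =>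
    ⟨(B y).integrable_comp hg.1, (B y).integrable_comp hg.2⟩
  have i1 : IntervalIntegrable (fun t => B (f' t) (∫ s in a..t, g' s)) volume a b := by
    rw [intervalIntegrable_iff_integrableOn_Ioc_of_le hab] at hf ⊢
    have cg' := (hab' ▸ cg)
    obtain ⟨C, hC⟩ := isCompact_Icc.exists_bound_of_continuousOn cg'
    refine (hf.norm.const_mul (‖B‖ * C)).mono' ?_ ?_
    · exact B.aestronglyMeasurable_comp₂ hf.1
        ((cg'.mono Ioc_subset_Icc_self).aestronglyMeasurable measurableSet_Ioc)
    · filter_upwards [ae_restrict_mem measurableSet_Ioc] with t ht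
      refine (B.le_opNorm₂ _ _).trans ?_
      have := hC t (Ioc_subset_Icc_self ht)
      calc _ ≤ ‖B‖ * ‖f' t‖ * C := by gcongr
        _ = _ := by ring
  have i2 : IntervalIntegrable (fun t => B (∫ s in a..t, f' s) (g' t)) volume a b := by
    rw [intervalIntegrable_iff_integrableOn_Ioc_of_le hab] at hg ⊢
    have cf' := (hab' ▸ cf)
    obtain ⟨C, hC⟩ := isCompact_Icc.exists_bound_of_continuousOn cf'
    refine (hg.norm.const_mul (‖B‖ * C)).mono' ?_ ?_
    · exact B.aestronglyMeasurable_comp₂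
        ((cf'.mono Ioc_subset_Icc_self).aestronglyMeasurable measurableSet_Ioc) hg.1
    · filter_upwards [ae_restrict_mem measurableSet_Ioc] with t ht
      refine (B.le_opNorm₂ _ _).trans ?_
      have := hC t (Ioc_subset_Icc_self ht)
      gcongr
  -- With the initial values split off, only the product of the two primitives vanishing at a needs
  -- Fubini; the other terms are linear in f' or g'.
  have e : ∀ t ∈ Icc a b, B (f' t) (g t) + B (f t) (g' t) =
      B (f' t) (g a) + B (f a) (g' t) +
        (B (f' t) (∫ s in a..t, g' s) + B (∫ s in a..t, f' s) (g' t)) := fun t ht => by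
    rw [hf1 t ht, hg1 t ht]
    simp only [map_add, add_apply]
    abel
  rw [intervalIntegral.integral_congr (fun t ht => e t (hab' ▸ ht)),
    intervalIntegral.integral_add ((i0 _).add (i0' _)) (i1.add i2),
    intervalIntegral.integral_add (i0 _) (i0' _), intervalIntegral.integral_add i1 i2,
    integral_bilin_primitive B hab hf hg,
    (B (f a)).intervalIntegral_comp_comm hg]
  have := (B.flip (g a)).intervalIntegral_comp_comm hf
  simp only [ContinuousLinearMap.flip_apply] at this
  rw [this, hf1 b (right_mem_Icc.2 hab), hg1 b (right_mem_Icc.2 hab)]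
  simp only [map_add, add_apply]
  abel

end IntegrationByParts

/-! ## Completeness of the sine functions -/

section SineComplete

variable {E : Type*} [NormedAddCommGroup E] [NormedSpace ℝ E]

theorem integrableOn_continuous_smul {η : ℝ → ℝ} (hη : ContinuousOn η (Icc 0 Real.pi)) {f : ℝ → E}
    (hf : IntegrableOn f (Ioo 0 Real.pi)) :
    IntegrableOn (fun x => η x • f x) (Ioo 0 Real.pi) := by
  obtain ⟨C, hC⟩ := isCompact_Icc.exists_bound_of_continuousOn hη
  refine Integrable.bdd_smul hf C
    ((hη.mono Ioo_subset_Icc_self).aestronglyMeasurable measurableSet_Ioo) ?_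
  filter_upwards [ae_restrict_mem measurableSet_Ioo] with x hx using hC x (Ioo_subset_Icc_self hx)

/-- Induction on n by 2 cos x sin kx = sin((k+1)x) + sin((k-1)x). The case k = 0 is set aside
because k - 1 is truncated there. -/
theorem integral_cos_pow_mul_sin_smul {f : ℝ → E} (hf : IntegrableOn f (Ioo 0 Real.pi))
    (h : ∀ k : ℕ, ∫ x in Ioo 0 Real.pi, Real.sin (k * x) • f x = 0) (n k : ℕ) :
    ∫ x in Ioo 0 Real.pi, (Real.cos x ^ n * Real.sin (k * x)) • f x = 0 := by
  induction n generalizing k with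
  | zero => simpa using h k
  | succ n ih =>
    rcases Nat.eq_zero_or_pos k with rfl | hk
    · simp
    have e : ∀ x : ℝ, (Real.cos x ^ (n + 1) * Real.sin (k * x)) • f x =
        (2⁻¹ : ℝ) • ((Real.cos x ^ n * Real.sin ((k + 1 : ℕ) * x)) • f x +
          (Real.cos x ^ n * Real.sin ((k - 1 : ℕ) * x)) • f x) := by
      intro x
      rw [← add_smul, smul_smul]
      congr 1
      have h1 : ((k + 1 : ℕ) : ℝ) * x = k * x + x := by push_cast; ring
      have h2 : ((k - 1 : ℕ) : ℝ) * x = k * x - x := by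
        rw [Nat.cast_sub hk]; push_cast; ring
      rw [h1, h2, Real.sin_add, Real.sin_sub, pow_succ]
      ring
    simp_rw [e]
    rw [integral_smul, integral_add, ih, ih]
    · simp
    all_goals exact integrableOn_continuous_smul (by fun_prop) hf

/-- Orthogonality to all cosⁿx sin x gives orthogonality to p(cos x) sin x for every polynomial p,
and by Weierstrass to η(x) sin x for every continuous η. Thus sin · f = 0 almost everywhere, and sin
> 0 inside the interval. -/
theorem ae_eq_zero_of_integral_sin_smul_eq_zero [CompleteSpace E] {f : ℝ → E}
    (hf : IntegrableOn f (Ioo 0 Real.pi))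
    (h : ∀ k : ℕ, ∫ x in Ioo 0 Real.pi, Real.sin (k * x) • f x = 0) :
    f =ᵐ[volume.restrict (Ioo 0 Real.pi)] 0 := by
  have hp : ∀ p : Polynomial ℝ,
      ∫ x in Ioo 0 Real.pi, (p.eval (Real.cos x) * Real.sin x) • f x = 0 := by
    intro p
    induction p using Polynomial.induction_on' with
    | add p q hp hq =>
      simp_rw [Polynomial.eval_add, add_mul, add_smul]
      rw [integral_add, hp, hq, add_zero]
      all_goals exact integrableOn_continuous_smul (by fun_prop) hf
    | monomial n c =>
      have := integral_cos_pow_mul_sin_smul hf h n 1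
      simp_rw [Polynomial.eval_monomial, mul_assoc, mul_smul c]
      rw [integral_smul]
      simp only [Nat.cast_one, one_mul] at this
      rw [this, smul_zero]
  have hc : ∀ η : ℝ → ℝ, Continuous η →
      ∫ x in Ioo 0 Real.pi, (η x * Real.sin x) • f x = 0 := by
    intro η hη
    rw [← norm_le_zero_iff]
    refine le_of_forall_pos_le_add fun ε hε => ?_
    set I := ∫ x in Ioo 0 Real.pi, ‖f x‖ with hI
    have hI0 : 0 ≤ I := integral_nonneg fun _ => norm_nonneg _
    -- The substitution y = cos x moves the approximation to [-1,1]. The denominator I + 1 stays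
    -- positive when f vanishes.
    obtain ⟨p, hpη⟩ := exists_polynomial_near_of_continuousOn (-1) 1 (fun y => η (Real.arccos y))
      (by fun_prop) (ε / (I + 1)) (by positivity)
    have e : ∫ x in Ioo 0 Real.pi, (η x * Real.sin x) • f x =
        ∫ x in Ioo 0 Real.pi, ((η x - p.eval (Real.cos x)) * Real.sin x) • f x := by
      simp_rw [sub_mul, sub_smul]
      rw [integral_sub, hp, sub_zero]
      all_goals exact integrableOn_continuous_smul (by fun_prop) hf
    rw [e, zero_add]
    calc _ ≤ ∫ x in Ioo 0 Real.pi, ε / (I + 1) * ‖f x‖ := by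
          refine norm_integral_le_of_norm_le (hf.norm.const_mul _) ?_
          filter_upwards [ae_restrict_mem measurableSet_Ioo] with x hx
          rw [norm_smul, norm_mul]
          gcongr
          have h1 := hpη (Real.cos x) ⟨Real.neg_one_le_cos x, Real.cos_le_one x⟩
          rw [Real.arccos_cos hx.1.le hx.2.le, abs_sub_comm] at h1
          have h2 : ‖Real.sin x‖ ≤ 1 := Real.abs_sin_le_one x
          calc _ ≤ ε / (I + 1) * 1 := by
                refine mul_le_mul h1.le h2 (norm_nonneg _) (by positivity)
            _ = _ := mul_one _
      _ = ε / (I + 1) * I := by rw [integral_const_mul]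
      _ ≤ ε := by
          rw [div_mul_eq_mul_div, div_le_iff₀ (by positivity)]
          nlinarith
  have hs : IntegrableOn (fun x => Real.sin x • f x) (Ioo 0 Real.pi) :=
    integrableOn_continuous_smul (by fun_prop) hf
  have key : ∀ᵐ x : ℝ, x ∈ Ioo (0 : ℝ) Real.pi → Real.sin x • f x = 0 := by
    refine isOpen_Ioo.ae_eq_zero_of_integral_contDiff_smul_eq_zero hs.locallyIntegrableOn ?_
    intro η h1 h2 h3
    rw [← hc η h1.continuous, setIntegral_eq_integral_of_forall_compl_eq_zero]
    · simp_rw [mul_smul]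
    intro x hx
    have : η x = 0 := by
      by_contra hne
      exact hx (h3 (subset_tsupport η hne))
    rw [this, zero_mul, zero_smul]
  have key' := (ae_restrict_iff' (μ := volume) measurableSet_Ioo).2 key
  filter_upwards [key', ae_restrict_mem measurableSet_Ioo] with x hx hx0
  exact (smul_eq_zero.1 hx).resolve_left (Real.sin_pos_of_pos_of_lt_pi hx0.1 hx0.2).ne'

end SineComplete

/-! ## Weak derivatives and absolutely continuous representatives -/

section WeakDerivPrimitive

variable {E : Type*} [NormedAddCommGroup E]

theorem integral_Ioo_eq_intervalIntegral [NormedSpace ℝ E] {a b : ℝ} (hab : a ≤ b) (f : ℝ → E) :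
    ∫ x in Ioo a b, f x = ∫ x in a..b, f x := by
  rw [intervalIntegral.integral_of_le hab, integral_Ioc_eq_integral_Ioo]

theorem L2_integrableOn (f : L2 E) : IntegrableOn f (Ioo 0 Real.pi) :=
  (Lp.memLp f).integrable (by norm_num)

theorem intervalIntegrable_of_integrableOn_Ioo {f : ℝ → E} {a b : ℝ} (hab : a ≤ b)
    (hf : IntegrableOn f (Ioo a b)) : IntervalIntegrable f volume a b :=
  (intervalIntegrable_iff_integrableOn_Ioo_of_le hab).2 hf

theorem L2_intervalIntegrable (f : L2 E) : IntervalIntegrable f volume 0 Real.pi :=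
  intervalIntegrable_of_integrableOn_Ioo Real.pi_pos.le (L2_integrableOn f)

theorem memLp_of_continuousOn_Icc {F : ℝ → E} {a b : ℝ} (hF : ContinuousOn F (Icc a b)) :
    MemLp F 2 (volume.restrict (Ioo a b)) := by
  obtain ⟨C, hC⟩ := isCompact_Icc.exists_bound_of_continuousOn hF
  refine MemLp.of_bound ?_ C ?_
  · exact (hF.mono Ioo_subset_Icc_self).aestronglyMeasurable measurableSet_Ioo
  · filter_upwards [ae_restrict_mem measurableSet_Ioo] with x hx using hC x (Ioo_subset_Icc_self hx)

theorem eq_of_ae_eq_of_continuousOn {F G : ℝ → E} {a b : ℝ} (hab : a < b)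
    (hF : ContinuousOn F (Icc a b))
    (hG : ContinuousOn G (Icc a b)) (h : F =ᵐ[volume.restrict (Ioo a b)] G) :
    EqOn F G (Icc a b) := by
  have h1 : EqOn F G (Ioo a b) :=
    Measure.eqOn_open_of_ae_eq h isOpen_Ioo (hF.mono Ioo_subset_Icc_self)
      (hG.mono Ioo_subset_Icc_self)
  have h2 : Icc a b ⊆ closure (Ioo a b) := by rw [closure_Ioo hab.ne]
  exact h1.of_subset_closure hF hG Ioo_subset_Icc_self h2

/-- Two continuous representatives agree up to the endpoints, so a trace may be read off from any of
them. -/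
theorem HasTrace.eq_of_ae_eq {f : L2 E} {x : ℝ} {v : E} (h : HasTrace f x v)
    (hx : x ∈ Icc 0 Real.pi) {F : ℝ → E} (hF : ContinuousOn F (Icc 0 Real.pi))
    (hfF : f =ᵐ[volume.restrict (Ioo (0 : ℝ) Real.pi)] F) : F x = v := by
  obtain ⟨G, hG, hfG, rfl⟩ := h
  exact eq_of_ae_eq_of_continuousOn Real.pi_pos hF hG (hfF.symm.trans hfG) hx

variable [NormedSpace ℝ E]

theorem continuousOn_primitive {g : ℝ → E} {a b : ℝ} (hab : a ≤ b)
    (hg : IntervalIntegrable g volume a b) (c : E) :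
    ContinuousOn (fun x => c + ∫ s in a..x, g s) (Icc a b) := by
  have := intervalIntegral.continuousOn_primitive_interval (μ := volume) (f := g) (a := a) (b := b)
    (by rwa [← intervalIntegrable_iff'])
  rw [uIcc_of_le hab] at this
  exact continuousOn_const.add this

variable [CompleteSpace E]

theorem integral_smul_by_parts {η η' : ℝ → ℝ} (hη : ∀ x, HasDerivAt η (η' x) x)
    (hη' : Continuous η') {a b : ℝ} (hab : a ≤ b) {G g : ℝ → E}
    (hg : IntervalIntegrable g volume a b) (hG : ∀ x ∈ Icc a b, G x = G a + ∫ s in a..x, g s) :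
    (∫ x in a..b, η' x • G x) = η b • G b - η a • G a - ∫ x in a..b, η x • g x := by
  have hη'i : ∀ x y, IntervalIntegrable η' volume x y := fun x y => hη'.intervalIntegrable x y
  have hGc : ContinuousOn G (uIcc a b) := by
    rw [uIcc_of_le hab]
    exact (continuousOn_primitive hab hg (G a)).congr hG
  have hηc : Continuous η := continuous_iff_continuousAt.2 fun x => (hη x).continuousAt
  have h := integral_bilin_by_parts (ContinuousLinearMap.lsmul ℝ ℝ (E := E)) hab (hη'i a b) hg
    (f := η) (g := G)
    (fun t _ => by rw [intervalIntegral.integral_eq_sub_of_hasDerivAt (fun x _ => hη x) (hη'i a t)]; ring)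
    hG
  simp only [ContinuousLinearMap.lsmul_apply] at h
  rw [← h, intervalIntegral.integral_add, add_sub_cancel_right]
  · exact (hη'.continuousOn.smul hGc).intervalIntegrable
  · exact hg.continuousOn_smul hηc.continuousOn

/-- A primitive of `g` has weak derivative `g`. -/
theorem isWeakDeriv_of_primitive {f g : L2 E} {F : ℝ → E}
    (hF : ∀ x ∈ Icc 0 Real.pi, F x = F 0 + ∫ s in (0)..x, g s)
    (hfF : f =ᵐ[volume.restrict (Ioo (0 : ℝ) Real.pi)] F) : IsWeakDeriv f g := by
  intro η h1 h2 h3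
  have hπ := Real.pi_pos.le
  have e1 : ∫ x in Ioo (0 : ℝ) Real.pi, deriv η x • f x =
      ∫ x in Ioo (0 : ℝ) Real.pi, deriv η x • F x := by
    refine integral_congr_ae ?_
    filter_upwards [hfF] with x hx
    rw [hx]
  have z : ∀ x ∉ Ioo 0 Real.pi, η x = 0 := fun x hx => by
    by_contra hne
    exact hx (h3 (subset_tsupport η hne))
  rw [e1, integral_Ioo_eq_intervalIntegral hπ, integral_Ioo_eq_intervalIntegral hπ,
    integral_smul_by_parts (fun x => (h1.differentiable (by simp) x).hasDerivAt)
      (h1.continuous_deriv (by simp)) hπ (L2_intervalIntegrable g) hF,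
    z 0 (by simp), z Real.pi (by simp)]
  simp

theorem isWeakDeriv_of_hasDerivAt {f g : L2 E} {F F' : ℝ → E} (hF : ∀ x, HasDerivAt F (F' x) x)
    (hF' : Continuous F') (hfF : f =ᵐ[volume.restrict (Ioo (0 : ℝ) Real.pi)] F)
    (hgF : g =ᵐ[volume.restrict (Ioo (0 : ℝ) Real.pi)] F') : IsWeakDeriv f g := by
  refine isWeakDeriv_of_primitive (F := F) (fun x hx => ?_) hfF
  have : ∫ s in (0)..x, g s = ∫ s in (0)..x, F' s := by
    rw [← integral_Ioo_eq_intervalIntegral hx.1, ← integral_Ioo_eq_intervalIntegral hx.1]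
    refine integral_congr_ae ?_
    exact ae_mono (Measure.restrict_mono (Ioo_subset_Ioo_right hx.2) le_rfl) hgF
  rw [this, intervalIntegral.integral_eq_sub_of_hasDerivAt (fun x _ => hF x)
    (hF'.intervalIntegrable _ _), add_sub_cancel]

/-- The primitive starting at 0 vanishes to the left of the support of θ trivially, and to the right
of it because the total integral is zero. -/
theorem exists_primitive_of_integral_eq_zero {θ : ℝ → ℝ}
    (h1 : ContDiff ℝ ((⊤ : ℕ∞) : WithTop ℕ∞) θ) (h2 : HasCompactSupport θ)
    (h3 : tsupport θ ⊆ Ioo 0 Real.pi) (h0 : ∫ x in Ioo (0 : ℝ) Real.pi, θ x = 0) :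
    ∃ η : ℝ → ℝ, ContDiff ℝ ((⊤ : ℕ∞) : WithTop ℕ∞) η ∧ HasCompactSupport η ∧
      tsupport η ⊆ Ioo 0 Real.pi ∧ deriv η = θ := by
  obtain ⟨α, β, hα, hβ, hαβ⟩ : ∃ α β : ℝ, 0 < α ∧ β < Real.pi ∧ tsupport θ ⊆ Icc α β := by
    rcases (tsupport θ).eq_empty_or_nonempty with he | hne
    -- For empty support the reversed bounds 1, 0 make the interval empty while satisfying both
    -- inequalities.
    · exact ⟨1, 0, one_pos, Real.pi_pos, by simp [he]⟩
    · obtain ⟨α, hα, hα'⟩ := h2.isCompact.exists_isLeast hne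
      obtain ⟨β, hβ, hβ'⟩ := h2.isCompact.exists_isGreatest hne
      exact ⟨α, β, (h3 hα).1, (h3 hβ).2, fun x hx => ⟨hα' hx, hβ' hx⟩⟩
  have z : ∀ x ∉ Icc α β, θ x = 0 := fun x hx => by
    by_contra hne
    exact hx (hαβ (subset_tsupport θ hne))
  have hd : ∀ x, HasDerivAt (fun x => ∫ s in (0)..x, θ s) (θ x) x := fun x =>
    intervalIntegral.integral_hasDerivAt_right (h1.continuous.intervalIntegrable _ _)
      (h1.continuous.stronglyMeasurableAtFilter _ _) h1.continuous.continuousAt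
  have hde : deriv (fun x => ∫ s in (0)..x, θ s) = θ := funext fun x => (hd x).deriv
  have hsupp : Function.support (fun x => ∫ s in (0)..x, θ s) ⊆ Icc α β := by
    intro x hx
    by_contra hxn
    refine hx ?_
    simp only [mem_Icc, not_and_or, not_le] at hxn
    rcases hxn with hxα | hxβ
    · refine (intervalIntegral.integral_congr (g := fun _ => 0) fun s hs => z s fun h => ?_).trans (by simp)
      have : s ≤ max 0 x := hs.2
      rcases le_max_iff.1 this with h' | h' <;> linarith [h.1]
    · rw [integral_Ioo_eq_intervalIntegral Real.pi_pos.le] at h0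
      have := intervalIntegral.integral_add_adjacent_intervals (a := 0) (b := x) (c := Real.pi)
        (μ := volume) (h1.continuous.intervalIntegrable _ _) (h1.continuous.intervalIntegrable _ _)
      rw [h0] at this
      have h' : ∫ s in x..Real.pi, θ s = 0 := by
        refine (intervalIntegral.integral_congr (g := fun _ => 0) fun s hs => z s fun h => ?_).trans (by simp)
        have : min x Real.pi ≤ s := hs.1
        rcases min_le_iff.1 this with h' | h' <;> linarith [h.2]
      simpa [h'] using this
  have htsupp : tsupport (fun x => ∫ s in (0)..x, θ s) ⊆ Icc α β := closure_minimal hsupp isClosed_Icc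
  refine ⟨_, ?_, ?_, htsupp.trans fun x hx => ⟨hα.trans_le hx.1, hx.2.trans_lt hβ⟩, hde⟩
  · rw [contDiff_infty_iff_deriv, hde]
    exact ⟨fun x => (hd x).differentiableAt, h1⟩
  · exact isCompact_Icc.of_isClosed_subset (isClosed_tsupport _) htsupp

/-- A function whose weak derivative vanishes is constant. -/
theorem IsWeakDeriv.ae_eq_const {f : L2 E} (h : IsWeakDeriv f 0) :
    ∃ c : E, f =ᵐ[volume.restrict (Ioo (0 : ℝ) Real.pi)] fun _ => c := by
  have hf := L2_integrableOn f
  -- A bump of unit mass supported in [π/4, 3π/4]; the constant sought is the mean of f against it.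
  let b : ContDiffBump (Real.pi / 2) := ⟨Real.pi / 8, Real.pi / 4, by positivity,
    by linarith [Real.pi_pos]⟩
  set θ₀ : ℝ → ℝ := b.normed volume with hθ₀
  have hb : tsupport θ₀ ⊆ Ioo 0 Real.pi := by
    rw [b.tsupport_normed_eq, Real.closedBall_eq_Icc]
    intro x hx
    have h1 := hx.1
    have h2 := hx.2
    simp only [b] at h1 h2
    constructor <;> linarith [Real.pi_pos]
  have hθ1 : ContDiff ℝ ((⊤ : ℕ∞) : WithTop ℕ∞) θ₀ := b.contDiff_normed
  have hθ2 : HasCompactSupport θ₀ := b.hasCompactSupport_normed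
  have hθi : ∫ x in Ioo 0 Real.pi, θ₀ x = 1 := by
    rw [setIntegral_eq_integral_of_forall_compl_eq_zero, hθ₀, b.integral_normed]
    intro x hx
    by_contra hne
    exact hx (hb (subset_tsupport _ hne))
  set c := ∫ x in Ioo 0 Real.pi, θ₀ x • f x with hc
  refine ⟨c, ?_⟩
  have key : ∀ᵐ x : ℝ, x ∈ Ioo (0 : ℝ) Real.pi → f x - c = 0 := by
    have hfc : IntegrableOn (fun x => f x - c) (Ioo 0 Real.pi) :=
      hf.sub (integrableOn_const (by simp))
    refine isOpen_Ioo.ae_eq_zero_of_integral_contDiff_smul_eq_zero hfc.locallyIntegrableOn ?_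
    intro θ h1 h2 h3
    have hθint : IntegrableOn θ (Ioo 0 Real.pi) :=
      (h1.continuous.integrable_of_hasCompactSupport h2).integrableOn
    set m := ∫ x in Ioo 0 Real.pi, θ x with hm
    -- Subtracting m θ₀ removes the mean of θ, so the difference is the derivative of a test
    -- function and f is orthogonal to it.
    obtain ⟨η, e1, e2, e3, e4⟩ := exists_primitive_of_integral_eq_zero
      (θ := fun x => θ x - m * θ₀ x) (h1.sub (contDiff_const.mul hθ1))
      (h2.sub (hθ2.mul_left))
      ((closure_mono (by
        intro x hx
        by_contra hx'
        simp only [mem_union, Function.mem_support, not_or, not_not] at hx'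
        exact hx (by simp [hx'.1, hx'.2]))).trans
        ((closure_union (s := Function.support θ) (t := Function.support θ₀)).le.trans
          (union_subset h3 hb)))
      (by
        rw [integral_sub hθint, integral_const_mul, hθi, mul_one, sub_self]
        exact (hθ1.continuous.integrable_of_hasCompactSupport hθ2).integrableOn.const_mul m)
    have h4 := h η e1 e2 e3
    rw [e4] at h4
    have h5 : ∫ x in Ioo (0 : ℝ) Real.pi, η x • (0 : L2 E) x = 0 := by
      refine integral_eq_zero_of_ae ?_
      filter_upwards [Lp.coeFn_zero E 2 (volume.restrict (Ioo (0 : ℝ) Real.pi))] with x hx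
      rw [hx]
      simp
    have i1 : IntegrableOn (fun x => θ x • f x) (Ioo 0 Real.pi) := integrableOn_smul h1.continuous h2 f
    have i2 : IntegrableOn (fun x => m • θ₀ x • f x) (Ioo 0 Real.pi) :=
      (integrableOn_smul hθ1.continuous hθ2 f).smul m
    have i3 : IntegrableOn (fun x => θ x • c) (Ioo 0 Real.pi) := hθint.smul_const c
    rw [h5, neg_zero] at h4
    simp_rw [sub_smul, mul_smul] at h4
    rw [integral_sub i1 i2, integral_smul, ← hc] at h4
    rw [← setIntegral_eq_integral_of_forall_compl_eq_zero (s := Ioo 0 Real.pi)]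
    · simp_rw [smul_sub]
      rw [integral_sub i1 i3, integral_smul_const, ← hm, h4]
    · intro x hx
      have : θ x = 0 := by
        by_contra hne
        exact hx (h3 (subset_tsupport θ hne))
      rw [this, zero_smul]
  have key' := (ae_restrict_iff' (μ := volume) measurableSet_Ioo).2 key
  filter_upwards [key'] with x hx using sub_eq_zero.1 hx

/-- A function with weak derivative `g` is a primitive of `g`. -/
theorem IsWeakDeriv.exists_primitive {f g : L2 E} (h : IsWeakDeriv f g) :
    ∃ c : E, f =ᵐ[volume.restrict (Ioo (0 : ℝ) Real.pi)] fun x => c + ∫ s in (0)..x, g s := by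
  have hπ := Real.pi_pos.le
  have hmem := memLp_of_continuousOn_Icc
    (continuousOn_primitive hπ (L2_intervalIntegrable g) (0 : E))
  set G : L2 E := hmem.toLp with hG
  have hGe := hmem.coeFn_toLp
  have hGw : IsWeakDeriv G g := isWeakDeriv_of_primitive (fun x _ => by simp) hGe
  have hd : IsWeakDeriv (f + (-1 : ℝ) • G) 0 := by
    simpa using h.add (hGw.smul (-1 : ℝ))
  obtain ⟨c, hc⟩ := hd.ae_eq_const
  refine ⟨c, ?_⟩
  filter_upwards [hc, hGe, Lp.coeFn_add f ((-1 : ℝ) • G), Lp.coeFn_smul (-1 : ℝ) G]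
    with x h1 h2 h3 h4
  rw [h3, Pi.add_apply, h4, Pi.smul_apply, hG, h2] at h1
  rw [← h1]
  simp

end WeakDerivPrimitive

/-! ## Green's formulas -/

section Green

variable {E : Type*} [NormedAddCommGroup E] [NormedSpace ℝ E]

theorem integral_congr_smul_Ioo {f : L2 E} {F : ℝ → E}
    (h : f =ᵐ[volume.restrict (Ioo (0 : ℝ) Real.pi)] F) (η : ℝ → ℝ) :
    ∫ x in Ioo 0 Real.pi, η x • f x = ∫ x in (0)..Real.pi, η x • F x := by
  rw [← integral_Ioo_eq_intervalIntegral Real.pi_pos.le]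
  refine integral_congr_ae ?_
  filter_upwards [h] with x hx
  rw [hx]

variable [CompleteSpace E]

/-- The weight ζ need not vanish at the endpoints, so the boundary values of the continuous
representative of f' survive. Sines kill both of them; the weight 1 - x/π isolates the one at 0. -/
theorem IsH2H10.exists_green {f f' f'' : L2 E} (h : IsH2H10 f f' f'') :
    ∃ F' : ℝ → E, ContinuousOn F' (Icc 0 Real.pi) ∧
      f' =ᵐ[volume.restrict (Ioo (0 : ℝ) Real.pi)] F' ∧
      ∀ ζ ζ' ζ'' : ℝ → ℝ, (∀ x, HasDerivAt ζ (ζ' x) x) → (∀ x, HasDerivAt ζ' (ζ'' x) x) →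
        Continuous ζ'' →
        ∫ x in Ioo 0 Real.pi, ζ'' x • f x =
          ζ 0 • F' 0 - ζ Real.pi • F' Real.pi + ∫ x in Ioo 0 Real.pi, ζ x • f'' x := by
  have hπ := Real.pi_pos.le
  obtain ⟨c, hc⟩ := h.deriv₂.exists_primitive
  obtain ⟨d, hd⟩ := h.deriv₁.exists_primitive
  have cF := continuousOn_primitive hπ (L2_intervalIntegrable f') d
  have cF' := continuousOn_primitive hπ (L2_intervalIntegrable f'') c
  have z0 := h.trace_zero.eq_of_ae_eq (left_mem_Icc.2 hπ) cF hd
  have zπ := h.trace_pi.eq_of_ae_eq (right_mem_Icc.2 hπ) cF hd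
  refine ⟨_, cF', hc, fun ζ ζ' ζ'' h1 h2 h3 => ?_⟩
  have hζ'c : Continuous ζ' := continuous_iff_continuousAt.2 fun x => (h2 x).continuousAt
  rw [integral_congr_smul_Ioo hd,
    integral_smul_by_parts h2 h3 hπ (L2_intervalIntegrable f') (fun x _ => by simp), z0, zπ,
    ← integral_Ioo_eq_intervalIntegral hπ, integral_congr_smul_Ioo hc,
    integral_smul_by_parts h1 hζ'c hπ (L2_intervalIntegrable f'') (fun x _ => by simp),
    ← integral_Ioo_eq_intervalIntegral hπ fun x => ζ x • f'' x]
  simp only [smul_zero, sub_zero, zero_sub, neg_sub]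
  abel

theorem IsH2H10.integral_sin_smul {f f' f'' : L2 E} (h : IsH2H10 f f' f'') (k : ℕ) :
    ∫ x in Ioo 0 Real.pi, Real.sin (k * x) • f'' x =
      -((k : ℝ) ^ 2 • ∫ x in Ioo 0 Real.pi, Real.sin (k * x) • f x) := by
  obtain ⟨F', -, -, hF'⟩ := h.exists_green
  have h1 : ∀ x : ℝ, HasDerivAt (fun x : ℝ => Real.sin (k * x)) (k * Real.cos (k * x)) x := fun x => by
    have := ((hasDerivAt_id x).const_mul (k : ℝ)).sin
    simpa [mul_comm] using this
  have h2 : ∀ x : ℝ, HasDerivAt (fun x : ℝ => k * Real.cos (k * x))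
      (-(k : ℝ) ^ 2 * Real.sin (k * x)) x := fun x => by
    have := (((hasDerivAt_id x).const_mul (k : ℝ)).cos).const_mul (k : ℝ)
    refine this.congr_deriv ?_
    simp only [id]
    ring
  have := hF' _ _ _ h1 h2 (by fun_prop)
  simp only [mul_zero, Real.sin_zero, zero_smul, Real.sin_nat_mul_pi, sub_zero, zero_add] at this
  rw [← this, ← integral_smul, ← integral_neg]
  simp only [neg_mul, neg_smul, mul_smul]

/-- Green's formula with the affine weight 1 - x/π, which is 1 at 0, 0 at π and has no second
derivative. It turns the trace into a continuous functional of f''. -/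
theorem IsH2H10.trace_deriv_eq {f f' f'' : L2 E} (h : IsH2H10 f f' f'') {p : E}
    (hp : HasTrace f' 0 p) : p = -∫ x in Ioo 0 Real.pi, (1 - x / Real.pi) • f'' x := by
  obtain ⟨F', cF', hc, hF'⟩ := h.exists_green
  have h1 : ∀ x : ℝ, HasDerivAt (fun x : ℝ => 1 - x / Real.pi) (-(1 / Real.pi)) x := fun x => by
    simpa using ((hasDerivAt_id x).div_const Real.pi).const_sub 1
  have := hF' _ _ _ h1 (fun x => hasDerivAt_const x _) continuous_const
  rw [← hp.eq_of_ae_eq (left_mem_Icc.2 Real.pi_pos.le) cF' hc, eq_neg_iff_add_eq_zero]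
  simpa [div_self Real.pi_pos.ne'] using this.symm

/-- Every `h ∈ L²` is the second derivative of some `f ∈ H² ∩ H¹₀`. -/
theorem exists_isH2H10 (h : L2 E) : ∃ f f' : L2 E, IsH2H10 f f' h := by
  have hπ := Real.pi_pos.le
  have c1 := continuousOn_primitive hπ (L2_intervalIntegrable h) (0 : E)
  have i1 : IntervalIntegrable (fun x => ∫ s in (0)..x, h s) volume 0 Real.pi := by
    simpa using (c1.intervalIntegrable_of_Icc hπ : IntervalIntegrable _ volume _ _)
  set d : E := -(Real.pi⁻¹ • ∫ x in (0)..Real.pi, ∫ s in (0)..x, h s) with hd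
  have c2 := continuousOn_primitive hπ (L2_intervalIntegrable h) d
  set F' : ℝ → E := fun x => d + ∫ s in (0)..x, h s with hF'
  have i2 : IntervalIntegrable F' volume 0 Real.pi := c2.intervalIntegrable_of_Icc hπ
  have c3 := continuousOn_primitive hπ i2 (0 : E)
  have m2 := memLp_of_continuousOn_Icc c2
  have m3 := memLp_of_continuousOn_Icc c3
  have e2 := m2.coeFn_toLp
  have e3 := m3.coeFn_toLp
  refine ⟨m3.toLp, m2.toLp, ⟨isWeakDeriv_of_primitive (fun x hx => ?_) e3,
    isWeakDeriv_of_primitive (fun x _ => by simp [hF']) e2, ⟨_, c3, e3, by simp⟩, ⟨_, c3, e3, ?_⟩⟩⟩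
  · simp only [zero_add, intervalIntegral.integral_same]
    rw [← integral_Ioo_eq_intervalIntegral hx.1, ← integral_Ioo_eq_intervalIntegral hx.1]
    have e4 : m2.toLp =ᵐ[volume.restrict (Ioo 0 x)] F' :=
      ae_mono (Measure.restrict_mono (Ioo_subset_Ioo_right hx.2) le_rfl) e2
    exact integral_congr_ae e4.symm
  · simp only [hF', zero_add]
    rw [intervalIntegral.integral_add (by simp) i1, intervalIntegral.integral_const, hd]
    simp [smul_smul, Real.pi_pos.ne']

/-- Green's formula on `[0,π]` for a classical function. -/
theorem integral_sin_smul_of_hasDerivAt {h h' h'' : ℝ → E} (hc : ContinuousOn h (Icc 0 Real.pi))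
    (hc' : ContinuousOn h' (Icc 0 Real.pi)) (hc'' : ContinuousOn h'' (Icc 0 Real.pi))
    (hd : ∀ x ∈ Ioo 0 Real.pi, HasDerivAt h (h' x) x)
    (hd' : ∀ x ∈ Ioo 0 Real.pi, HasDerivAt h' (h'' x) x) (hπ : h Real.pi = 0) (k : ℕ) :
    (∫ x in Ioo 0 Real.pi, Real.sin (k * x) • h'' x) +
      (k : ℝ) ^ 2 • ∫ x in Ioo 0 Real.pi, Real.sin (k * x) • h x = (k : ℝ) • h 0 := by
  have hs : Continuous fun x : ℝ => Real.sin (k * x) := by fun_prop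
  have i1 : IntervalIntegrable (fun x => Real.sin (k * x) • h x) volume 0 Real.pi :=
    (hs.continuousOn.smul hc).intervalIntegrable_of_Icc Real.pi_pos.le
  have i2 : IntervalIntegrable (fun x => Real.sin (k * x) • h'' x) volume 0 Real.pi :=
    (hs.continuousOn.smul hc'').intervalIntegrable_of_Icc Real.pi_pos.le
  have i3 : IntervalIntegrable (fun x => (k : ℝ) ^ 2 • Real.sin (k * x) • h x) volume 0 Real.pi :=
    i1.smul _
  -- The combination sin(kx) h' - k cos(kx) h is a primitive of the integrand; its only nonzero
  -- boundary value is at 0 and equals -k h(0).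
  have := intervalIntegral.integral_eq_sub_of_hasDerivAt_of_le Real.pi_pos.le
    (f := fun x => Real.sin (k * x) • h' x - (k * Real.cos (k * x)) • h x)
    (f' := fun x => Real.sin (k * x) • h'' x + (k : ℝ) ^ 2 • Real.sin (k * x) • h x)
    ((hs.continuousOn.smul hc').sub
      ((by fun_prop : Continuous fun x : ℝ => k * Real.cos (k * x)).continuousOn.smul hc))
    (fun x hx => by
      have h1 : HasDerivAt (fun x : ℝ => Real.sin (k * x)) (k * Real.cos (k * x)) x := by
        have := ((hasDerivAt_id x).const_mul (k : ℝ)).sin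
        simpa [mul_comm] using this
      have h2 : HasDerivAt (fun x : ℝ => k * Real.cos (k * x))
          (-(k : ℝ) ^ 2 * Real.sin (k * x)) x := by
        have := (((hasDerivAt_id x).const_mul (k : ℝ)).cos).const_mul (k : ℝ)
        refine this.congr_deriv ?_
        simp only [id]
        ring
      refine ((h1.smul (hd' x hx)).sub (h2.smul (hd x hx))).congr_deriv ?_
      rw [smul_smul, neg_mul, neg_smul]
      abel)
    (i2.add i3)
  rw [intervalIntegral.integral_add i2 i3, intervalIntegral.integral_smul] at this
  rw [integral_Ioo_eq_intervalIntegral Real.pi_pos.le, integral_Ioo_eq_intervalIntegral Real.pi_pos.le,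
    this]
  simp [Real.sin_nat_mul_pi, hπ]

end Green

/-! ## The sine decomposition of `L²(0,π;E)` -/

section Sine

theorem integral_cos_int_mul {m : ℤ} (hm : m ≠ 0) : ∫ x in (0)..Real.pi, Real.cos (m * x) = 0 := by
  have hm' : (m : ℝ) ≠ 0 := by exact_mod_cast hm
  rw [intervalIntegral.integral_comp_mul_left (fun x => Real.cos x) hm', integral_cos]
  simp [Real.sin_int_mul_pi]

theorem integral_sin_mul_sin (j k : ℕ) :
    ∫ x in (0)..Real.pi, Real.sin ((j + 1 : ℕ) * x) * Real.sin ((k + 1 : ℕ) * x) =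
      if j = k then Real.pi / 2 else 0 := by
  have e : ∀ x : ℝ, Real.sin ((j + 1 : ℕ) * x) * Real.sin ((k + 1 : ℕ) * x) =
      2⁻¹ * (Real.cos (((j : ℤ) - k : ℤ) * x) - Real.cos (((j : ℤ) + k + 2 : ℤ) * x)) := fun x => by
    have h1 : (((j : ℤ) - k : ℤ) : ℝ) * x = (j + 1 : ℕ) * x - (k + 1 : ℕ) * x := by
      push_cast; ring
    have h2 : (((j : ℤ) + k + 2 : ℤ) : ℝ) * x = (j + 1 : ℕ) * x + (k + 1 : ℕ) * x := by
      push_cast; ring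
    rw [h1, h2, Real.cos_sub, Real.cos_add]
    ring
  simp_rw [e]
  rw [intervalIntegral.integral_const_mul, intervalIntegral.integral_sub
    ((by fun_prop : Continuous _).intervalIntegrable _ _)
    ((by fun_prop : Continuous _).intervalIntegrable _ _), integral_cos_int_mul (m := (j : ℤ) + k + 2) (by omega)]
  split_ifs with h
  · subst h
    simp
    ring
  · rw [integral_cos_int_mul (by omega)]
    simp

/-- The normalised sine function `√(2/π) sin((k+1)x)`. -/
def sineFun (k : ℕ) (x : ℝ) : ℝ := √(2 / Real.pi) * Real.sin ((k + 1 : ℕ) * x)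

theorem continuous_sineFun (k : ℕ) : Continuous (sineFun k) := by
  unfold sineFun; fun_prop

theorem integral_sineFun_mul (j k : ℕ) :
    ∫ x in Ioo 0 Real.pi, sineFun j x * sineFun k x = if j = k then 1 else 0 := by
  have e : ∀ x : ℝ, sineFun j x * sineFun k x =
      2 / Real.pi * (Real.sin ((j + 1 : ℕ) * x) * Real.sin ((k + 1 : ℕ) * x)) := fun x => by
    have := Real.mul_self_sqrt (show 0 ≤ 2 / Real.pi by positivity)
    unfold sineFun
    linear_combination (Real.sin ((j + 1 : ℕ) * x) * Real.sin ((k + 1 : ℕ) * x)) * this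
  simp_rw [e]
  rw [integral_Ioo_eq_intervalIntegral Real.pi_pos.le, intervalIntegral.integral_const_mul,
    integral_sin_mul_sin]
  split_ifs
  · field_simp
  · simp

variable (𝕜 : Type*) [RCLike 𝕜] {E : Type*} [NormedAddCommGroup E] [InnerProductSpace 𝕜 E]
  [NormedSpace ℝ E] [IsScalarTower ℝ 𝕜 E]

/-- The element `x ↦ η(x) c` of `L²(0,π;E)`. -/
def smulConst (η : ℝ → ℝ) (hη : Continuous η) : E →ₗ[𝕜] L2 E where
  toFun c := (memLp_of_continuousOn_Icc (F := fun x => η x • c)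
    (hη.continuousOn.smul continuousOn_const)).toLp
  map_add' c d := by
    rw [← MemLp.toLp_add]
    congr 1
    ext x
    simp
  map_smul' a c := by
    rw [RingHom.id_apply, ← MemLp.toLp_const_smul]
    congr 1
    ext x
    exact smul_comm _ _ _

theorem coeFn_smulConst {η : ℝ → ℝ} (hη : Continuous η) (c : E) :
    smulConst 𝕜 η hη c =ᵐ[volume.restrict (Ioo (0 : ℝ) Real.pi)] fun x => η x • c :=
  MemLp.coeFn_toLp (memLp_of_continuousOn_Icc (hη.continuousOn.smul continuousOn_const))

variable [CompleteSpace E]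

theorem inner_smulConst_left {η : ℝ → ℝ} (hη : Continuous η) (c : E) (f : L2 E) :
    inner 𝕜 (smulConst 𝕜 η hη c) f = inner 𝕜 c (∫ x in Ioo 0 Real.pi, η x • f x) := by
  have hi : IntegrableOn (fun x => η x • f x) (Ioo 0 Real.pi) :=
    integrableOn_continuous_smul hη.continuousOn (L2_integrableOn f)
  rw [L2.inner_def, ← integral_inner hi]
  refine integral_congr_ae ?_
  filter_upwards [coeFn_smulConst 𝕜 hη c] with x hx
  rw [hx, ← algebraMap_smul 𝕜 (η x) c, ← algebraMap_smul 𝕜 (η x) (f x), inner_smul_left,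
    inner_smul_right]
  simp

/-- The isometric embedding `c ↦ √(2/π) sin((k+1)x) c`. -/
def sineEmb (k : ℕ) : E →ₗᵢ[𝕜] L2 E :=
  (smulConst 𝕜 (sineFun k) (continuous_sineFun k)).isometryOfInner fun c d => by
    rw [inner_smulConst_left]
    congr 1
    have : ∫ x in Ioo 0 Real.pi, sineFun k x • smulConst 𝕜 (sineFun k) (continuous_sineFun k) d x =
        ∫ x in Ioo 0 Real.pi, (sineFun k x * sineFun k x) • d := by
      refine integral_congr_ae ?_
      filter_upwards [coeFn_smulConst 𝕜 (continuous_sineFun k) d] with x hx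
      rw [hx, smul_smul]
    rw [this, integral_smul_const, integral_sineFun_mul]
    simp

theorem coeFn_sineEmb (k : ℕ) (c : E) :
    sineEmb 𝕜 k c =ᵐ[volume.restrict (Ioo (0 : ℝ) Real.pi)] fun x => sineFun k x • c :=
  coeFn_smulConst 𝕜 (continuous_sineFun k) c

/-- The `k`-th sine coefficient `√(2/π) ∫ sin((k+1)x) f(x) dx`. -/
def coef (k : ℕ) : L2 E →L[𝕜] E := (sineEmb 𝕜 k).toContinuousLinearMap.adjoint

theorem inner_sineEmb_left (k : ℕ) (c : E) (f : L2 E) :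
    inner 𝕜 (sineEmb 𝕜 k c) f = inner 𝕜 c (coef 𝕜 k f) :=
  (ContinuousLinearMap.adjoint_inner_right (sineEmb 𝕜 k).toContinuousLinearMap c f).symm

theorem inner_sineEmb_right (k : ℕ) (c : E) (f : L2 E) :
    inner 𝕜 f (sineEmb 𝕜 k c) = inner 𝕜 (coef 𝕜 k f) c :=
  (ContinuousLinearMap.adjoint_inner_left (sineEmb 𝕜 k).toContinuousLinearMap c f).symm

theorem coef_apply (k : ℕ) (f : L2 E) :
    coef 𝕜 k f = ∫ x in Ioo 0 Real.pi, sineFun k x • f x := by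
  refine ext_inner_left 𝕜 fun c => ?_
  rw [← inner_sineEmb_left, ← inner_smulConst_left 𝕜 (continuous_sineFun k)]
  rfl

theorem coef_eq_smul (k : ℕ) (f : L2 E) :
    coef 𝕜 k f = √(2 / Real.pi) • ∫ x in Ioo 0 Real.pi, Real.sin ((k + 1 : ℕ) * x) • f x := by
  rw [coef_apply, ← integral_smul]
  simp_rw [sineFun, mul_smul]

theorem coef_sineEmb (j k : ℕ) (c : E) :
    coef 𝕜 j (sineEmb 𝕜 k c) = if j = k then c else 0 := by
  rw [coef_apply]
  have : ∫ x in Ioo 0 Real.pi, sineFun j x • sineEmb 𝕜 k c x =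
      ∫ x in Ioo 0 Real.pi, (sineFun j x * sineFun k x) • c := by
    refine integral_congr_ae ?_
    filter_upwards [coeFn_sineEmb 𝕜 k c] with x hx
    rw [hx, smul_smul]
  rw [this, integral_smul_const, integral_sineFun_mul]
  split_ifs <;> simp

/-- This is completeness of the sines in the form used throughout: identities in L² and between
operators are checked mode by mode. -/
theorem L2_ext_coef {f g : L2 E} (h : ∀ k, coef 𝕜 k f = coef 𝕜 k g) : f = g := by
  rw [← sub_eq_zero]
  have h0 : ∀ k, coef 𝕜 k (f - g) = 0 := fun k => by rw [map_sub, h, sub_self]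
  have := ae_eq_zero_of_integral_sin_smul_eq_zero (L2_integrableOn (f - g)) fun k => by
    -- Coefficient k carries frequency k + 1; frequency 0 is the trivial function sin 0.
    rcases k with _ | k
    · simp
    · have h1 := h0 k
      rw [coef_eq_smul] at h1
      exact (smul_eq_zero.1 h1).resolve_left (by positivity)
  exact (Lp.eq_zero_iff_ae_eq_zero).2 this

theorem isHilbertSum_sineEmb : IsHilbertSum 𝕜 (fun _ : ℕ => E) fun k => sineEmb (E := E) 𝕜 k := by
  refine IsHilbertSum.mk (fun j k hjk c d => ?_) ?_
  · rw [inner_sineEmb_left, coef_sineEmb, if_neg hjk, inner_zero_right]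
  · rw [top_le_iff, Submodule.topologicalClosure_eq_top_iff, Submodule.eq_bot_iff]
    intro f hf
    refine L2_ext_coef 𝕜 fun k => ?_
    rw [map_zero]
    refine ext_inner_left 𝕜 fun c => ?_
    rw [inner_zero_right, ← inner_sineEmb_left]
    exact hf _ (Submodule.mem_iSup_of_mem k ⟨c, rfl⟩)

/-- The isometry of `L²(0,π;E)` with `ℓ²(E)` given by the sine coefficients. -/
def sineEquiv : L2 E ≃ₗᵢ[𝕜] lp (fun _ : ℕ => E) 2 := (isHilbertSum_sineEmb 𝕜).linearIsometryEquiv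

theorem sineEquiv_apply (f : L2 E) (k : ℕ) : sineEquiv 𝕜 f k = coef 𝕜 k f := by
  obtain ⟨w, rfl⟩ := (sineEquiv 𝕜).symm.surjective f
  rw [LinearIsometryEquiv.apply_symm_apply]
  have h := ((isHilbertSum_sineEmb (E := E) 𝕜).hasSum_linearIsometryEquiv_symm w).mapL (coef 𝕜 k)
  simp only [coef_sineEmb] at h
  refine HasSum.unique ?_ h
  convert hasSum_single k fun j hj => if_neg (Ne.symm hj)
  simp

/-! Parseval and Riesz-Fischer. -/

theorem hasSum_norm_sq_coef (f : L2 E) : HasSum (fun k => ‖coef 𝕜 k f‖ ^ 2) (‖f‖ ^ 2) := by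
  have h := lp.hasSum_norm (p := 2) (by norm_num) (sineEquiv 𝕜 f)
  rw [LinearIsometryEquiv.norm_map] at h
  simpa [sineEquiv_apply] using h

theorem hasSum_inner_coef (f g : L2 E) :
    HasSum (fun k => inner 𝕜 (coef 𝕜 k f) (coef 𝕜 k g)) (inner 𝕜 f g) := by
  have h := lp.hasSum_inner (𝕜 := 𝕜) (sineEquiv 𝕜 f) (sineEquiv 𝕜 g)
  rw [LinearIsometryEquiv.inner_map_map] at h
  simpa [sineEquiv_apply] using h

theorem exists_coef_eq {c : ℕ → E} (hc : Summable fun k => ‖c k‖ ^ 2) :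
    ∃ f : L2 E, ∀ k, coef 𝕜 k f = c k := by
  have hm : Memℓp c 2 := memℓp_gen (by simpa using hc)
  refine ⟨(sineEquiv 𝕜).symm ⟨c, hm⟩, fun k => ?_⟩
  rw [← sineEquiv_apply, LinearIsometryEquiv.apply_symm_apply]

theorem norm_le_of_coef_le {f : L2 E} {b : ℕ → ℝ} (hb : Summable fun k => b k ^ 2)
    (h : ∀ k, ‖coef 𝕜 k f‖ ≤ b k) : ‖f‖ ^ 2 ≤ ∑' k, b k ^ 2 := by
  rw [← (hasSum_norm_sq_coef 𝕜 f).tsum_eq]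
  exact (hasSum_norm_sq_coef 𝕜 f).summable.tsum_le_tsum
    (fun k => pow_le_pow_left₀ (norm_nonneg _) (h k) 2) hb

/-- Dominated convergence for the sine coefficients. -/
theorem tendsto_of_coef {ι : Type*} {l : Filter ι} {F : ι → L2 E} {f : L2 E} {b : ℕ → ℝ}
    (hb : Summable fun k => b k ^ 2)
    (hF : ∀ᶠ i in l, ∀ k, ‖coef 𝕜 k (F i) - coef 𝕜 k f‖ ≤ b k)
    (hlim : ∀ k, Tendsto (fun i => coef 𝕜 k (F i)) l (𝓝 (coef 𝕜 k f))) :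
    Tendsto F l (𝓝 f) := by
  rw [tendsto_iff_norm_sub_tendsto_zero]
  have h : Tendsto (fun i => ∑' k, ‖coef 𝕜 k (F i) - coef 𝕜 k f‖ ^ 2) l (𝓝 (∑' _ : ℕ, 0)) := by
    refine tendsto_tsum_of_dominated_convergence hb (fun k => ?_) ?_
    · have := (tendsto_iff_norm_sub_tendsto_zero.1 (hlim k)).pow 2
      simpa using this
    · filter_upwards [hF] with i hi k
      rw [norm_pow, norm_norm]
      exact pow_le_pow_left₀ (norm_nonneg _) (hi k) 2
  have e : ∀ i, ∑' k, ‖coef 𝕜 k (F i) - coef 𝕜 k f‖ ^ 2 = ‖F i - f‖ ^ 2 := fun i => by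
    rw [← (hasSum_norm_sq_coef 𝕜 (F i - f)).tsum_eq]
    simp_rw [map_sub]
  simp_rw [e, tsum_zero] at h
  have h2 := h.sqrt
  simpa [Real.sqrt_sq (norm_nonneg _)] using h2

end Sine

/-! ## Exponentials of bounded operators -/

section Exponential

variable {𝕜 : Type*} [RCLike 𝕜] {E : Type*} [NormedAddCommGroup E] [NormedSpace 𝕜 E]
  [CompleteSpace E]

/-- The group `e^{ta}` generated by a bounded operator, at real times. -/
def expOp (a : E →L[𝕜] E) (t : ℝ) : E →L[𝕜] E := NormedSpace.exp ((t : 𝕜) • a)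

theorem expOp_zero (a : E →L[𝕜] E) : expOp a 0 = 1 := by simp [expOp]

theorem expOp_add (a : E →L[𝕜] E) (s t : ℝ) : expOp a (s + t) = expOp a s * expOp a t := by
  unfold expOp
  rw [RCLike.ofReal_add, add_smul]
  refine NormedSpace.exp_add_of_commute_of_mem_ball (𝕂 := 𝕜)
    (((Commute.refl a).smul_left _).smul_right _) ?_ ?_
  all_goals exact (NormedSpace.expSeries_radius_eq_top 𝕜 (E →L[𝕜] E)).symm ▸ edist_lt_top _ _

theorem hasSum_expOp (a : E →L[𝕜] E) (t : ℝ) (c : E) :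
    HasSum (fun n : ℕ => ((n.factorial : 𝕜)⁻¹ * (t : 𝕜) ^ n) • (a ^ n) c) (expOp a t c) := by
  have h := (NormedSpace.exp_series_hasSum_exp' (𝕂 := 𝕜) ((t : 𝕜) • a)).mapL
    (ContinuousLinearMap.apply 𝕜 E c)
  refine (congrArg (fun f : ℕ → E => HasSum f (expOp a t c)) (funext fun n => ?_)).mpr h
  simp [smul_pow, mul_smul]

theorem norm_expOp_le (a : E →L[𝕜] E) (t : ℝ) : ‖expOp a t‖ ≤ Real.exp (|t| * ‖a‖) := by
  have h := NormedSpace.exp_series_hasSum_exp' (𝕂 := 𝕜) ((t : 𝕜) • a)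
  have h2 : HasSum (fun n : ℕ => (|t| * ‖a‖) ^ n / n.factorial) (Real.exp (|t| * ‖a‖)) := by
    rw [Real.exp_eq_exp_ℝ]
    exact NormedSpace.expSeries_div_hasSum_exp _
  refine h.norm_le_of_bounded h2 fun n => ?_
  have h3 : ‖((t : 𝕜) • a) ^ n‖ ≤ (|t| * ‖a‖) ^ n := by
    rcases n with _ | n
    · rw [pow_zero, pow_zero]
      exact ContinuousLinearMap.norm_id_le
    · refine (norm_pow_le' _ n.succ_pos).trans_eq ?_
      rw [norm_smul, RCLike.norm_ofReal]
  rw [norm_smul, norm_inv, RCLike.norm_natCast, div_eq_inv_mul]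
  gcongr

theorem hasDerivAt_expOp_apply [NormedSpace ℝ E] [IsScalarTower ℝ 𝕜 E] (a : E →L[𝕜] E) (c : E)
    (t : ℝ) : HasDerivAt (fun t => expOp a t c) (a (expOp a t c)) t := by
  have h1 : HasDerivAt (fun u : 𝕜 => NormedSpace.exp (u • a) c) (a (expOp a t c)) (t : 𝕜) :=
    (hasDerivAt_exp_smul_const' a (t : 𝕜)).clm_apply (hasDerivAt_const _ c) |>.congr_deriv (by simp [expOp])
  have h2 : HasDerivAt (fun t : ℝ => (t : 𝕜)) 1 t := by
    simpa using (RCLike.ofRealCLM (K := 𝕜)).hasDerivAt (x := t)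
  exact (h1.scomp t h2).congr_deriv (one_smul _ _)

/-- The exponential series has real coefficients, so a merely real linear J suffices. It is applied
to the inclusion of ℝ² in ℂ², to compare the real and the complex semigroups. -/
theorem expOp_intertwine [NormedSpace ℝ E] [IsScalarTower ℝ 𝕜 E] {𝕜' : Type*} [RCLike 𝕜']
    {E' : Type*} [NormedAddCommGroup E'] [NormedSpace 𝕜' E'] [CompleteSpace E'] [NormedSpace ℝ E']
    [IsScalarTower ℝ 𝕜' E'] {a : E →L[𝕜] E} {b : E' →L[𝕜'] E'} {J : E →L[ℝ] E'}
    (hJ : ∀ c, J (a c) = b (J c)) (t : ℝ) (c : E) : J (expOp a t c) = expOp b t (J c) := by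
  have hJn : ∀ n : ℕ, J ((a ^ n) c) = (b ^ n) (J c) := fun n => by
    induction n with
    | zero => simp
    | succ n ih => rw [pow_succ', pow_succ', mul_apply_eq_comp,
        mul_apply_eq_comp, hJ, ih]
  refine ((hasSum_expOp a t c).mapL J).unique ?_
  convert hasSum_expOp b t (J c) using 2 with n
  have e1 : ((n.factorial : 𝕜)⁻¹ * (t : 𝕜) ^ n) = (algebraMap ℝ 𝕜) ((n.factorial : ℝ)⁻¹ * t ^ n) := by
    simp
  have e2 : ((n.factorial : 𝕜')⁻¹ * (t : 𝕜') ^ n) = (algebraMap ℝ 𝕜') ((n.factorial : ℝ)⁻¹ * t ^ n) := by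
    simp
  rw [e1, e2, algebraMap_smul, algebraMap_smul, map_smul, hJn]

end Exponential

/-! ## Block diagonal operators -/

section BlockDiag

variable {𝕜 : Type*} [RCLike 𝕜] {E : Type*} [NormedAddCommGroup E] [InnerProductSpace 𝕜 E]
  [NormedSpace ℝ E] [IsScalarTower ℝ 𝕜 E] [CompleteSpace E]

theorem norm_le_mul_of_coef_le {f g : L2 E} {C : ℝ} (hC : 0 ≤ C)
    (h : ∀ k, ‖coef 𝕜 k g‖ ≤ C * ‖coef 𝕜 k f‖) : ‖g‖ ≤ C * ‖f‖ := by
  have h1 := hasSum_norm_sq_coef 𝕜 f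
  have h2 := norm_le_of_coef_le 𝕜 (f := g) (b := fun k => C * ‖coef 𝕜 k f‖)
    (by simp_rw [mul_pow]; exact h1.summable.mul_left _) h
  simp_rw [mul_pow] at h2
  rw [tsum_mul_left, h1.tsum_eq, ← mul_pow] at h2
  exact le_of_sq_le_sq h2 (by positivity)

theorem exists_coef_eq_apply {m : ℕ → E →L[𝕜] E} {C : ℝ} (hm : ∀ k, ‖m k‖ ≤ C) (f : L2 E) :
    ∃ g : L2 E, ∀ k, coef 𝕜 k g = m k (coef 𝕜 k f) := by
  refine exists_coef_eq 𝕜 ?_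
  refine Summable.of_nonneg_of_le (fun _ => by positivity) (fun k => ?_)
    ((hasSum_norm_sq_coef 𝕜 f).summable.mul_left (C ^ 2))
  rw [← mul_pow]
  exact pow_le_pow_left₀ (norm_nonneg _) ((m k).le_of_opNorm_le (hm k) _) 2

/-- The operator that acts on the `k`-th sine coefficient as `m k`. -/
def blockDiag (m : ℕ → E →L[𝕜] E) (C : ℝ) (hm : ∀ k, ‖m k‖ ≤ C) : L2 E →L[𝕜] L2 E :=
  LinearMap.mkContinuous
    { toFun := fun f => (exists_coef_eq_apply hm f).choose
      map_add' := fun f g => L2_ext_coef 𝕜 fun k => by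
        rw [(exists_coef_eq_apply hm (f + g)).choose_spec, map_add, map_add, map_add,
          (exists_coef_eq_apply hm f).choose_spec, (exists_coef_eq_apply hm g).choose_spec]
      map_smul' := fun c f => L2_ext_coef 𝕜 fun k => by
        rw [(exists_coef_eq_apply hm (c • f)).choose_spec, map_smul, map_smul, RingHom.id_apply,
          map_smul, (exists_coef_eq_apply hm f).choose_spec] }
    C fun f => norm_le_mul_of_coef_le (𝕜 := 𝕜) ((norm_nonneg _).trans (hm 0)) fun k => by
      rw [LinearMap.coe_mk, AddHom.coe_mk, (exists_coef_eq_apply hm f).choose_spec]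
      exact (m k).le_of_opNorm_le (hm k) _

theorem coef_blockDiag {m : ℕ → E →L[𝕜] E} {C : ℝ} (hm : ∀ k, ‖m k‖ ≤ C) (k : ℕ) (f : L2 E) :
    coef 𝕜 k (blockDiag m C hm f) = m k (coef 𝕜 k f) :=
  (exists_coef_eq_apply hm f).choose_spec k

/-! ## The modes of `∂ₓₓ + a` -/

/-- The square `(k+1)²` of the frequency of the `k`-th mode. -/
def freqSq (k : ℕ) : ℝ := ((k : ℝ) + 1) ^ 2

theorem one_le_freqSq (k : ℕ) : 1 ≤ freqSq k := by
  unfold freqSq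
  have : (0 : ℝ) ≤ k := k.cast_nonneg
  nlinarith

theorem freqSq_pos (k : ℕ) : 0 < freqSq k := one_pos.trans_le (one_le_freqSq k)

/-- The restriction `a - (k+1)²` of `∂ₓₓ + a` to the `k`-th mode. -/
def modeOp (a : E →L[𝕜] E) (k : ℕ) : E →L[𝕜] E := a - ((freqSq k : ℝ) : 𝕜) • 1

theorem modeOp_apply (a : E →L[𝕜] E) (k : ℕ) (c : E) : modeOp a k c = a c - freqSq k • c := by
  simp only [modeOp, sub_apply, smul_apply, one_apply_eq_self]
  rw [← algebraMap_smul 𝕜 (freqSq k) c]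

/-- The exponential `e^{t(a-(k+1)²)}`. -/
def modeExp (a : E →L[𝕜] E) (k : ℕ) (t : ℝ) : E →L[𝕜] E :=
  ((Real.exp (-(freqSq k * t)) : ℝ) : 𝕜) • expOp a t

theorem modeExp_apply (a : E →L[𝕜] E) (k : ℕ) (t : ℝ) (c : E) :
    modeExp a k t c = Real.exp (-(freqSq k * t)) • expOp a t c := by
  rw [modeExp, smul_apply, ← algebraMap_smul 𝕜 (Real.exp _) (expOp a t c)]

theorem modeExp_zero (a : E →L[𝕜] E) (k : ℕ) : modeExp a k 0 = 1 := by
  simp [modeExp, expOp_zero]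

theorem modeExp_add (a : E →L[𝕜] E) (k : ℕ) (s t : ℝ) :
    modeExp a k (s + t) = modeExp a k s * modeExp a k t := by
  rw [modeExp, modeExp, modeExp, smul_mul_smul_comm, ← RCLike.ofReal_mul, ← Real.exp_add, expOp_add]
  ring_nf

theorem modeExp_add_apply (a : E →L[𝕜] E) (k : ℕ) (s t : ℝ) (c : E) :
    modeExp a k (s + t) c = modeExp a k s (modeExp a k t c) := by
  rw [modeExp_add]; rfl

theorem norm_modeExp_le (a : E →L[𝕜] E) (k : ℕ) {t : ℝ} (ht : 0 ≤ t) :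
    ‖modeExp a k t‖ ≤ Real.exp (-(freqSq k * t)) * Real.exp (t * ‖a‖) := by
  rw [modeExp, norm_smul, RCLike.norm_ofReal, abs_of_pos (Real.exp_pos _)]
  have := norm_expOp_le a t
  rw [abs_of_nonneg ht] at this
  gcongr

theorem norm_modeExp_le_exp (a : E →L[𝕜] E) (k : ℕ) {t : ℝ} (ht : 0 ≤ t) :
    ‖modeExp a k t‖ ≤ Real.exp (t * ‖a‖) := by
  refine (norm_modeExp_le a k ht).trans ?_
  have : Real.exp (-(freqSq k * t)) ≤ 1 := Real.exp_le_one_iff.2 (by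
    have := freqSq_pos k
    nlinarith)
  exact mul_le_of_le_one_left (Real.exp_pos _).le this

theorem hasDerivAt_modeExp_apply (a : E →L[𝕜] E) (k : ℕ) (c : E) (t : ℝ) :
    HasDerivAt (fun t => modeExp a k t c) (modeOp a k (modeExp a k t c)) t := by
  simp_rw [modeExp_apply, modeOp_apply]
  have h1 : HasDerivAt (fun t => Real.exp (-(freqSq k * t)))
      (Real.exp (-(freqSq k * t)) * (-(freqSq k))) t := by
    have := ((hasDerivAt_id t).const_mul (freqSq k)).neg.exp
    simpa using this
  refine (h1.smul (hasDerivAt_expOp_apply a c t)).congr_deriv ?_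
  rw [← algebraMap_smul 𝕜 (Real.exp _) (expOp a t c), map_smul, algebraMap_smul, algebraMap_smul,
    smul_smul, mul_neg, neg_smul, mul_comm (freqSq k) (Real.exp _), sub_eq_add_neg]

theorem modeOp_modeExp_comm (a : E →L[𝕜] E) (k : ℕ) (c : E) (t : ℝ) :
    modeOp a k (modeExp a k t c) = modeExp a k t (modeOp a k c) := by
  have h : a (expOp a t c) = expOp a t (a c) := by
    have h1 : Commute a (expOp a t) := ((Commute.refl a).smul_right _).exp_right
    exact congrArg (fun b : E →L[𝕜] E => b c) h1.eq
  simp only [modeOp, modeExp, sub_apply, smul_apply, one_apply_eq_self, map_sub, map_smul, h,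
    smul_sub, smul_comm _ ((freqSq k : ℝ) : 𝕜)]

theorem continuous_modeExp_apply (a : E →L[𝕜] E) (k : ℕ) (c : E) :
    Continuous fun t => modeExp a k t c :=
  continuous_iff_continuousAt.2 fun t => (hasDerivAt_modeExp_apply a k c t).continuousAt

/-- Mean value inequality. The bound is in terms of a(k) c, where a(k) is the block: if the block
images of the coefficients are square summable, it dominates the difference quotients. -/
theorem norm_modeExp_sub_le (a : E →L[𝕜] E) (k : ℕ) (c : E) {t : ℝ} (ht : 0 ≤ t) :
    ‖modeExp a k t c - c‖ ≤ t * (Real.exp (t * ‖a‖) * ‖modeOp a k c‖) := by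
  have := norm_image_sub_le_of_norm_deriv_le_segment' (f := fun t => modeExp a k t c)
    (C := Real.exp (t * ‖a‖) * ‖modeOp a k c‖) (a := 0) (b := t)
    (fun s _ => (hasDerivAt_modeExp_apply a k c s).hasDerivWithinAt) (fun s hs => by
      rw [modeOp_modeExp_comm]
      refine ((modeExp a k s).le_of_opNorm_le (norm_modeExp_le_exp a k hs.1) _).trans ?_
      have := hs.2.le
      gcongr) t (right_mem_Icc.2 ht)
  simpa [modeExp_zero, mul_comm] using this

end BlockDiag

/-! ## The semigroup -/

section Semigroup

variable {𝕜 : Type*} [RCLike 𝕜] {E : Type*} [NormedAddCommGroup E] [InnerProductSpace 𝕜 E]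
  [NormedSpace ℝ E] [IsScalarTower ℝ 𝕜 E] [CompleteSpace E]

/-- The semigroup on `L²(0,π;E)` generated by `∂ₓₓ + a` with Dirichlet boundary conditions
(constant for negative times). -/
def heatOp (a : E →L[𝕜] E) (t : ℝ) : L2 E →L[𝕜] L2 E :=
  blockDiag (fun k => modeExp a k (max t 0)) (Real.exp (max t 0 * ‖a‖))
    fun k => norm_modeExp_le_exp a k (le_max_right t 0)

theorem coef_heatOp (a : E →L[𝕜] E) {t : ℝ} (ht : 0 ≤ t) (k : ℕ) (f : L2 E) :
    coef 𝕜 k (heatOp a t f) = modeExp a k t (coef 𝕜 k f) := by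
  rw [heatOp, coef_blockDiag, max_eq_left ht]

theorem heatOp_zero (a : E →L[𝕜] E) : heatOp a 0 = ContinuousLinearMap.id 𝕜 (L2 E) := by
  ext1 f
  refine L2_ext_coef 𝕜 fun k => ?_
  rw [coef_heatOp a le_rfl, modeExp_zero]
  rfl

theorem heatOp_add (a : E →L[𝕜] E) {s t : ℝ} (hs : 0 ≤ s) (ht : 0 ≤ t) :
    heatOp a (s + t) = (heatOp a s).comp (heatOp a t) := by
  ext1 f
  refine L2_ext_coef 𝕜 fun k => ?_
  rw [coef_heatOp a (add_nonneg hs ht), ContinuousLinearMap.comp_apply, coef_heatOp a hs,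
    coef_heatOp a ht, modeExp_add_apply]

theorem norm_modeExp_sub_le_of_le_one (a : E →L[𝕜] E) (k : ℕ) (c : E) {t : ℝ} (ht : 0 ≤ t)
    (ht1 : t ≤ 1) : ‖modeExp a k t c - c‖ ≤ (Real.exp ‖a‖ + 1) * ‖c‖ := by
  have h1 : ‖modeExp a k t c‖ ≤ Real.exp ‖a‖ * ‖c‖ := by
    refine (modeExp a k t).le_of_opNorm_le ((norm_modeExp_le_exp a k ht).trans ?_) c
    exact Real.exp_le_exp.2 (mul_le_of_le_one_left (norm_nonneg _) ht1)
  refine (norm_sub_le _ _).trans ?_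
  rw [add_mul, one_mul]
  gcongr

theorem summable_mul_norm_coef_sq (C : ℝ) (f : L2 E) :
    Summable fun k => (C * ‖coef 𝕜 k f‖) ^ 2 := by
  simp_rw [mul_pow]
  exact (hasSum_norm_sq_coef 𝕜 f).summable.mul_left _

theorem tendsto_heatOp (a : E →L[𝕜] E) (f : L2 E) :
    Tendsto (fun t => heatOp a t f) (𝓝[>] 0) (𝓝 f) := by
  refine tendsto_of_coef 𝕜 (summable_mul_norm_coef_sq (𝕜 := 𝕜) (Real.exp ‖a‖ + 1) f) ?_ fun k => ?_
  · filter_upwards [Ioc_mem_nhdsGT (zero_lt_one (α := ℝ))] with t ht k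
    rw [coef_heatOp a ht.1.le]
    exact norm_modeExp_sub_le_of_le_one a k _ ht.1.le ht.2
  · have h := ((continuous_modeExp_apply a k (coef 𝕜 k f)).tendsto 0).mono_left
      (nhdsWithin_le_nhds (s := Ioi 0))
    rw [modeExp_zero, one_apply_eq_self] at h
    refine h.congr' ?_
    filter_upwards [self_mem_nhdsWithin] with t ht
    rw [coef_heatOp a (le_of_lt ht)]

/-- Coefficients are continuous, which gives one direction. Conversely, for t ≤ 1 the k-th
difference quotient is at most e^{‖a‖} times the k-th coefficient of g, and dominated convergence
over the modes applies. -/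
theorem tendsto_slope_heatOp_iff (a : E →L[𝕜] E) (f g : L2 E) :
    Tendsto (fun t : ℝ => ((t⁻¹ : ℝ) : 𝕜) • (heatOp a t f - f)) (𝓝[>] 0) (𝓝 g) ↔
      ∀ k, coef 𝕜 k g = modeOp a k (coef 𝕜 k f) := by
  have e : ∀ k, ∀ t > (0 : ℝ), coef 𝕜 k (((t⁻¹ : ℝ) : 𝕜) • (heatOp a t f - f)) =
      t⁻¹ • (modeExp a k t (coef 𝕜 k f) - coef 𝕜 k f) := fun k t ht => by
    rw [map_smul, map_sub, coef_heatOp a (le_of_lt ht), ← algebraMap_smul 𝕜 (t⁻¹)]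
  have hlim : ∀ k, Tendsto (fun t : ℝ => coef 𝕜 k (((t⁻¹ : ℝ) : 𝕜) • (heatOp a t f - f))) (𝓝[>] 0)
      (𝓝 (modeOp a k (coef 𝕜 k f))) := fun k => by
    have h := (hasDerivAt_modeExp_apply a k (coef 𝕜 k f) 0).tendsto_slope_zero_right
    simp only [zero_add, modeExp_zero, one_apply_eq_self] at h
    refine h.congr' ?_
    filter_upwards [self_mem_nhdsWithin] with t ht
    rw [e k t ht]
  constructor
  · intro h k
    exact tendsto_nhds_unique (((coef 𝕜 k).continuous.tendsto g).comp h) (hlim k)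
  · intro h
    refine tendsto_of_coef 𝕜 (summable_mul_norm_coef_sq (𝕜 := 𝕜) (Real.exp ‖a‖ + 1) g) ?_ fun k => ?_
    · filter_upwards [Ioc_mem_nhdsGT (zero_lt_one (α := ℝ))] with t ht k
      rw [e k t ht.1]
      refine (norm_sub_le _ _).trans ?_
      rw [add_mul, one_mul, norm_smul, norm_inv, Real.norm_of_nonneg ht.1.le]
      refine add_le_add ?_ le_rfl
      rw [inv_mul_le_iff₀ ht.1, h k]
      refine (norm_modeExp_sub_le a k _ ht.1.le).trans ?_
      have h1 : t * ‖a‖ ≤ ‖a‖ := mul_le_of_le_one_left (norm_nonneg _) ht.2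
      have := ht.1.le
      gcongr
    · rw [h k]
      exact hlim k

end Semigroup

/-! ## The graph of the parabolic operator -/

section Graph

/-- A real linear map commutes with the integral. One statement serves both the matrix
multiplication and the complexification. -/
theorem coef_of_ae_eq {𝕜 𝕜' : Type*} [RCLike 𝕜] [RCLike 𝕜'] {E E' : Type*}
    [NormedAddCommGroup E] [InnerProductSpace 𝕜 E] [NormedSpace ℝ E] [IsScalarTower ℝ 𝕜 E]
    [CompleteSpace E] [NormedAddCommGroup E'] [InnerProductSpace 𝕜' E'] [NormedSpace ℝ E']
    [IsScalarTower ℝ 𝕜' E'] [CompleteSpace E'] (J : E →L[ℝ] E') {f : L2 E} {g : L2 E'}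
    (h : g =ᵐ[volume.restrict (Ioo (0 : ℝ) Real.pi)] fun x => J (f x)) (k : ℕ) :
    coef 𝕜' k g = J (coef 𝕜 k f) := by
  rw [coef_apply, coef_apply, ← J.integral_comp_comm
    (integrableOn_continuous_smul (continuous_sineFun k).continuousOn (L2_integrableOn f))]
  refine integral_congr_ae ?_
  filter_upwards [h] with x hx
  rw [hx, map_smul]

/-- The endomorphism of `𝕜²` given by a matrix. -/
def matOp {𝕜 : Type*} [RCLike 𝕜] (M : Matrix (Fin 2) (Fin 2) 𝕜) :
    EuclideanSpace 𝕜 (Fin 2) →L[𝕜] EuclideanSpace 𝕜 (Fin 2) :=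
  Matrix.toEuclideanCLM (n := Fin 2) (𝕜 := 𝕜) M

theorem coef_matMul {𝕜 : Type*} [RCLike 𝕜] (M : Matrix (Fin 2) (Fin 2) 𝕜) (k : ℕ)
    (f : L2 (EuclideanSpace 𝕜 (Fin 2))) : coef 𝕜 k (matMul M f) = matOp M (coef 𝕜 k f) :=
  coef_of_ae_eq (𝕜 := 𝕜) (𝕜' := 𝕜) ((matOp M).restrictScalars ℝ)
    (ContinuousLinearMap.coeFn_compLpL _ _) k

theorem coef_stateC (k : ℕ) (f : StateR) : coef ℂ k (stateC f) = vecC (coef ℝ k f) :=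
  coef_of_ae_eq (𝕜 := ℝ) (𝕜' := ℂ) vecC (ContinuousLinearMap.coeFn_compLpL _ _) k

theorem IsH2H10.coef_deriv₂ {𝕜 : Type*} [RCLike 𝕜] {E : Type*} [NormedAddCommGroup E]
    [InnerProductSpace 𝕜 E] [NormedSpace ℝ E] [IsScalarTower ℝ 𝕜 E] [CompleteSpace E]
    {f f' f'' : L2 E} (h : IsH2H10 f f' f'') (k : ℕ) :
    coef 𝕜 k f'' = -(freqSq k • coef 𝕜 k f) := by
  rw [coef_eq_smul, coef_eq_smul, h.integral_sin_smul, smul_neg, smul_comm, freqSq]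
  norm_cast

/-- For the converse, let F ∈ H² ∩ H¹₀ have second derivative g - A₀f. Its coefficients times
-(k+1)² equal those of f times -(k+1)², so F = f, and f inherits the regularity and the boundary
values. -/
theorem mem_parabolicGraph_iff (A₀ : Matrix (Fin 2) (Fin 2) ℝ) (f g : StateC) :
    (f, g) ∈ parabolicGraph A₀ ↔
      ∀ k, coef ℂ k g = modeOp (matOp (matC A₀)) k (coef ℂ k f) := by
  constructor
  · rintro ⟨f', f'', hf, hg⟩ k
    simp only at hg hf
    rw [hg, map_add, coef_matMul, modeOp_apply, hf.coef_deriv₂]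
    abel
  · intro h
    obtain ⟨F, F', hF⟩ := exists_isH2H10 (g - matMul (matC A₀) f)
    have : F = f := L2_ext_coef ℂ fun k => by
      have h1 := hF.coef_deriv₂ (𝕜 := ℂ) k
      rw [map_sub, h, coef_matMul, modeOp_apply, sub_sub_cancel_left, neg_inj] at h1
      exact (smul_right_injective _ (freqSq_pos k).ne' h1).symm
    subst this
    exact ⟨F', _, hF, by simp⟩

end Graph

/-! ## Dirichlet lifts -/

section Lift

/-- The factor `√(2/π) (k+1)` that relates boundary values and sine coefficients. -/
def sineAmp (k : ℕ) : ℝ := √(2 / Real.pi) * ((k : ℝ) + 1)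

section

variable {𝕜 : Type*} [RCLike 𝕜] {E : Type*} [NormedAddCommGroup E] [InnerProductSpace 𝕜 E]
  [NormedSpace ℝ E] [IsScalarTower ℝ 𝕜 E] [CompleteSpace E]

/-- For h'' = N h, Green's formula against the sine leaves only the boundary term at 0, which
carries the factor √(2/π)(k+1). It is used with N = ω - a for lifts and with N = 0 for the affine
profile. -/
theorem coef_of_dirichlet {h h' : ℝ → E} {N : E →L[𝕜] E} (hc : ContinuousOn h (Icc 0 Real.pi))
    (hc' : ContinuousOn h' (Icc 0 Real.pi)) (hd : ∀ x ∈ Ioo 0 Real.pi, HasDerivAt h (h' x) x)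
    (hd' : ∀ x ∈ Ioo 0 Real.pi, HasDerivAt h' (N (h x)) x) (hπ : h Real.pi = 0)
    {f : L2 E} (hf : f =ᵐ[volume.restrict (Ioo (0 : ℝ) Real.pi)] h) (k : ℕ) :
    N (coef 𝕜 k f) + freqSq k • coef 𝕜 k f = sineAmp k • h 0 := by
  have hG := integral_sin_smul_of_hasDerivAt hc hc' (N.continuous.comp_continuousOn hc) hd hd' hπ (k + 1)
  have e1 : ∫ x in Ioo 0 Real.pi, Real.sin ((k + 1 : ℕ) * x) • h x =
      ∫ x in Ioo 0 Real.pi, Real.sin ((k + 1 : ℕ) * x) • f x := by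
    refine integral_congr_ae ?_
    filter_upwards [hf] with x hx
    rw [hx]
  have e2 : ∫ x in Ioo 0 Real.pi, Real.sin ((k + 1 : ℕ) * x) • N (h x) =
      N (∫ x in Ioo 0 Real.pi, Real.sin ((k + 1 : ℕ) * x) • f x) := by
    rw [← N.integral_comp_comm
      (integrableOn_continuous_smul (by fun_prop) (L2_integrableOn f))]
    refine integral_congr_ae ?_
    filter_upwards [hf] with x hx
    rw [hx, ← algebraMap_smul 𝕜 (Real.sin _) (h x), map_smul, algebraMap_smul]
  simp only [Function.comp_apply] at hG
  rw [e1, e2] at hG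
  have e3 := congrArg (fun c => √(2 / Real.pi) • c) hG
  have e4 : √(2 / Real.pi) • N (∫ x in Ioo 0 Real.pi, Real.sin ((k + 1 : ℕ) * x) • f x) =
      N (coef 𝕜 k f) := by
    rw [coef_eq_smul, ← algebraMap_smul 𝕜 (√(2 / Real.pi)) (∫ x in Ioo 0 Real.pi, _), map_smul,
      algebraMap_smul]
  simp only [smul_add] at e3
  rw [e4, smul_comm, ← coef_eq_smul 𝕜, smul_smul] at e3
  simpa [freqSq, sineAmp] using e3

end

section

variable {𝕜 : Type*} [RCLike 𝕜] {E : Type*} [NormedAddCommGroup E] [NormedSpace 𝕜 E]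
  [NormedSpace ℝ E] [IsScalarTower ℝ 𝕜 E] [CompleteSpace E]

theorem expOp_apply_comm (a : E →L[𝕜] E) (c : E) (t : ℝ) : a (expOp a t c) = expOp a t (a c) := by
  have h1 : Commute a (expOp a t) := ((Commute.refl a).smul_right _).exp_right
  exact congrArg (fun b : E →L[𝕜] E => b c) h1.eq

theorem contDiff_expOp_apply (a : E →L[𝕜] E) (n : ℕ) (c : E) :
    ContDiff ℝ n fun t => expOp a t c := by
  induction n generalizing c with
  | zero =>
    exact contDiff_zero.2 (continuous_iff_continuousAt.2 fun t =>
      (hasDerivAt_expOp_apply a c t).continuousAt)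
  | succ n ih =>
    have hd : deriv (fun t => expOp a t c) = fun t => expOp a t (a c) :=
      funext fun t => by rw [(hasDerivAt_expOp_apply a c t).deriv, expOp_apply_comm]
    rw [Nat.cast_succ, contDiff_succ_iff_deriv, hd]
    exact ⟨fun t => (hasDerivAt_expOp_apply a c t).differentiableAt, by simp, ih _⟩

end

variable {E : Type*} [NormedAddCommGroup E] [InnerProductSpace ℂ E] [CompleteSpace E]
  [NormedSpace ℝ E] [IsScalarTower ℝ ℂ E]

/-- The first order system equivalent to `f'' = N f`. -/
def firstOrder (N : E →L[ℂ] E) : E × E →L[ℂ] E × E :=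
  (ContinuousLinearMap.snd ℂ E E).prod (N.comp (ContinuousLinearMap.fst ℂ E E))

/-- The solution of `f'' = N f`, `f(0) = 0`, `f'(0) = c`, together with its derivative. -/
def sinhOp (N : E →L[ℂ] E) (x : ℝ) : E →L[ℂ] E × E :=
  (expOp (firstOrder N) x).comp (ContinuousLinearMap.inr ℂ E E)

theorem sinhOp_zero (N : E →L[ℂ] E) (c : E) : sinhOp N 0 c = (0, c) := by
  simp [sinhOp, expOp_zero]

theorem contDiff_sinhOp (N : E →L[ℂ] E) (n : ℕ) (c : E) :
    ContDiff ℝ n fun x => sinhOp N x c := contDiff_expOp_apply _ n _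

theorem hasDerivAt_sinhOp_fst (N : E →L[ℂ] E) (c : E) (x : ℝ) :
    HasDerivAt (fun x => (sinhOp N x c).1) (sinhOp N x c).2 x :=
  (ContinuousLinearMap.fst ℝ E E).hasFDerivAt.comp_hasDerivAt x
    (hasDerivAt_expOp_apply (firstOrder N) ((0 : E), c) x)

theorem hasDerivAt_sinhOp_snd (N : E →L[ℂ] E) (c : E) (x : ℝ) :
    HasDerivAt (fun x => (sinhOp N x c).2) (N (sinhOp N x c).1) x :=
  (ContinuousLinearMap.snd ℝ E E).hasFDerivAt.comp_hasDerivAt x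
    (hasDerivAt_expOp_apply (firstOrder N) ((0 : E), c) x)

/-- The reflected solution `x ↦ f(π - x)` satisfies the same equation and vanishes at `π`. -/
theorem hasDerivAt_sinhOp_reflect_fst (N : E →L[ℂ] E) (c : E) (x : ℝ) :
    HasDerivAt (fun x => (sinhOp N (Real.pi - x) c).1) (-(sinhOp N (Real.pi - x) c).2) x :=
  (hasDerivAt_sinhOp_fst N c (Real.pi - x)).comp_const_sub Real.pi x

theorem hasDerivAt_sinhOp_reflect_snd (N : E →L[ℂ] E) (c : E) (x : ℝ) :
    HasDerivAt (fun x => -(sinhOp N (Real.pi - x) c).2) (N (sinhOp N (Real.pi - x) c).1) x := by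
  simpa using ((hasDerivAt_sinhOp_snd N c (Real.pi - x)).comp_const_sub Real.pi x).fun_neg

theorem continuous_sinhOp (N : E →L[ℂ] E) (c : E) : Continuous fun x => sinhOp N x c :=
  (contDiff_sinhOp N 0 c).continuous

theorem coef_of_sinhOp_reflect (N : E →L[ℂ] E) (c : E) {f : L2 E}
    (hf : f =ᵐ[volume.restrict (Ioo (0 : ℝ) Real.pi)] fun x => (sinhOp N (Real.pi - x) c).1)
    (k : ℕ) :
    N (coef ℂ k f) + freqSq k • coef ℂ k f = sineAmp k • (sinhOp N Real.pi c).1 := by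
  have hcont : Continuous fun x => sinhOp N (Real.pi - x) c :=
    (continuous_sinhOp N c).comp (continuous_const.sub continuous_id)
  have := coef_of_dirichlet (𝕜 := ℂ) (N := N) hcont.fst.continuousOn hcont.snd.neg.continuousOn
    (fun x _ => hasDerivAt_sinhOp_reflect_fst N c x)
    (fun x _ => hasDerivAt_sinhOp_reflect_snd N c x) (by simp [sinhOp_zero]) hf k
  simpa using this

/-- If the reflected solution vanishes at both ends, each sine coefficient lies in the kernel of N +
(k+1)², hence is zero. The solution then vanishes identically, and so does its derivative -c at π.
-/
theorem injective_sinhOp_pi {N : E →L[ℂ] E} (hN : ∀ k c, N c + freqSq k • c = 0 → c = 0) :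
    Function.Injective fun c => (sinhOp N Real.pi c).1 := by
  have key : ∀ c, (sinhOp N Real.pi c).1 = 0 → c = 0 := by
    intro c hc
    have hcont : Continuous fun x => (sinhOp N (Real.pi - x) c).1 :=
      ((continuous_sinhOp N c).comp (continuous_const.sub continuous_id)).fst
    have hm := memLp_of_continuousOn_Icc (a := 0) (b := Real.pi) hcont.continuousOn
    have hf := hm.coeFn_toLp
    have h0 : hm.toLp = (0 : L2 E) := L2_ext_coef ℂ fun k => by
      have := coef_of_sinhOp_reflect N c hf k
      rw [hc, smul_zero] at this
      rw [hN k _ this, map_zero]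
    rw [h0] at hf
    have hz := eq_of_ae_eq_of_continuousOn Real.pi_pos hcont.continuousOn continuousOn_const
      (hf.symm.trans (Lp.coeFn_zero E 2 _))
    -- Vanishing is known only on [0,π], so the derivatives at π are compared within the interval.
    have h1 : HasDerivWithinAt (fun x => (sinhOp N (Real.pi - x) c).1) (-c) (Icc 0 Real.pi) Real.pi := by
      have := (hasDerivAt_sinhOp_reflect_fst N c Real.pi).hasDerivWithinAt (s := Icc 0 Real.pi)
      simpa [sinhOp_zero] using this
    have h2 : HasDerivWithinAt (fun x => (sinhOp N (Real.pi - x) c).1) 0 (Icc 0 Real.pi) Real.pi :=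
      (hasDerivWithinAt_const Real.pi _ (0 : E)).congr (fun x hx => hz hx)
        (hz (right_mem_Icc.2 Real.pi_pos.le))
    have := (uniqueDiffOn_Icc Real.pi_pos Real.pi (right_mem_Icc.2 Real.pi_pos.le)).eq_deriv _ h1 h2
    simpa using this
  intro c d hcd
  rw [← sub_eq_zero]
  refine key _ ?_
  simpa [sub_eq_zero] using hcd

end Lift

/-! ### Existence, uniqueness and sine coefficients of the Dirichlet lift -/

section DirichletLift

variable {A₀ : Matrix (Fin 2) (Fin 2) ℝ} {B₀ : EuclideanSpace ℝ (Fin 2)} {ω : ℂ}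

/-- The operator `a = A₀` on `ℂ²`. -/
abbrev opC (A₀ : Matrix (Fin 2) (Fin 2) ℝ) :
    EuclideanSpace ℂ (Fin 2) →L[ℂ] EuclideanSpace ℂ (Fin 2) := matOp (matC A₀)

theorem smul_sub_modeOp (ω : ℂ) (k : ℕ) (c : EuclideanSpace ℂ (Fin 2)) :
    ω • c - modeOp (opC A₀) k c = (ω • 1 - opC A₀ : _ →L[ℂ] _) c + freqSq k • c := by
  rw [modeOp_apply]
  simp
  abel

theorem NonResonant.eq_zero (h : NonResonant A₀ ω) (k : ℕ) (c : EuclideanSpace ℂ (Fin 2))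
    (hc : ω • c - modeOp (opC A₀) k c = 0) : c = 0 := by
  -- Mode k has frequency k + 1 ≥ 1, so the non-resonance condition is used at k + 1.
  have h1 := Matrix.eq_zero_of_mulVec_eq_zero (h (k + 1) (by omega)) (v := c.ofLp) (by
    have h2 := congrArg WithLp.ofLp hc
    rw [modeOp_apply] at h2
    simp only [matOp, WithLp.ofLp_sub, WithLp.ofLp_smul, WithLp.ofLp_zero,
      Matrix.ofLp_toEuclideanCLM] at h2
    rw [Matrix.sub_mulVec, ← h2]
    ext i
    simp only [Matrix.scalar_apply, Pi.sub_apply, Matrix.mulVec_diagonal, Pi.smul_apply, freqSq,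
      Complex.real_smul, smul_eq_mul]
    push_cast
    ring)
  ext i
  simpa using congrFun h1 i

/-- Shooting from π: the map from the slope parameter at π to the value at 0 is an injective
endomorphism of ℂ², hence surjective. -/
theorem NonResonant.exists_isDirichletLift (h : NonResonant A₀ ω) (B₀ : EuclideanSpace ℝ (Fin 2))
    (a : ℂ) : ∃ f, IsDirichletLift A₀ B₀ ω a f := by
  set N : EuclideanSpace ℂ (Fin 2) →L[ℂ] EuclideanSpace ℂ (Fin 2) := ω • 1 - opC A₀ with hN
  have hinj := injective_sinhOp_pi (N := N) fun k c hc => h.eq_zero k c (by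
    rw [smul_sub_modeOp, ← hN, hc])
  have hsurj := LinearMap.surjective_of_injective
    (f := ((ContinuousLinearMap.fst ℂ _ _).comp (sinhOp N Real.pi)).toLinearMap) hinj
  obtain ⟨c, hc⟩ := hsurj (a • vecC B₀)
  refine ⟨fun x => (sinhOp N (Real.pi - x) c).1, ?_, fun x _ => ?_, ?_, ?_⟩
  · exact (contDiff_fst.comp ((contDiff_sinhOp N 2 c).comp (contDiff_const.sub contDiff_id))).contDiffOn
  · have e1 : deriv (fun x => (sinhOp N (Real.pi - x) c).1) =
        fun x => -(sinhOp N (Real.pi - x) c).2 :=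
      funext fun x => (hasDerivAt_sinhOp_reflect_fst N c x).deriv
    rw [e1, (hasDerivAt_sinhOp_reflect_snd N c x).deriv, hN]
    simp [opC, matOp]
  · simpa using hc
  · simp [sinhOp_zero]

/-- The sine coefficients of a Dirichlet lift. -/
theorem IsDirichletLift.coef_eq {a : ℂ} {h : ℝ → EuclideanSpace ℂ (Fin 2)}
    (hh : IsDirichletLift A₀ B₀ ω a h) {f : StateC}
    (hf : f =ᵐ[volume.restrict (Ioo (0 : ℝ) Real.pi)] h) (k : ℕ) :
    ω • coef ℂ k f - modeOp (opC A₀) k (coef ℂ k f) = a • sineAmp k • vecC B₀ := by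
  have hu := uniqueDiffOn_Icc Real.pi_pos
  have hd1 : ContDiffOn ℝ 1 (derivWithin h (Icc 0 Real.pi)) (Icc 0 Real.pi) :=
    hh.contDiffOn.derivWithin hu (by norm_num)
  -- Regularity up to the boundary concerns the derivative within [0,π], while the equation uses the
  -- full derivative; they agree inside.
  have hev : ∀ x ∈ Ioo 0 Real.pi, derivWithin h (Icc 0 Real.pi) =ᶠ[𝓝 x] deriv h := fun x hx => by
    filter_upwards [isOpen_Ioo.mem_nhds hx] with y hy
    exact derivWithin_of_mem_nhds (Icc_mem_nhds hy.1 hy.2)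
  rw [smul_sub_modeOp, smul_comm, ← hh.at_zero]
  refine coef_of_dirichlet hh.contDiffOn.continuousOn hd1.continuousOn (fun x hx => ?_)
    (fun x hx => ?_) hh.at_pi hf k
  · rw [(hev x hx).eq_of_nhds]
    exact ((hh.contDiffOn.differentiableOn (by norm_num)).differentiableAt
      (Icc_mem_nhds hx.1 hx.2)).hasDerivAt
  · have h1 := ((hd1.differentiableOn (by norm_num)).differentiableAt
      (Icc_mem_nhds hx.1 hx.2)).hasDerivAt
    rw [(hev x hx).deriv_eq] at h1
    convert h1 using 1
    rw [← sub_eq_zero, sub_apply, smul_apply, one_apply_eq_self, ← hh.ode x hx]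
    simp [matOp]

/-- The coefficients of two lifts satisfy the same equation, whose block is injective by
non-resonance; continuity then gives equality on the closed interval. -/
theorem NonResonant.eqOn_of_isDirichletLift (hω : NonResonant A₀ ω) {a : ℂ}
    {h h' : ℝ → EuclideanSpace ℂ (Fin 2)} (hh : IsDirichletLift A₀ B₀ ω a h)
    (hh' : IsDirichletLift A₀ B₀ ω a h') : EqOn h' h (Icc 0 Real.pi) := by
  have m := memLp_of_continuousOn_Icc hh.contDiffOn.continuousOn
  have m' := memLp_of_continuousOn_Icc hh'.contDiffOn.continuousOn
  have e : (m.toLp : StateC) = m'.toLp := L2_ext_coef ℂ fun k => by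
    have h1 := (hh.coef_eq m.coeFn_toLp k).trans (hh'.coef_eq m'.coeFn_toLp k).symm
    rw [← sub_eq_zero]
    refine hω.eq_zero k _ ?_
    rw [map_sub, smul_sub, sub_sub_sub_comm, h1, sub_self]
  refine eq_of_ae_eq_of_continuousOn Real.pi_pos hh'.contDiffOn.continuousOn
    hh.contDiffOn.continuousOn ?_
  exact m'.coeFn_toLp.symm.trans (e ▸ m.coeFn_toLp)

theorem IsDirichletLift.smul {a : ℂ} {h : ℝ → EuclideanSpace ℂ (Fin 2)}
    (hh : IsDirichletLift A₀ B₀ ω 1 h) : IsDirichletLift A₀ B₀ ω a (fun x => a • h x) where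
  contDiffOn := hh.contDiffOn.const_smul a
  ode x hx := by
    have e1 : deriv (fun x => a • h x) = fun x => a • deriv h x :=
      funext fun x => deriv_const_smul_field a h
    rw [e1, deriv_fun_const_smul_field a (deriv h), map_smul, ← smul_add, hh.ode x hx, smul_comm]
  at_zero := by rw [hh.at_zero, one_smul]
  at_pi := by rw [hh.at_pi, smul_zero]

/-- The Dirichlet map. -/
theorem NonResonant.exists_dirichletMap (hω : NonResonant A₀ ω) (B₀ : EuclideanSpace ℝ (Fin 2)) :
    ∃ D : ℂ →L[ℂ] StateC,
      (∀ a h, IsDirichletLift A₀ B₀ ω a h → D a =ᵐ[volume.restrict (Ioo 0 Real.pi)] h) ∧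
      ∀ a k, ω • coef ℂ k (D a) - modeOp (opC A₀) k (coef ℂ k (D a)) =
        a • sineAmp k • vecC B₀ := by
  obtain ⟨h, hh⟩ := hω.exists_isDirichletLift B₀ 1
  have m := memLp_of_continuousOn_Icc hh.contDiffOn.continuousOn
  set f : StateC := m.toLp with hf
  have hD : ∀ a h', IsDirichletLift A₀ B₀ ω a h' →
      ContinuousLinearMap.toSpanSingleton ℂ f a =ᵐ[volume.restrict (Ioo 0 Real.pi)] h' := by
    intro a h' hh'
    have e := hω.eqOn_of_isDirichletLift hh' (hh.smul (a := a))
    rw [ContinuousLinearMap.toSpanSingleton_apply]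
    filter_upwards [Lp.coeFn_smul a f, m.coeFn_toLp, ae_restrict_mem measurableSet_Ioo] with x h1 h2 h3
    rw [h1, Pi.smul_apply, hf, h2, ← e (Ioo_subset_Icc_self h3)]
  refine ⟨ContinuousLinearMap.toSpanSingleton ℂ f, hD, fun a k => ?_⟩
  exact hh.smul.coef_eq (hD a _ hh.smul) k

end DirichletLift

/-! ## Truncation to finitely many modes -/

section Cutoff

variable (𝕜 : Type*) [RCLike 𝕜] {E : Type*} [NormedAddCommGroup E] [InnerProductSpace 𝕜 E]
  [NormedSpace ℝ E] [IsScalarTower ℝ 𝕜 E] [CompleteSpace E]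

/-- The projection onto the first `N` modes. -/
def cutoff (N : ℕ) : L2 E →L[𝕜] L2 E :=
  ∑ k ∈ Finset.range N, (sineEmb 𝕜 k).toContinuousLinearMap.comp (coef 𝕜 k)

theorem cutoff_apply (N : ℕ) (f : L2 E) :
    cutoff 𝕜 N f = ∑ k ∈ Finset.range N, sineEmb 𝕜 k (coef 𝕜 k f) := by
  simp [cutoff]

theorem coef_cutoff (N j : ℕ) (f : L2 E) :
    coef 𝕜 j (cutoff 𝕜 N f) = if j < N then coef 𝕜 j f else 0 := by
  rw [cutoff_apply, map_sum]
  simp_rw [coef_sineEmb]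
  rw [Finset.sum_ite_eq]
  simp

theorem norm_cutoff_apply_le (N : ℕ) (f : L2 E) : ‖cutoff 𝕜 N f‖ ≤ ‖f‖ := by
  have := norm_le_mul_of_coef_le (𝕜 := 𝕜) (f := f) (g := cutoff 𝕜 N f) zero_le_one fun k => by
    rw [coef_cutoff]
    split_ifs <;> simp
  simpa using this

theorem tendsto_cutoff (f : L2 E) : Tendsto (fun N => cutoff 𝕜 N f) atTop (𝓝 f) := by
  refine tendsto_of_coef 𝕜 (hasSum_norm_sq_coef 𝕜 f).summable
    (Eventually.of_forall fun N k => ?_) fun k => ?_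
  · rw [coef_cutoff]
    split_ifs <;> simp
  · refine tendsto_const_nhds.congr' ?_
    filter_upwards [eventually_gt_atTop k] with N hN
    rw [coef_cutoff, if_pos hN]

theorem isCompactOperator_cutoff [FiniteDimensional 𝕜 E] (N : ℕ) :
    IsCompactOperator (cutoff (E := E) 𝕜 N) := by
  have : ProperSpace E := FiniteDimensional.proper_rclike 𝕜 E
  unfold cutoff
  induction N with
  | zero => simpa using isCompactOperator_zero
  | succ N ih =>
    rw [Finset.sum_range_succ]
    have h : IsCompactOperator ((sineEmb 𝕜 N).toContinuousLinearMap ∘ coef (E := E) 𝕜 N) :=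
      (isCompactOperator_of_locallyCompactSpace_dom (coef 𝕜 N)).clm_comp _
    exact ih.add h

theorem le_freqSq (k : ℕ) : (k : ℝ) ≤ freqSq k := by
  unfold freqSq
  have : (0 : ℝ) ≤ k := k.cast_nonneg
  nlinarith

end Cutoff

/-! ## The resolvent -/

section Resolvent

variable {A₀ : Matrix (Fin 2) (Fin 2) ℝ} {ω : ℂ}

theorem coef_parabolicOp (x : (parabolicOp A₀).domain) (k : ℕ) :
    coef ℂ k (parabolicOp A₀ x) = modeOp (opC A₀) k (coef ℂ k (x : StateC)) := by
  have h := (parabolicOp A₀).mem_graph x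
  rw [parabolicOp_graph, mem_parabolicGraph_iff] at h
  exact h k

theorem exists_mem_domain {x y : StateC} (h : ∀ k, coef ℂ k y = modeOp (opC A₀) k (coef ℂ k x)) :
    ∃ hx : x ∈ (parabolicOp A₀).domain, parabolicOp A₀ ⟨x, hx⟩ = y := by
  have h1 := (mem_parabolicGraph_iff A₀ x y).2 h
  rw [← parabolicOp_graph, LinearPMap.mem_graph_iff] at h1
  obtain ⟨z, rfl, hz⟩ := h1
  exact ⟨z.2, hz⟩

theorem sineEmb_mem_domain (k : ℕ) (c : EuclideanSpace ℂ (Fin 2)) :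
    ∃ hx : sineEmb ℂ k c ∈ (parabolicOp A₀).domain,
      parabolicOp A₀ ⟨sineEmb ℂ k c, hx⟩ = sineEmb ℂ k (modeOp (opC A₀) k c) := by
  refine exists_mem_domain fun j => ?_
  rw [coef_sineEmb, coef_sineEmb]
  split_ifs with h
  · rw [h]
  · rw [map_zero]

theorem dense_domain_parabolicOp : Dense ((parabolicOp A₀).domain : Set StateC) := by
  intro f
  refine mem_closure_of_tendsto (tendsto_cutoff ℂ f) (Eventually.of_forall fun N => ?_)
  rw [cutoff_apply]
  exact Submodule.sum_mem _ fun k _ => (sineEmb_mem_domain k _).1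

/-- An a priori estimate: solving the block equation for its leading term (k+1)² c leaves ω and a as
perturbations. -/
theorem freqSq_mul_norm_le (a : EuclideanSpace ℂ (Fin 2) →L[ℂ] EuclideanSpace ℂ (Fin 2)) (ω : ℂ)
    (k : ℕ) (c : EuclideanSpace ℂ (Fin 2)) :
    freqSq k * ‖c‖ ≤ ‖ω • c - modeOp a k c‖ + (‖ω‖ + ‖a‖) * ‖c‖ := by
  have e : freqSq k • c = (ω • c - modeOp a k c) - (ω • c - a c) := by
    rw [modeOp_apply]; abel
  have h1 : ‖freqSq k • c‖ = freqSq k * ‖c‖ := by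
    rw [norm_smul, Real.norm_of_nonneg (freqSq_pos k).le]
  rw [← h1, e]
  refine (norm_sub_le _ _).trans ?_
  refine add_le_add le_rfl ((norm_sub_le _ _).trans ?_)
  rw [add_mul, norm_smul]
  exact add_le_add le_rfl (a.le_opNorm c)

/-- Non-resonance makes each block injective, hence invertible. For large k the a priori estimate
absorbs ω and a, leaving 2/(k+1)²; the finitely many remaining blocks only enlarge the constant. -/
theorem exists_resolvent_blocks (hω : NonResonant A₀ ω) :
    ∃ (m : ℕ → EuclideanSpace ℂ (Fin 2) →L[ℂ] EuclideanSpace ℂ (Fin 2)) (C : ℝ), 0 ≤ C ∧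
      (∀ k c, ω • m k c - modeOp (opC A₀) k (m k c) = c) ∧
      (∀ k c, m k (ω • c - modeOp (opC A₀) k c) = c) ∧ ∀ k, ‖m k‖ ≤ C / freqSq k := by
  have hinj : ∀ k, Function.Injective ((ω • 1 - modeOp (opC A₀) k : _ →L[ℂ] _).toLinearMap) := by
    intro k
    rw [← LinearMap.ker_eq_bot, LinearMap.ker_eq_bot']
    exact fun c hc => hω.eq_zero k c (by simpa using hc)
  let e : ∀ k, EuclideanSpace ℂ (Fin 2) ≃L[ℂ] EuclideanSpace ℂ (Fin 2) := fun k =>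
    (LinearEquiv.ofInjectiveEndo _ (hinj k)).toContinuousLinearEquiv
  have he : ∀ k c, e k c = ω • c - modeOp (opC A₀) k c := fun k c => by simp [e]
  -- Beyond this K the perturbation is at most half of (k+1)².
  obtain ⟨K, hK⟩ := exists_nat_ge (2 * (‖ω‖ + ‖opC A₀‖))
  set m : ℕ → EuclideanSpace ℂ (Fin 2) →L[ℂ] EuclideanSpace ℂ (Fin 2) :=
    fun k => ((e k).symm : _ →L[ℂ] _) with hm
  have hnn : ∀ k, 0 ≤ freqSq k * ‖m k‖ := fun k => mul_nonneg (freqSq_pos k).le (norm_nonneg _)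
  have hS : 0 ≤ ∑ k ∈ Finset.range K, freqSq k * ‖m k‖ := Finset.sum_nonneg fun k _ => hnn k
  have h1 : ∀ k c, ω • m k c - modeOp (opC A₀) k (m k c) = c := fun k c => by
    rw [← he]; exact (e k).apply_symm_apply c
  refine ⟨m, 2 + ∑ k ∈ Finset.range K, freqSq k * ‖m k‖, by positivity, h1, fun k c => ?_,
    fun k => ?_⟩
  · rw [← he]; exact (e k).symm_apply_apply c
  · rw [le_div_iff₀ (freqSq_pos k), mul_comm]
    rcases lt_or_ge k K with hk | hk
    · refine (Finset.single_le_sum (fun k _ => hnn k) (Finset.mem_range.2 hk)).trans ?_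
      linarith
    · have h2 : ‖m k‖ ≤ 2 / freqSq k := by
        refine ContinuousLinearMap.opNorm_le_bound _ (div_nonneg zero_le_two (freqSq_pos k).le) fun c => ?_
        have h3 := freqSq_mul_norm_le (opC A₀) ω k (m k c)
        rw [h1] at h3
        have h4 : 2 * (‖ω‖ + ‖opC A₀‖) ≤ freqSq k :=
          hK.trans ((Nat.cast_le.2 hk).trans (le_freqSq k))
        rw [div_mul_eq_mul_div, le_div_iff₀ (freqSq_pos k)]
        nlinarith [norm_nonneg (m k c)]
      rw [le_div_iff₀ (freqSq_pos k), mul_comm] at h2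
      linarith

/-- Since the blocks decay, truncating to N modes changes the resolvent by at most C/N in norm, so
it is a norm limit of compact operators. -/
theorem NonResonant.exists_resolvent (hω : NonResonant A₀ ω) :
    ∃ R, IsResolventAt (parabolicOp A₀) ω R ∧ IsCompactOperator R := by
  obtain ⟨m, C, hC, h1, h2, h3⟩ := exists_resolvent_blocks hω
  have hmC : ∀ k, ‖m k‖ ≤ C := fun k => (h3 k).trans (div_le_self hC (one_le_freqSq k))
  set R : StateC →L[ℂ] StateC := blockDiag m C hmC with hR
  refine ⟨R, ⟨fun x => ?_, fun x => ?_⟩, ?_⟩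
  · obtain ⟨hd, hy⟩ := exists_mem_domain (A₀ := A₀) (x := R x) (y := ω • R x - x) fun k => by
      rw [map_sub, map_smul, hR, coef_blockDiag, sub_eq_iff_eq_add, ← sub_eq_iff_eq_add', h1]
    exact ⟨hd, by rw [hy, sub_sub_cancel]⟩
  · refine L2_ext_coef ℂ fun k => ?_
    rw [hR, coef_blockDiag, map_sub, map_smul, coef_parabolicOp, h2]
  · refine isCompactOperator_of_tendsto (F := fun N => R.comp (cutoff ℂ N)) (l := atTop) (f := R) ?_
      (Eventually.of_forall fun N => (isCompactOperator_cutoff ℂ N).clm_comp R)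
    rw [tendsto_iff_norm_sub_tendsto_zero]
    refine squeeze_zero' (Eventually.of_forall fun _ => norm_nonneg _)
      (g := fun N : ℕ => C / (N : ℝ)) ?_ (tendsto_const_div_atTop_nhds_zero_nat C)
    filter_upwards [eventually_gt_atTop 0] with N hN0
    have hN : (0 : ℝ) ≤ C / N := by positivity
    refine ContinuousLinearMap.opNorm_le_bound _ hN fun f => ?_
    refine norm_le_mul_of_coef_le (𝕜 := ℂ) hN fun k => ?_
    rw [sub_apply, map_sub, ContinuousLinearMap.comp_apply, hR, coef_blockDiag, coef_blockDiag,
      coef_cutoff]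
    split_ifs with hk
    · rw [sub_self, norm_zero]
      positivity
    · rw [map_zero, zero_sub, norm_neg]
      refine (m k).le_of_opNorm_le ((h3 k).trans ?_) _
      have : (N : ℝ) ≤ freqSq k := (Nat.cast_le.2 (not_lt.1 hk)).trans (le_freqSq k)
      have hN1 : (0 : ℝ) < N := Nat.cast_pos.2 hN0
      gcongr

/-- The resolvent identity S = R(1 + (ω - μ)S) carries compactness from one point to another. -/
theorem IsResolventAt.isCompactOperator {H : Type*} [NormedAddCommGroup H] [InnerProductSpace ℂ H]
    {A : H →ₗ.[ℂ] H} {ω μ : ℂ} {R S : H →L[ℂ] H} (hR : IsResolventAt A ω R)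
    (hc : IsCompactOperator R) (hS : IsResolventAt A μ S) : IsCompactOperator S := by
  have e : S = R.comp (1 + (ω - μ) • S) := by
    ext1 x
    obtain ⟨hd, hx⟩ := hS.1 x
    have h1 := hR.2 ⟨S x, hd⟩
    simp only [ContinuousLinearMap.comp_apply, add_apply, one_apply_eq_self, smul_apply]
    refine h1.symm.trans (congrArg R ?_)
    nth_rw 3 [← hx]
    simp only [sub_smul]
    abel
  rw [e]
  exact hc.comp_clm _

/-- An eigenvalue of a has modulus at most ‖a‖, and ‖a‖ + 1 + k² exceeds it. -/
theorem exists_nonResonant (A₀ : Matrix (Fin 2) (Fin 2) ℝ) : ∃ ω, NonResonant A₀ ω := by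
  refine ⟨((‖opC A₀‖ + 1 : ℝ) : ℂ), fun k _ hdet => ?_⟩
  obtain ⟨v, hv, h0⟩ := Matrix.exists_mulVec_eq_zero_iff.2 hdet
  set c : EuclideanSpace ℂ (Fin 2) := WithLp.toLp 2 v with hc
  have e : opC A₀ c = ((‖opC A₀‖ + 1 + (k : ℝ) ^ 2 : ℝ) : ℂ) • c := by
    rw [Matrix.sub_mulVec, sub_eq_zero] at h0
    ext i
    have := congrFun h0 i
    simp only [Matrix.scalar_apply, Matrix.mulVec_diagonal] at this
    rw [PiLp.smul_apply, smul_eq_mul]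
    refine (congrFun (Matrix.ofLp_toEuclideanCLM (matC A₀) c) i).trans ?_
    simp only [hc]
    rw [← this]
    push_cast
    ring
  have h1 := (opC A₀).le_opNorm c
  rw [e, norm_smul, Complex.norm_real, Real.norm_of_nonneg (by positivity)] at h1
  have hcpos : 0 < ‖c‖ := norm_pos_iff.2 fun h => hv (by simpa [hc] using h)
  nlinarith [sq_nonneg (k : ℝ)]

theorem hasCompactResolvent_parabolicOp (A₀ : Matrix (Fin 2) (Fin 2) ℝ) :
    HasCompactResolvent (parabolicOp A₀) := by
  obtain ⟨ω, hω⟩ := exists_nonResonant A₀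
  obtain ⟨R, hR, hc⟩ := hω.exists_resolvent
  exact ⟨⟨ω, R, hR⟩, fun μ S hS => hR.isCompactOperator hc hS⟩

end Resolvent

/-! ## The spectral decomposition -/

section Spectral

variable {A₀ : Matrix (Fin 2) (Fin 2) ℝ}

/-- On mode j, (λ - (j+1)²) - A acts as -(a - λ), so generalized eigenvectors of the matrix become
generalized eigenvectors of A. -/
theorem isInKerPow_sineEmb {lam : ℂ} (j n : ℕ) (c : EuclideanSpace ℂ (Fin 2))
    (h : (((opC A₀).toLinearMap - lam • 1 : Module.End ℂ _) ^ n) c = 0) :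
    IsInKerPow (parabolicOp A₀) (lam - (freqSq j : ℝ)) n (sineEmb ℂ j c) := by
  induction n generalizing c with
  | zero =>
    have : c = 0 := by simpa using h
    simp [IsInKerPow, this]
  | succ n ih =>
    obtain ⟨hd, hy⟩ := sineEmb_mem_domain (A₀ := A₀) j c
    refine ⟨hd, ?_⟩
    have e : (lam - (freqSq j : ℝ)) • sineEmb ℂ j c - parabolicOp A₀ ⟨sineEmb ℂ j c, hd⟩ =
        sineEmb ℂ j (-(((opC A₀).toLinearMap - lam • 1 : Module.End ℂ _) c)) := by
      rw [hy, ← map_smul, ← map_sub]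
      congr 1
      rw [modeOp_apply]
      simp only [LinearMap.sub_apply, LinearMap.smul_apply, Module.End.one_apply,
        ContinuousLinearMap.coe_coe, sub_smul, Complex.coe_smul]
      abel
    rw [e]
    refine ih _ ?_
    rw [map_neg, ← Module.End.mul_apply, ← pow_succ, h, neg_zero]

/-- Over ℂ the generalized eigenspaces of a span ℂ², and each of them embeds into mode j. -/
theorem sineEmb_mem_span (j : ℕ) (c : EuclideanSpace ℂ (Fin 2)) (H₁ : Submodule ℂ StateC)
    (h : ∀ c, sineEmb ℂ j c ∈ H₁) :
    sineEmb ℂ j c ∈ Submodule.span ℂ {x | x ∈ H₁ ∧ IsGenEigenvector (parabolicOp A₀) x} := by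
  have hc : c ∈ ⨆ lam : ℂ, Module.End.maxGenEigenspace (opC A₀).toLinearMap lam := by
    rw [Module.End.iSup_maxGenEigenspace_eq_top]
    trivial
  induction hc using Submodule.iSup_induction' with
  | mem lam c hc =>
    rw [Module.End.mem_maxGenEigenspace] at hc
    obtain ⟨n, hn⟩ := hc
    -- The exponent is raised by one because a generalized eigenvector requires a positive one and n
    -- may be 0.
    refine Submodule.subset_span ⟨h c, _, n + 1, by omega, isInKerPow_sineEmb (lam := lam) j (n + 1) c ?_⟩
    rw [pow_succ', Module.End.mul_apply, hn, map_zero]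
  | zero => rw [map_zero]; exact Submodule.zero_mem _
  | add c d _ _ hc hd => rw [map_add]; exact Submodule.add_mem _ hc hd

/-- An eigenvector of a placed on the lowest mode is an eigenvector of A. This makes the clause
about empty spectrum vacuous. -/
theorem spectrumSet_parabolicOp_ne_empty : spectrumSet (parabolicOp A₀) ≠ ∅ := by
  obtain ⟨lam, hlam⟩ := Module.End.exists_eigenvalue (opC A₀).toLinearMap
  obtain ⟨c, hc⟩ := hlam.exists_hasEigenvector
  intro h
  have hμ : lam - (freqSq 0 : ℝ) ∈ resolventSet (parabolicOp A₀) := by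
    by_contra hn
    exact (h ▸ (show lam - (freqSq 0 : ℝ) ∈ spectrumSet (parabolicOp A₀) from hn) :)
  obtain ⟨R, hR⟩ := hμ
  have hk : IsInKerPow (parabolicOp A₀) (lam - (freqSq 0 : ℝ)) 1 (sineEmb ℂ 0 c) :=
    isInKerPow_sineEmb 0 1 c (by
      have := hc.apply_eq_smul
      rw [ContinuousLinearMap.coe_coe] at this
      simp [this])
  obtain ⟨hd, hz⟩ := hk
  have h0 : (lam - (freqSq 0 : ℝ)) • sineEmb ℂ 0 c - parabolicOp A₀ ⟨sineEmb ℂ 0 c, hd⟩ = 0 := hz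
  have h1 := hR.2 ⟨_, hd⟩
  rw [h0, map_zero] at h1
  exact hc.2 ((sineEmb ℂ 0).injective (by rw [map_zero]; exact h1.symm))

/-- The semigroup `e^{At}`. -/
def heatSemigroup (A₀ : Matrix (Fin 2) (Fin 2) ℝ) : C0Semigroup StateC where
  op := heatOp (opC A₀)
  op_zero := heatOp_zero _
  op_add _ _ hs ht := heatOp_add _ hs ht
  tendsto_zero := tendsto_heatOp _

theorem heatSemigroup_hasGenerator (A₀ : Matrix (Fin 2) (Fin 2) ℝ) :
    (heatSemigroup A₀).HasGenerator (parabolicOp A₀).graph := by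
  intro x y
  rw [parabolicOp_graph, SetLike.mem_coe, mem_parabolicGraph_iff]
  exact (tendsto_slope_heatOp_iff _ x y).symm

/-- H_1 consists of the modes k < N and H_s of the others. With N ≥ ‖a‖ + 1 one has (k+1)² - ‖a‖ ≥ 1
for k ≥ N, so e^{At} decays like e^{-t} on H_s. No sharp splitting is needed: H_1 may contain
decaying modes too. -/
theorem spectralHypothesis_parabolicOp (A₀ : Matrix (Fin 2) (Fin 2) ℝ) :
    SpectralHypothesis (parabolicOp A₀) (heatSemigroup A₀) := by
  obtain ⟨N, hN⟩ := exists_nat_ge (‖opC A₀‖ + 1)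
  set P : StateC →L[ℂ] StateC := cutoff ℂ N with hP
  have hs : ∀ x, x ∈ P.ker ↔ ∀ k < N, coef ℂ k x = 0 := by
    refine fun x => ⟨fun hx k hk => ?_, fun h => L2_ext_coef ℂ fun k => ?_⟩
    · have := coef_cutoff ℂ N k x
      rw [if_pos hk] at this
      rw [← this, ← hP, show P x = 0 from hx, map_zero]
    · rw [map_zero]
      refine (coef_cutoff ℂ N k x).trans ?_
      split_ifs with hk
      exacts [h k hk, rfl]
  have h1 : ∀ x, x ∈ (1 - P).ker ↔ ∀ k, N ≤ k → coef ℂ k x = 0 := by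
    have hx' : ∀ x, x ∈ (1 - P).ker ↔ x = P x := fun x => by simp [sub_eq_zero]
    refine fun x => (hx' x).trans ⟨fun hx k hk => ?_, fun h => L2_ext_coef ℂ fun k => ?_⟩
    · rw [hx, hP, coef_cutoff, if_neg (not_lt.2 hk)]
    · rw [hP, coef_cutoff]
      split_ifs with hk
      exacts [rfl, h k (not_lt.1 hk)]
  have hPP : ∀ x, P (P x) = P x := fun x => L2_ext_coef ℂ fun k => by
    simp only [hP, coef_cutoff]
    split_ifs <;> rfl
  refine ⟨P.ker, (1 - P).ker, P.isClosed_ker, (1 - P).isClosed_ker, ?_, ?_, ?_, ?_, ?_⟩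
  · refine IsCompl.of_eq ?_ ?_
    · rw [Submodule.eq_bot_iff]
      rintro x ⟨hx, hx'⟩
      refine L2_ext_coef ℂ fun k => ?_
      rw [map_zero]
      exact (lt_or_ge k N).elim ((hs x).1 hx k) ((h1 x).1 hx' k)
    · rw [Submodule.eq_top_iff']
      intro x
      have : x = (x - P x) + P x := by abel
      rw [this]
      refine Submodule.add_mem_sup ?_ ?_
      · simp [hPP]
      · simp [hPP]
  · intro x hx
    rw [hs] at hx
    have hb : ∀ t ≥ 0, ‖heatOp (opC A₀) t x‖ ≤ Real.exp (-t) * ‖x‖ := fun t ht =>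
      norm_le_mul_of_coef_le (𝕜 := ℂ) (Real.exp_pos _).le fun k => by
        rw [coef_heatOp _ ht]
        rcases lt_or_ge k N with hk | hk
        · simp [hx k hk]
        · refine (modeExp (opC A₀) k t).le_of_opNorm_le ((norm_modeExp_le _ k ht).trans ?_) _
          rw [← Real.exp_add, Real.exp_le_exp]
          have : ‖opC A₀‖ + 1 ≤ freqSq k := hN.trans ((Nat.cast_le.2 hk).trans (le_freqSq k))
          nlinarith
    refine squeeze_zero_norm' (a := fun t => Real.exp (-t) * ‖x‖) ?_ ?_
    · filter_upwards [eventually_ge_atTop 0] with t ht using hb t ht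
    · simpa using (Real.tendsto_exp_neg_atTop_nhds_zero).mul_const ‖x‖
  · intro x hx t ht
    rw [h1] at hx ⊢
    intro k hk
    change coef ℂ k (heatOp (opC A₀) t x) = 0
    rw [coef_heatOp _ ht, hx k hk, map_zero]
  · refine le_antisymm (fun x hx => ?_) ?_
    · refine Submodule.le_topologicalClosure _ ?_
      have hx' : x = P x := by simpa [sub_eq_zero] using hx
      rw [hx', hP, cutoff_apply]
      refine Submodule.sum_mem _ fun k hk => sineEmb_mem_span k _ _ fun c => ?_
      rw [h1]
      intro j hj
      rw [coef_sineEmb, if_neg]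
      have := Finset.mem_range.1 hk
      omega
    · refine Submodule.topologicalClosure_minimal _ (Submodule.span_le.2 fun x hx => hx.1)
        (1 - P).isClosed_ker
  · exact fun h => absurd h spectrumSet_parabolicOp_ne_empty

end Spectral

/-! ## The extrapolation space -/

section Extrapolation

variable {H : Type*} [NormedAddCommGroup H] [InnerProductSpace ℂ H] [CompleteSpace H]
  {A : H →ₗ.[ℂ] H} {ω : ℂ} {R : H →L[ℂ] H}

theorem extend_eq_embed (hA : Dense (A.domain : Set H)) (x : A.domain) :
    extend A x = embed A (A x) := by
  ext v
  rw [extend_apply, embed_apply]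
  exact LinearPMap.adjoint_isFormalAdjoint hA v x

/-- The operator `ω - 𝒜 : H → (dom A^*)'`. -/
def shift (A : H →ₗ.[ℂ] H) (ω : ℂ) : H →L[ℂ] Extrap A := ω • embed A - extend A

theorem shift_apply (x : H) (v : GraphDom A.adjoint) :
    shift A ω x v = inner ℂ ((starRingEnd ℂ) ω • GraphDom.incl A.adjoint v - GraphDom.apply A.adjoint v) x := by
  rw [inner_sub_left, inner_smul_left, starRingEnd_self_apply, ← embed_apply, ← extend_apply]
  rfl

theorem shift_eq_embed (hA : Dense (A.domain : Set H)) (x : A.domain) :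
    shift A ω x = embed A (ω • (x : H) - A x) := by
  rw [shift, sub_apply, smul_apply, extend_eq_embed hA, map_sub, map_smul]

/-- Taking adjoints in R(ω - A) = 1 gives one half of the fact that R^* is the resolvent of A^* at
ω̄; `IsResolventAt.adjoint_apply` is the other half. -/
theorem IsResolventAt.adjoint_mem_domain (hA : Dense (A.domain : Set H)) (hR : IsResolventAt A ω R)
    (w : H) : ∃ h : R.adjoint w ∈ A.adjoint.domain,
      A.adjoint ⟨R.adjoint w, h⟩ = (starRingEnd ℂ) ω • R.adjoint w - w := by
  have key : ∀ x : A.domain, inner ℂ ((starRingEnd ℂ) ω • R.adjoint w - w) (x : H) =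
      inner ℂ (R.adjoint w) (A x) := fun x => by
    have h := hR.2 x
    rw [ContinuousLinearMap.adjoint_inner_left, inner_sub_left, inner_smul_left,
      starRingEnd_self_apply, ContinuousLinearMap.adjoint_inner_left]
    rw [map_sub, map_smul, sub_eq_iff_eq_add] at h
    rw [← inner_smul_right, h, inner_add_right]
    ring
  have hd := LinearPMap.mem_adjoint_domain_of_exists _ ⟨_, key⟩
  exact ⟨hd, LinearPMap.adjoint_apply_eq hA ⟨_, hd⟩ key⟩

theorem IsResolventAt.adjoint_apply (hA : Dense (A.domain : Set H)) (hR : IsResolventAt A ω R)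
    (v : A.adjoint.domain) : R.adjoint ((starRingEnd ℂ) ω • (v : H) - A.adjoint v) = v := by
  refine ext_inner_right ℂ fun y => ?_
  obtain ⟨hd, hy⟩ := hR.1 y
  rw [ContinuousLinearMap.adjoint_inner_left, inner_sub_left, inner_smul_left,
    starRingEnd_self_apply]
  have h : inner ℂ (A.adjoint v) (R y) = inner ℂ (v : H) (A ⟨R y, hd⟩) :=
    LinearPMap.adjoint_isFormalAdjoint hA v ⟨R y, hd⟩
  rw [h]
  nth_rw 3 [← hy]
  rw [inner_sub_right, inner_smul_right]

/-- The inverse of `ω̄ - A^*`, as a map into `dom A^*`. -/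
def adjointResolvent (hA : Dense (A.domain : Set H)) (hR : IsResolventAt A ω R) :
    H →L[ℂ] GraphDom A.adjoint :=
  LinearMap.mkContinuous
    (show H →ₗ[ℂ] GraphDom A.adjoint from
      LinearMap.codRestrict A.adjoint.domain R.adjoint.toLinearMap fun w =>
        (hR.adjoint_mem_domain hA w).1)
    (‖R.adjoint‖ + (‖ω‖ * ‖R.adjoint‖ + 1)) fun w => by
      set v : GraphDom A.adjoint := (show H →ₗ[ℂ] GraphDom A.adjoint from
        LinearMap.codRestrict A.adjoint.domain R.adjoint.toLinearMap fun w =>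
          (hR.adjoint_mem_domain hA w).1) w with hv
      have h := GraphDom.norm_sq A.adjoint v
      have h1 : ‖GraphDom.inclₗ A.adjoint v‖ ≤ ‖R.adjoint‖ * ‖w‖ := R.adjoint.le_opNorm w
      have h2 : ‖GraphDom.applyₗ A.adjoint v‖ ≤ (‖ω‖ * ‖R.adjoint‖ + 1) * ‖w‖ := by
        have e : GraphDom.applyₗ A.adjoint v = (starRingEnd ℂ) ω • R.adjoint w - w :=
          (hR.adjoint_mem_domain hA w).2
        rw [e]
        refine (norm_sub_le _ _).trans ?_
        rw [norm_smul, RCLike.norm_conj, add_mul, one_mul, mul_assoc]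
        gcongr
        exact R.adjoint.le_opNorm w
      have h3 : ‖v‖ ≤ ‖GraphDom.inclₗ A.adjoint v‖ + ‖GraphDom.applyₗ A.adjoint v‖ := by
        refine le_of_sq_le_sq ?_ (by positivity)
        rw [h]
        nlinarith [norm_nonneg (GraphDom.inclₗ A.adjoint v), norm_nonneg (GraphDom.applyₗ A.adjoint v)]
      rw [add_mul]
      exact h3.trans (add_le_add h1 h2)

theorem incl_adjointResolvent (hA : Dense (A.domain : Set H)) (hR : IsResolventAt A ω R) (w : H) :
    GraphDom.incl A.adjoint (adjointResolvent hA hR w) = R.adjoint w := rfl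

theorem apply_adjointResolvent (hA : Dense (A.domain : Set H)) (hR : IsResolventAt A ω R) (w : H) :
    GraphDom.apply A.adjoint (adjointResolvent hA hR w) = (starRingEnd ℂ) ω • R.adjoint w - w :=
  (hR.adjoint_mem_domain hA w).2

theorem adjointResolvent_apply (hA : Dense (A.domain : Set H)) (hR : IsResolventAt A ω R)
    (v : GraphDom A.adjoint) :
    adjointResolvent hA hR ((starRingEnd ℂ) ω • GraphDom.incl A.adjoint v - GraphDom.apply A.adjoint v) = v :=
  Subtype.ext (hR.adjoint_apply hA v)

/-- Testing with v = R^*x, for which (ω̄ - A^*)v = x, gives ⟨x, x⟩ = 0. -/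
theorem shift_injective (hA : Dense (A.domain : Set H)) (hR : IsResolventAt A ω R) :
    Function.Injective (shift A ω) := by
  rw [injective_iff_map_eq_zero]
  intro x hx
  have h := congrArg (fun z : Extrap A => z (adjointResolvent hA hR x)) hx
  simp only [shift_apply, incl_adjointResolvent, apply_adjointResolvent, sub_sub_cancel] at h
  exact inner_self_eq_zero.1 h

/-- Riesz representation: z composed with R^* and conjugated is a bounded linear functional on H,
and the vector representing it is the preimage of z. -/
theorem shift_surjective (hA : Dense (A.domain : Set H)) (hR : IsResolventAt A ω R) :
    Function.Surjective (shift A ω) := by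
  intro z
  set ℓ : StrongDual ℂ H := (starL ℂ : ℂ ≃L⋆[ℂ] ℂ).toContinuousLinearMap.comp (z.comp (adjointResolvent hA hR)) with hℓ
  refine ⟨(InnerProductSpace.toDual ℂ H).symm ℓ, ?_⟩
  ext v
  rw [shift_apply, ← inner_conj_symm, InnerProductSpace.toDual_symm_apply]
  have : ℓ ((starRingEnd ℂ) ω • GraphDom.incl A.adjoint v - GraphDom.apply A.adjoint v) =
      (starRingEnd ℂ) (z v) := by
    rw [← congrArg z (adjointResolvent_apply hA hR v)]
    rfl
  rw [this, starRingEnd_self_apply]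

/-- `ω - 𝒜` is an isomorphism of `H` onto `(dom A^*)'`. -/
def shiftEquiv (hA : Dense (A.domain : Set H)) (hR : IsResolventAt A ω R) : H ≃L[ℂ] Extrap A :=
  ContinuousLinearEquiv.ofBijective (shift A ω) (LinearMap.ker_eq_bot.2 (shift_injective hA hR))
    (LinearMap.range_eq_top.2 (shift_surjective hA hR))

theorem shiftEquiv_apply (hA : Dense (A.domain : Set H)) (hR : IsResolventAt A ω R) (x : H) :
    shiftEquiv hA hR x = shift A ω x := rfl

/-- The semigroup `e^{𝒜t}` on the extrapolation space. -/
def C0Semigroup.extrapolate (S : C0Semigroup H) (e : H ≃L[ℂ] Extrap A) : C0Semigroup (Extrap A) where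
  op t := (e : H →L[ℂ] Extrap A).comp ((S.op t).comp (e.symm : Extrap A →L[ℂ] H))
  op_zero := by
    ext1 z
    simp [S.op_zero]
  op_add s t hs ht := by
    ext1 z
    simp [S.op_add s t hs ht]
  tendsto_zero z := by
    have h := (e.continuous.tendsto _).comp (S.tendsto_zero (e.symm z))
    simpa [Function.comp_def] using h

theorem C0Semigroup.extrapolate_op_apply (S : C0Semigroup H) (e : H ≃L[ℂ] Extrap A) (t : ℝ) (x : H) :
    (S.extrapolate e).op t (e x) = e (S.op t x) := by
  simp [C0Semigroup.extrapolate]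

/-- The isomorphism e = ω - 𝒜 sends R x to the embedded x, that is, it maps dom A onto the copy of
H. It therefore carries the graph of A onto that of 𝒜, and conjugation carries one generator to the
other. -/
theorem C0Semigroup.extrapolate_hasGenerator (hA : Dense (A.domain : Set H))
    (hR : IsResolventAt A ω R) {S : C0Semigroup H} (hS : S.HasGenerator A.graph) :
    (S.extrapolate (shiftEquiv hA hR)).HasGenerator (extendGraph A) := by
  set e := shiftEquiv hA hR with he
  have hext : ∀ x, extend A x = ω • embed A x - e x := fun x => by
    rw [he, shiftEquiv_apply, shift]
    simp
  have hemb : ∀ x : A.domain, e x = embed A (ω • (x : H) - A x) := fun x => shift_eq_embed hA x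
  intro z z'
  obtain ⟨p, rfl⟩ := e.surjective z
  obtain ⟨q, rfl⟩ := e.surjective z'
  have h1 : ((e p, e q) ∈ extendGraph A) ↔ (p, q) ∈ A.graph := by
    constructor
    · rintro ⟨x, hx⟩
      obtain ⟨hd, hy⟩ := hR.1 x
      have e1 : e (R x) = embed A x := by
        have := hemb ⟨R x, hd⟩
        rwa [hy] at this
      obtain ⟨h1, h2⟩ := Prod.mk.inj hx
      have h1' : p = R x := e.injective (by rw [e1, h1])
      have h2' : q = ω • R x - x := e.injective (by rw [map_sub, map_smul, e1, ← h2, hext])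
      rw [LinearPMap.mem_graph_iff]
      refine ⟨⟨R x, hd⟩, h1'.symm, ?_⟩
      rw [h2']
      exact (sub_eq_of_eq_add' (sub_eq_iff_eq_add.1 hy)).symm
    · intro h
      rw [LinearPMap.mem_graph_iff] at h
      obtain ⟨x, rfl, rfl⟩ := h
      refine ⟨ω • (x : H) - A x, Prod.ext (hemb x).symm ?_⟩
      simp only [hext]
      rw [← hemb x, map_sub, map_smul, sub_sub_cancel]
  rw [h1, SetLike.mem_coe.symm, hS p q]
  have h2 : ∀ t : ℝ, ((t⁻¹ : ℝ) : ℂ) • ((S.extrapolate e).op t (e p) - e p) =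
      e (((t⁻¹ : ℝ) : ℂ) • (S.op t p - p)) := fun t => by
    rw [C0Semigroup.extrapolate_op_apply, map_smul, map_sub]
  simp_rw [h2]
  constructor
  · exact fun h => (e.continuous.tendsto q).comp h
  · intro h
    have := (e.symm.continuous.tendsto _).comp h
    simpa [Function.comp_def] using this

end Extrapolation

/-! ## The boundary kernel -/

section Kernel

/-- For 0 ≤ s ≤ 1, x^s ≤ max(1, x) ≤ e^x. -/
theorem exp_neg_le_rpow {x s : ℝ} (hx : 0 < x) (h0 : 0 ≤ s) (h1 : s ≤ 1) :
    Real.exp (-x) ≤ x ^ (-s) := by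
  rw [Real.exp_neg, Real.rpow_neg hx.le]
  refine inv_anti₀ (Real.rpow_pos_of_pos hx s) ?_
  have hle : x ≤ Real.exp x := by linarith [Real.add_one_le_exp x]
  rcases le_total x 1 with h | h
  · exact (Real.rpow_le_one hx.le h h0).trans (Real.one_le_exp hx.le)
  · calc x ^ s ≤ x ^ (1 : ℝ) := Real.rpow_le_rpow_of_exponent_le h h1
      _ = x := Real.rpow_one x
      _ ≤ _ := hle

/-- The weights `(k+1)^{-1+2θ}`. -/
def modeWeight (θ : ℝ) (k : ℕ) : ℝ := ((k : ℝ) + 1) ^ (-1 + 2 * θ)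

theorem modeWeight_nonneg (θ : ℝ) (k : ℕ) : 0 ≤ modeWeight θ k :=
  Real.rpow_nonneg (by positivity) _

/-- The exponent -2 + 4θ is below -1 precisely when θ < 1/4; this is where the restriction on θ
comes from. -/
theorem summable_modeWeight_sq {θ : ℝ} (hθ : θ < 1 / 4) : Summable fun k => modeWeight θ k ^ 2 := by
  have h := (summable_nat_add_iff 1).2 (Real.summable_nat_rpow (p := -2 + 4 * θ) |>.2 (by linarith))
  refine h.congr fun k => ?_
  rw [modeWeight, ← Real.rpow_natCast, ← Real.rpow_mul (by positivity)]
  push_cast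
  congr 1
  ring

/-- With s = 1 - θ, the power (k+1)^{-2(1-θ)} gained from the exponential outweighs the amplitude k
+ 1 and leaves (k+1)^{-1+2θ}. -/
theorem exp_neg_mul_le {θ : ℝ} (h0 : 0 ≤ θ) (h1 : θ ≤ 1) (k : ℕ) {t : ℝ} (ht : 0 < t) :
    Real.exp (-(freqSq k * t)) * ((k : ℝ) + 1) ≤ t ^ (-(1 - θ)) * modeWeight θ k := by
  have hk : (0 : ℝ) < (k : ℝ) + 1 := by positivity
  have h := exp_neg_le_rpow (mul_pos (freqSq_pos k) ht) (s := 1 - θ) (by linarith) (by linarith)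
  refine (mul_le_mul_of_nonneg_right h hk.le).trans_eq ?_
  rw [Real.mul_rpow (freqSq_pos k).le ht.le, freqSq, ← Real.rpow_natCast, ← Real.rpow_mul hk.le,
    mul_comm _ (t ^ _), mul_assoc, modeWeight]
  congr 1
  rw [← Real.rpow_add_one hk.ne']
  congr 1
  push_cast
  ring

variable {𝕜 : Type*} [RCLike 𝕜] {E : Type*} [NormedAddCommGroup E] [InnerProductSpace 𝕜 E]
  [NormedSpace ℝ E] [IsScalarTower ℝ 𝕜 E] [CompleteSpace E]

theorem norm_modeExp_sineAmp_le (a : E →L[𝕜] E) (b : E) {θ : ℝ} (h0 : 0 ≤ θ) (h1 : θ ≤ 1) (k : ℕ)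
    {t T : ℝ} (ht : 0 < t) (htT : t ≤ T) :
    ‖modeExp a k t (sineAmp k • b)‖ ≤
      Real.exp (T * ‖a‖) * √(2 / Real.pi) * ‖b‖ * t ^ (-(1 - θ)) * modeWeight θ k := by
  have h2 := norm_modeExp_le a k ht.le
  have h3 : Real.exp (t * ‖a‖) ≤ Real.exp (T * ‖a‖) := by gcongr
  have h4 := exp_neg_mul_le h0 h1 k ht
  have h5 : ‖sineAmp k • b‖ = √(2 / Real.pi) * ((k : ℝ) + 1) * ‖b‖ := by
    rw [norm_smul, sineAmp, Real.norm_of_nonneg (by positivity)]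
  refine ((modeExp a k t).le_of_opNorm_le h2 _).trans ?_
  rw [h5]
  calc _ = Real.exp (t * ‖a‖) * √(2 / Real.pi) * ‖b‖ * (Real.exp (-(freqSq k * t)) * ((k : ℝ) + 1)) := by
        ring
    _ ≤ Real.exp (T * ‖a‖) * √(2 / Real.pi) * ‖b‖ * (t ^ (-(1 - θ)) * modeWeight θ k) := by
        gcongr
    _ = _ := by ring

theorem exists_kernel (a : E →L[𝕜] E) (b : E) {t : ℝ} (ht : 0 < t) :
    ∃ f : L2 E, ∀ k, coef 𝕜 k f = modeExp a k t (sineAmp k • b) := by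
  refine exists_coef_eq 𝕜 ?_
  -- At a fixed positive time θ = 0 suffices; its singularity t⁻¹ matters only for integrability in
  -- t.
  refine Summable.of_nonneg_of_le (fun _ => by positivity) (fun k => ?_)
    ((summable_modeWeight_sq (θ := 0) (by norm_num)).mul_left
      ((Real.exp (t * ‖a‖) * √(2 / Real.pi) * ‖b‖ * t ^ (-(1 - 0) : ℝ)) ^ 2))
  rw [← mul_pow]
  exact pow_le_pow_left₀ (norm_nonneg _)
    (norm_modeExp_sineAmp_le a b le_rfl zero_le_one k ht le_rfl) 2

open Classical in
/-- The state at time `t > 0` produced by a unit impulse at the boundary. -/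
def boundaryKernel (a : E →L[𝕜] E) (b : E) (t : ℝ) : L2 E :=
  if ht : 0 < t then (exists_kernel a b ht).choose else 0

theorem coef_boundaryKernel (a : E →L[𝕜] E) (b : E) {t : ℝ} (ht : 0 < t) (k : ℕ) :
    coef 𝕜 k (boundaryKernel a b t) = modeExp a k t (sineAmp k • b) := by
  rw [boundaryKernel, dif_pos ht]
  exact (exists_kernel a b ht).choose_spec k

theorem exists_norm_boundaryKernel_le (a : E →L[𝕜] E) (b : E) {θ : ℝ} (hθ : θ ∈ Ioo (0 : ℝ) (1 / 4))
    (T : ℝ) : ∃ M : ℝ, 0 ≤ M ∧ ∀ t ∈ Ioo 0 T, ‖boundaryKernel a b t‖ ≤ M * t ^ (-(1 - θ)) := by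
  set W := ∑' k, modeWeight θ k ^ 2 with hW
  have hW0 : 0 ≤ W := tsum_nonneg fun k => sq_nonneg _
  set C := Real.exp (T * ‖a‖) * √(2 / Real.pi) * ‖b‖ with hC
  refine ⟨C * √W, by positivity, fun t ht => ?_⟩
  have hp : (0 : ℝ) ≤ t ^ (-(1 - θ)) := Real.rpow_nonneg ht.1.le _
  have h := norm_le_of_coef_le 𝕜 (f := boundaryKernel a b t)
    (b := fun k => C * t ^ (-(1 - θ)) * modeWeight θ k)
    (by simp_rw [mul_pow _ (modeWeight θ _)]; exact (summable_modeWeight_sq hθ.2).mul_left _) fun k => by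
      rw [coef_boundaryKernel a b ht.1]
      exact norm_modeExp_sineAmp_le a b hθ.1.le (by linarith [hθ.2]) k ht.1 ht.2.le
  simp_rw [mul_pow _ (modeWeight θ _)] at h
  rw [tsum_mul_left, ← hW] at h
  refine le_of_sq_le_sq (h.trans_eq ?_) (by positivity)
  rw [mul_pow (C * √W), mul_pow C (√W), mul_pow C, Real.sq_sqrt hW0]
  ring

/-- Near t₀ the coefficients are dominated by those bounds at time t₀/2 with θ = 0. Continuity
serves to provide measurability of the kernel. -/
theorem continuousOn_boundaryKernel (a : E →L[𝕜] E) (b : E) :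
    ContinuousOn (boundaryKernel a b) (Ioi 0) := by
  intro t₀ ht₀
  have ht₀' : 0 < t₀ := ht₀
  refine ContinuousAt.continuousWithinAt ?_
  set C := Real.exp (2 * t₀ * ‖a‖) * √(2 / Real.pi) * ‖b‖ with hC
  have hnear : ∀ t ∈ Ioo (t₀ / 2) (2 * t₀), ∀ k, ‖modeExp a k t (sineAmp k • b)‖ ≤
      C * (t₀ / 2) ^ (-(1 - 0) : ℝ) * modeWeight 0 k := fun t ht k => by
    have ht0 : 0 < t := by linarith [ht.1]
    refine (norm_modeExp_sineAmp_le a b le_rfl zero_le_one k ht0 ht.2.le).trans ?_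
    have : t ^ (-(1 - 0) : ℝ) ≤ (t₀ / 2) ^ (-(1 - 0) : ℝ) :=
      Real.rpow_le_rpow_of_nonpos (by linarith) ht.1.le (by norm_num)
    have := modeWeight_nonneg 0 k
    gcongr
  have hev : ∀ᶠ t in 𝓝 t₀, t ∈ Ioo (t₀ / 2) (2 * t₀) := Ioo_mem_nhds (by linarith) (by linarith)
  refine tendsto_of_coef 𝕜 (b := fun k => 2 * (C * (t₀ / 2) ^ (-(1 - 0) : ℝ)) * modeWeight 0 k)
    (by simp_rw [mul_pow _ (modeWeight 0 _)]
        exact (summable_modeWeight_sq (θ := 0) (by norm_num)).mul_left _) ?_ fun k => ?_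
  · filter_upwards [hev] with t ht k
    rw [coef_boundaryKernel a b (by linarith [ht.1]), coef_boundaryKernel a b ht₀']
    refine (norm_sub_le _ _).trans ?_
    have h1 := hnear t ht k
    have h2 := hnear t₀ hev.self_of_nhds k
    linarith
  · rw [coef_boundaryKernel a b ht₀']
    refine ((continuous_modeExp_apply a k _).tendsto t₀).congr' ?_
    filter_upwards [hev] with t ht
    rw [coef_boundaryKernel a b (by linarith [ht.1])]

theorem integrableOn_boundaryKernel (a : E →L[𝕜] E) (b : E) (T : ℝ) :
    IntegrableOn (boundaryKernel a b) (Ioo 0 T) := by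
  -- Any θ in (0, 1/4) would do; t^{-7/8} is integrable at 0.
  obtain ⟨M, hM, h⟩ := exists_norm_boundaryKernel_le a b (θ := 1 / 8) (by norm_num) T
  have hr : IntegrableOn (fun t : ℝ => M * t ^ (-(1 - 1 / 8) : ℝ)) (Ioo 0 T) := by
    refine Integrable.const_mul ?_ M
    have := (intervalIntegral.intervalIntegrable_rpow' (a := 0) (b := T) (r := (-(1 - 1 / 8) : ℝ))
      (by norm_num)).1
    exact this.mono_set Ioo_subset_Ioc_self
  refine Integrable.mono' hr ?_ ?_
  · exact ((continuousOn_boundaryKernel a b).mono fun t ht => ht.1).aestronglyMeasurable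
      measurableSet_Ioo
  · filter_upwards [ae_restrict_mem measurableSet_Ioo] with t ht using h t ht

end Kernel

/-! ## Young's inequality `L¹ * L² ⊆ L²` -/

section Young

open scoped ENNReal

/-- Cauchy–Schwarz for the splitting υκ = (υ κ^{1/2}) κ^{1/2}. -/
theorem sq_lintegral_mul_le {α : Type*} [MeasurableSpace α] {μ : Measure α} {υ κ : α → ℝ≥0∞}
    (hυ : AEMeasurable υ μ) (hκ : AEMeasurable κ μ) :
    (∫⁻ s, υ s * κ s ∂μ) ^ 2 ≤ (∫⁻ s, κ s ∂μ) * ∫⁻ s, υ s ^ 2 * κ s ∂μ := by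
  have h2 : ∀ x : ℝ≥0∞, (x ^ (1 / 2 : ℝ)) ^ 2 = x := fun x => by
    rw [← ENNReal.rpow_natCast, ← ENNReal.rpow_mul]; norm_num
  have hκ' : AEMeasurable (fun s => κ s ^ (1 / 2 : ℝ)) μ := hκ.pow_const _
  have h := ENNReal.lintegral_mul_le_Lp_mul_Lq μ Real.HolderConjugate.two_two (hυ.mul hκ') hκ'
  have e1 : ∀ s, ((υ * fun s => κ s ^ (1 / 2 : ℝ)) * fun s => κ s ^ (1 / 2 : ℝ)) s = υ s * κ s := by
    intro s
    simp only [Pi.mul_apply]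
    rw [mul_assoc, ← sq, h2]
  have e2 : ∀ s, (υ * fun s => κ s ^ (1 / 2 : ℝ)) s ^ (2 : ℝ) = υ s ^ 2 * κ s := by
    intro s
    rw [ENNReal.rpow_two, Pi.mul_apply, mul_pow, h2]
  have e3 : ∀ s, (κ s ^ (1 / 2 : ℝ)) ^ (2 : ℝ) = κ s := by
    intro s
    rw [ENNReal.rpow_two, h2]
  simp_rw [e1, e2, e3] at h
  calc (∫⁻ s, υ s * κ s ∂μ) ^ 2 ≤ _ := pow_le_pow_left₀ zero_le h 2
    _ = _ := by rw [mul_pow, h2, h2, mul_comm]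

/-- Apply the weighted Cauchy–Schwarz inequality for each t, then Tonelli and translation
invariance. -/
theorem lintegral_sq_lintegral_le {υ κ : ℝ → ℝ≥0∞} (hυ : AEMeasurable υ) (hκ : AEMeasurable κ) :
    ∫⁻ t, (∫⁻ s, υ s * κ (t - s)) ^ 2 ≤ (∫⁻ s, κ s) ^ 2 * ∫⁻ s, υ s ^ 2 := by
  have hκt : ∀ t, AEMeasurable fun s => κ (t - s) := fun t =>
    hκ.comp_quasiMeasurePreserving (quasiMeasurePreserving_sub_left_of_right_invariant volume t)
  have hint : ∀ t, ∫⁻ s, κ (t - s) = ∫⁻ s, κ s := fun t => lintegral_sub_left_eq_self κ t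
  have hmeas : AEMeasurable (fun p : ℝ × ℝ => υ p.2 ^ 2 * κ (p.1 - p.2)) (volume.prod volume) :=
    (hυ.pow_const 2).comp_snd.mul (hκ.comp_quasiMeasurePreserving
      (quasiMeasurePreserving_sub_of_right_invariant volume volume))
  calc ∫⁻ t, (∫⁻ s, υ s * κ (t - s)) ^ 2
      ≤ ∫⁻ t, (∫⁻ s, κ s) * ∫⁻ s, υ s ^ 2 * κ (t - s) := by
        refine lintegral_mono fun t => ?_
        have := sq_lintegral_mul_le hυ (hκt t)
        rwa [hint] at this
    _ = (∫⁻ s, κ s) * ∫⁻ t, ∫⁻ s, υ s ^ 2 * κ (t - s) :=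
        lintegral_const_mul'' _ hmeas.lintegral_prod_right'
    _ = (∫⁻ s, κ s) * ∫⁻ s, ∫⁻ t, υ s ^ 2 * κ (t - s) := by
        rw [lintegral_lintegral_swap hmeas]
    _ = (∫⁻ s, κ s) * ∫⁻ s, (∫⁻ s, κ s) * υ s ^ 2 := by
        congr 1
        refine lintegral_congr fun s => ?_
        have hs : AEMeasurable fun t => κ (t - s) := hκ.comp_quasiMeasurePreserving
          (measurePreserving_sub_right volume s).quasiMeasurePreserving
        rw [lintegral_const_mul'' _ hs, lintegral_sub_right_eq_self κ s, mul_comm]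
    _ = _ := by
        rw [lintegral_const_mul'' _ (hυ.pow_const 2), sq, mul_assoc]

variable {𝕜 : Type*} [RCLike 𝕜] {X : Type*} [NormedAddCommGroup X] [NormedSpace ℝ X]
  [NormedSpace 𝕜 X]

theorem eLpNorm_two_sq {α F : Type*} [MeasurableSpace α] [NormedAddCommGroup F] {μ : Measure α}
    (f : α → F) : eLpNorm f 2 μ ^ 2 = ∫⁻ s, ‖f s‖ₑ ^ 2 ∂μ := by
  rw [eLpNorm_eq_lintegral_rpow_enorm_toReal (by norm_num) (by norm_num),
    ← ENNReal.rpow_natCast, ← ENNReal.rpow_mul]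
  simp

theorem aestronglyMeasurable_conv_integrand {K : ℝ → X} {u : ℝ → 𝕜}
    (hK : AEStronglyMeasurable K) (hu : AEStronglyMeasurable u) :
    AEStronglyMeasurable (fun p : ℝ × ℝ => u p.2 • K (p.1 - p.2)) (volume.prod volume) :=
  hu.comp_snd.smul (hK.comp_quasiMeasurePreserving
    (quasiMeasurePreserving_sub_of_right_invariant volume volume))

theorem lintegral_sq_lintegral_enorm_le {K : ℝ → X} {u : ℝ → 𝕜}
    (hK : AEStronglyMeasurable K) (hu : AEStronglyMeasurable u) :
    ∫⁻ t, (∫⁻ s, ‖u s • K (t - s)‖ₑ) ^ 2 ≤ ((∫⁻ s, ‖K s‖ₑ) * eLpNorm u 2) ^ 2 := by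
  simp_rw [enorm_smul]
  rw [mul_pow, eLpNorm_two_sq]
  exact lintegral_sq_lintegral_le hu.enorm hK.enorm

/-- The convolution of the norms has finite L² norm, so it is finite for almost every t. -/
theorem ae_integrable_conv {K : ℝ → X} {u : ℝ → 𝕜} (hK : Integrable K) (hu : MemLp u 2) :
    ∀ᵐ t : ℝ, Integrable fun s => u s • K (t - s) := by
  have hm := aestronglyMeasurable_conv_integrand hK.1 hu.1
  have h1 := lintegral_sq_lintegral_enorm_le hK.1 hu.1
  have h2 : ∫⁻ t, (∫⁻ s, ‖u s • K (t - s)‖ₑ) ^ 2 ≠ ∞ :=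
    ne_top_of_le_ne_top (ENNReal.pow_ne_top (ENNReal.mul_ne_top hK.2.ne hu.2.ne)) h1
  have h3 := ae_lt_top' (hm.enorm.lintegral_prod_right'.pow_const 2) h2
  filter_upwards [h3] with t ht
  refine ⟨hu.1.smul (hK.1.comp_quasiMeasurePreserving
    (quasiMeasurePreserving_sub_left_of_right_invariant volume t)), ?_⟩
  exact (ENNReal.pow_lt_top_iff.1 ht).resolve_right (by norm_num)

theorem aestronglyMeasurable_conv {K : ℝ → X} {u : ℝ → 𝕜}
    (hK : AEStronglyMeasurable K) (hu : AEStronglyMeasurable u) :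
    AEStronglyMeasurable fun t => ∫ s, u s • K (t - s) :=
  (aestronglyMeasurable_conv_integrand hK hu).integral_prod_right'

theorem eLpNorm_conv_le {K : ℝ → X} {u : ℝ → 𝕜}
    (hK : AEStronglyMeasurable K) (hu : AEStronglyMeasurable u) :
    eLpNorm (fun t => ∫ s, u s • K (t - s)) 2 ≤ (∫⁻ s, ‖K s‖ₑ) * eLpNorm u 2 := by
  refine (ENNReal.pow_le_pow_left_iff two_ne_zero).1 ?_
  rw [eLpNorm_two_sq]
  refine le_trans (lintegral_mono fun t => ?_) (lintegral_sq_lintegral_enorm_le hK hu)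
  exact pow_le_pow_left₀ zero_le (enorm_integral_le_lintegral_enorm _) 2

/-- The causal convolution on `(0, T)`. -/
def causalConv (K : ℝ → X) (u : ℝ → 𝕜) (t : ℝ) : X := ∫ s in (0)..t, u s • K (t - s)

/-- Extending u and K by zero outside (0,T) reduces the causal convolution to the one on the whole
line: K at negative times is cut off, which enforces s < t. -/
theorem indicator_smul_indicator (K : ℝ → X) (u : ℝ → 𝕜) {t T : ℝ} (ht : t ∈ Ioo 0 T) (s : ℝ) :
    (Ioo 0 T).indicator u s • (Ioo 0 T).indicator K (t - s) =
      (Ioo 0 t).indicator (fun s => u s • K (t - s)) s := by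
  by_cases hs : s ∈ Ioo 0 t
  · have h1 : s ∈ Ioo 0 T := ⟨hs.1, hs.2.trans ht.2⟩
    have h2 : t - s ∈ Ioo 0 T := ⟨sub_pos.2 hs.2, by linarith [hs.1, ht.2]⟩
    rw [indicator_of_mem hs, indicator_of_mem h1, indicator_of_mem h2]
  · rw [indicator_of_notMem hs]
    by_cases h0 : 0 < s
    · have : t - s ∉ Ioo 0 T := fun h => hs ⟨h0, sub_pos.1 h.1⟩
      rw [indicator_of_notMem this, smul_zero]
    · have : s ∉ Ioo 0 T := fun h => h0 h.1
      rw [indicator_of_notMem this, zero_smul]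

variable {K : ℝ → X} {u : ℝ → 𝕜} {T : ℝ}

theorem ae_intervalIntegrable_causalConv (hK : IntegrableOn K (Ioo 0 T))
    (hu : MemLp u 2 (volume.restrict (Ioo 0 T))) :
    ∀ᵐ t ∂(volume.restrict (Ioo 0 T)),
      IntervalIntegrable (fun s => u s • K (t - s)) volume 0 t := by
  have h : ∀ᵐ t : ℝ, Integrable fun s =>
      (Ioo 0 T).indicator u s • (Ioo 0 T).indicator K (t - s) := ae_integrable_conv ((integrable_indicator_iff measurableSet_Ioo).2 hK)
    ((memLp_indicator_iff_restrict measurableSet_Ioo).2 hu)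
  filter_upwards [ae_restrict_of_ae h, ae_restrict_mem measurableSet_Ioo] with t h1 ht
  simp_rw [indicator_smul_indicator K u ht] at h1
  rw [intervalIntegrable_iff_integrableOn_Ioo_of_le ht.1.le]
  exact (integrable_indicator_iff measurableSet_Ioo).1 h1

theorem causalConv_eq {t : ℝ} (ht : t ∈ Ioo 0 T) :
    ∫ s, (Ioo 0 T).indicator u s • (Ioo 0 T).indicator K (t - s) = causalConv K u t := by
  simp_rw [indicator_smul_indicator K u ht]
  rw [integral_indicator measurableSet_Ioo, integral_Ioo_eq_intervalIntegral ht.1.le, causalConv]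

theorem aestronglyMeasurable_causalConv (hK : IntegrableOn K (Ioo 0 T))
    (hu : MemLp u 2 (volume.restrict (Ioo 0 T))) :
    AEStronglyMeasurable (causalConv K u) (volume.restrict (Ioo 0 T)) := by
  refine (aestronglyMeasurable_conv ((integrable_indicator_iff measurableSet_Ioo).2 hK).1
    ((memLp_indicator_iff_restrict measurableSet_Ioo).2 hu).1).restrict.congr ?_
  filter_upwards [ae_restrict_mem measurableSet_Ioo] with t ht using causalConv_eq ht

theorem eLpNorm_causalConv_le (hK : IntegrableOn K (Ioo 0 T))
    (hu : MemLp u 2 (volume.restrict (Ioo 0 T))) :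
    eLpNorm (causalConv K u) 2 (volume.restrict (Ioo 0 T)) ≤
      (∫⁻ s in Ioo 0 T, ‖K s‖ₑ) * eLpNorm u 2 (volume.restrict (Ioo 0 T)) := by
  have h := eLpNorm_conv_le ((integrable_indicator_iff measurableSet_Ioo).2 hK).1
    ((memLp_indicator_iff_restrict measurableSet_Ioo).2 hu).1
  rw [eLpNorm_indicator_eq_eLpNorm_restrict measurableSet_Ioo] at h
  simp_rw [enorm_indicator_eq_indicator_enorm] at h
  rw [lintegral_indicator measurableSet_Ioo] at h
  refine le_trans ?_ h
  refine le_trans (eLpNorm_congr_ae ?_).le (eLpNorm_mono_measure _ Measure.restrict_le_self)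
  filter_upwards [ae_restrict_mem measurableSet_Ioo] with t ht using (causalConv_eq ht).symm

theorem memLp_causalConv (hK : IntegrableOn K (Ioo 0 T))
    (hu : MemLp u 2 (volume.restrict (Ioo 0 T))) :
    MemLp (causalConv K u) 2 (volume.restrict (Ioo 0 T)) :=
  ⟨aestronglyMeasurable_causalConv hK hu, (eLpNorm_causalConv_le hK hu).trans_lt
    (ENNReal.mul_lt_top hK.2 hu.2)⟩

theorem causalConv_add {v : ℝ → 𝕜} {t : ℝ}
    (hu : IntervalIntegrable (fun s => u s • K (t - s)) volume 0 t)
    (hv : IntervalIntegrable (fun s => v s • K (t - s)) volume 0 t) :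
    causalConv K (u + v) t = causalConv K u t + causalConv K v t := by
  simp only [causalConv, Pi.add_apply, add_smul]
  exact intervalIntegral.integral_add hu hv

theorem causalConv_smul [SMulCommClass ℝ 𝕜 X] (c : 𝕜) (t : ℝ) :
    causalConv K (c • u) t = c • causalConv K u t := by
  simp only [causalConv, Pi.smul_apply, smul_assoc, intervalIntegral.integral_smul]

theorem causalConv_congr {v : ℝ → 𝕜} (h : u =ᵐ[volume.restrict (Ioo 0 T)] v) {t : ℝ}
    (ht : t ∈ Ioo 0 T) : causalConv K u t = causalConv K v t := by
  rw [causalConv, causalConv, ← integral_Ioo_eq_intervalIntegral ht.1.le,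
    ← integral_Ioo_eq_intervalIntegral ht.1.le]
  refine integral_congr_ae ?_
  have := ae_mono (Measure.restrict_mono (Ioo_subset_Ioo_right ht.2.le) le_rfl) h
  filter_upwards [this] with s hs
  rw [hs]

/-- Convolution with an integrable kernel, as a bounded operator on `L²(0, T)`. -/
theorem exists_causalConv_clm [SMulCommClass ℝ 𝕜 X] (hK : IntegrableOn K (Ioo 0 T)) :
    ∃ L : Lp 𝕜 2 (volume.restrict (Ioo 0 T)) →L[𝕜] Lp X 2 (volume.restrict (Ioo 0 T)),
      ∀ u, L u =ᵐ[volume.restrict (Ioo 0 T)] causalConv K u := by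
  have hm : ∀ u : Lp 𝕜 2 (volume.restrict (Ioo 0 T)), MemLp (causalConv K u) 2
      (volume.restrict (Ioo 0 T)) := fun u => memLp_causalConv hK (Lp.memLp u)
  let L₀ : Lp 𝕜 2 (volume.restrict (Ioo 0 T)) →ₗ[𝕜] Lp X 2 (volume.restrict (Ioo 0 T)) :=
    { toFun := fun u => (hm u).toLp _
      map_add' := fun u v => by
        refine Lp.ext ?_
        filter_upwards [(hm (u + v)).coeFn_toLp, (hm u).coeFn_toLp, (hm v).coeFn_toLp,
          Lp.coeFn_add ((hm u).toLp _) ((hm v).toLp _),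
          ae_intervalIntegrable_causalConv hK (Lp.memLp u),
          ae_intervalIntegrable_causalConv hK (Lp.memLp v),
          ae_restrict_mem measurableSet_Ioo] with t h1 h2 h3 h4 h5 h6 ht
        rw [h1, h4, Pi.add_apply, h2, h3, causalConv_congr (Lp.coeFn_add u v) ht,
          causalConv_add h5 h6]
      map_smul' := fun c u => by
        refine Lp.ext ?_
        filter_upwards [(hm (c • u)).coeFn_toLp, (hm u).coeFn_toLp,
          Lp.coeFn_smul c ((hm u).toLp _), ae_restrict_mem measurableSet_Ioo] with t h1 h2 h3 ht
        rw [h1, RingHom.id_apply, h3, Pi.smul_apply, h2, causalConv_congr (Lp.coeFn_smul c u) ht,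
          causalConv_smul] }
  refine ⟨L₀.mkContinuous (∫⁻ s in Ioo 0 T, ‖K s‖ₑ).toReal fun u => ?_, fun u => (hm u).coeFn_toLp⟩
  change ‖(hm u).toLp _‖ ≤ _
  rw [Lp.norm_toLp, Lp.norm_def, ← ENNReal.toReal_mul]
  exact ENNReal.toReal_mono (ENNReal.mul_ne_top hK.2.ne (Lp.memLp u).2.ne)
    (eLpNorm_causalConv_le hK (Lp.memLp u))

end Young

/-! ## The control operator and mild solutions -/

/-! ### Bounds and time continuity of the semigroup -/

section HeatBounds

variable {𝕜 : Type*} [RCLike 𝕜] {E : Type*} [NormedAddCommGroup E] [InnerProductSpace 𝕜 E]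
  [NormedSpace ℝ E] [IsScalarTower ℝ 𝕜 E] [CompleteSpace E]

theorem norm_heatOp_apply_le (a : E →L[𝕜] E) {t T : ℝ} (ht : 0 ≤ t) (htT : t ≤ T) (f : L2 E) :
    ‖heatOp a t f‖ ≤ Real.exp (T * ‖a‖) * ‖f‖ := by
  refine norm_le_mul_of_coef_le (𝕜 := 𝕜) (Real.exp_pos _).le fun k => ?_
  rw [coef_heatOp a ht]
  refine (modeExp a k t).le_of_opNorm_le ((norm_modeExp_le_exp a k ht).trans ?_) _
  gcongr

theorem continuousOn_heatOp_apply (a : E →L[𝕜] E) (T : ℝ) (f : L2 E) :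
    ContinuousOn (fun t => heatOp a t f) (Icc 0 T) := by
  intro t₀ ht₀
  refine tendsto_of_coef 𝕜
    (summable_mul_norm_coef_sq (𝕜 := 𝕜) (2 * Real.exp (T * ‖a‖)) f) ?_ fun k => ?_
  · filter_upwards [self_mem_nhdsWithin] with t ht k
    have h : ∀ s ∈ Icc 0 T, ‖modeExp a k s (coef 𝕜 k f)‖ ≤ Real.exp (T * ‖a‖) * ‖coef 𝕜 k f‖ :=
      fun s hs => by
        refine (modeExp a k s).le_of_opNorm_le ((norm_modeExp_le_exp a k hs.1).trans ?_) _
        have := hs.2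
        gcongr
    rw [coef_heatOp a ht.1, coef_heatOp a ht₀.1]
    refine (norm_sub_le _ _).trans ?_
    linarith [h t ht, h t₀ ht₀]
  · rw [coef_heatOp a ht₀.1]
    refine (((continuous_modeExp_apply a k _).tendsto t₀).mono_left nhdsWithin_le_nhds).congr' ?_
    filter_upwards [self_mem_nhdsWithin] with t ht
    rw [coef_heatOp a ht.1]

end HeatBounds

section Control

variable {A₀ : Matrix (Fin 2) (Fin 2) ℝ} {B₀ : EuclideanSpace ℝ (Fin 2)} {ω ω' : ℂ}

/-- `D` satisfies, in Fourier coefficients, the equation of the Dirichlet map at `ω`. -/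
def IsDirichletMap (A₀ : Matrix (Fin 2) (Fin 2) ℝ) (B₀ : EuclideanSpace ℝ (Fin 2)) (ω : ℂ)
    (D : ℂ →L[ℂ] StateC) : Prop :=
  ∀ a k, ω • coef ℂ k (D a) - modeOp (opC A₀) k (coef ℂ k (D a)) = a • sineAmp k • vecC B₀

/-- The response in `H = L²(0,π;ℂ)²` to a unit impulse of the control. -/
abbrev kernelC (A₀ : Matrix (Fin 2) (Fin 2) ℝ) (B₀ : EuclideanSpace ℝ (Fin 2)) : ℝ → StateC :=
  boundaryKernel (opC A₀) (vecC B₀)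

variable {D D' : ℂ →L[ℂ] StateC}

/-- The boundary data of two Dirichlet maps cancel, so (D - D')1 lies in dom A and A maps it to ωD1
- ω'D'1. Rearranged, this says that the control operator is independent of ω. -/
theorem IsDirichletMap.shift_comp_eq (hD : IsDirichletMap A₀ B₀ ω D)
    (hD' : IsDirichletMap A₀ B₀ ω' D') :
    (shift (parabolicOp A₀) ω).comp D = (shift (parabolicOp A₀) ω').comp D' := by
  ext1
  obtain ⟨hx, h⟩ := exists_mem_domain (A₀ := A₀) (x := D 1 - D' 1) (y := ω • D 1 - ω' • D' 1)
    fun k => by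
      have h1 := hD 1 k
      rw [← hD' 1 k] at h1
      simp only [map_sub, map_smul]
      rw [sub_eq_sub_iff_sub_eq_sub] at h1
      exact h1
  have h2 := extend_eq_embed dense_domain_parabolicOp ⟨_, hx⟩
  rw [h] at h2
  simp only [map_sub, map_smul] at h2
  simp only [ContinuousLinearMap.comp_apply, shift, sub_apply, smul_apply]
  rw [sub_eq_sub_iff_sub_eq_sub]
  exact h2.symm

/-- Applying e^{t(a-(k+1)²)} to the coefficient equation of D turns its right-hand side into the
boundary kernel, which is in L² for t > 0. -/
theorem IsDirichletMap.exists_heatSemigroup_mem_domain (hD : IsDirichletMap A₀ B₀ ω D) {t : ℝ}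
    (ht : 0 < t) (a : ℂ) :
    ∃ hx : (heatSemigroup A₀).op t (D a) ∈ (parabolicOp A₀).domain,
      parabolicOp A₀ ⟨_, hx⟩ = ω • (heatSemigroup A₀).op t (D a) - a • kernelC A₀ B₀ t := by
  refine exists_mem_domain fun k => ?_
  have h := congrArg (modeExp (opC A₀) k t) (hD a k)
  simp only [map_sub, map_smul] at h
  rw [map_sub, map_smul, map_smul, coef_boundaryKernel _ _ ht]
  change ω • coef ℂ k (heatOp (opC A₀) t (D a)) - _ = modeOp (opC A₀) k (coef ℂ k (heatOp (opC A₀) t (D a)))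
  rw [coef_heatOp _ ht.le, modeOp_modeExp_comm, ← h]
  abel

theorem IsDirichletMap.exists_norm_le (hD : IsDirichletMap A₀ B₀ ω D) {θ : ℝ}
    (hθ : θ ∈ Ioo (0 : ℝ) (1 / 4)) (T : ℝ) :
    ∃ M : ℝ, ∀ t ∈ Ioo 0 T, ∀ a : ℂ,
      ∃ hx : (heatSemigroup A₀).op t (D a) ∈ (parabolicOp A₀).domain,
        ‖parabolicOp A₀ ⟨_, hx⟩‖ ≤ M * ‖a‖ / t ^ (1 - θ) := by
  obtain ⟨M, hM, h⟩ := exists_norm_boundaryKernel_le (opC A₀) (vecC B₀) hθ T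
  set C := ‖ω‖ * Real.exp (T * ‖opC A₀‖) * ‖D‖ with hC
  -- The term ω e^{At}D stays bounded by C on (0,T); the factor T^{1-θ} lets the singular weight
  -- absorb it.
  refine ⟨C * T ^ (1 - θ) + M, fun t ht a => ?_⟩
  obtain ⟨hx, hA⟩ := hD.exists_heatSemigroup_mem_domain ht.1 a
  refine ⟨hx, ?_⟩
  have hp : 0 < t ^ (1 - θ) := Real.rpow_pos_of_pos ht.1 _
  have hpT : t ^ (1 - θ) ≤ T ^ (1 - θ) :=
    Real.rpow_le_rpow ht.1.le ht.2.le (by linarith [hθ.2])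
  have h1 : ‖ω • (heatSemigroup A₀).op t (D a)‖ ≤ C * ‖a‖ := by
    rw [norm_smul, hC, mul_assoc, mul_assoc]
    refine mul_le_mul_of_nonneg_left ?_ (norm_nonneg _)
    refine (norm_heatOp_apply_le (opC A₀) ht.1.le ht.2.le (D a)).trans ?_
    exact mul_le_mul_of_nonneg_left (D.le_opNorm a) (Real.exp_pos _).le
  have h2 : ‖a • kernelC A₀ B₀ t‖ * t ^ (1 - θ) ≤ M * ‖a‖ := by
    have h3 := h t ht
    rw [Real.rpow_neg ht.1.le, ← div_eq_mul_inv, le_div_iff₀ hp] at h3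
    rw [norm_smul, mul_assoc, mul_comm M]
    exact mul_le_mul_of_nonneg_left h3 (norm_nonneg _)
  rw [hA, le_div_iff₀ hp]
  calc ‖ω • (heatSemigroup A₀).op t (D a) - a • kernelC A₀ B₀ t‖ * t ^ (1 - θ)
      ≤ (‖ω • (heatSemigroup A₀).op t (D a)‖ + ‖a • kernelC A₀ B₀ t‖) * t ^ (1 - θ) :=
        mul_le_mul_of_nonneg_right (norm_sub_le _ _) hp.le
    _ ≤ C * ‖a‖ * T ^ (1 - θ) + M * ‖a‖ := by
        rw [add_mul]
        have : 0 ≤ C * ‖a‖ := by positivity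
        gcongr
    _ = _ := by ring

variable {R : StateC →L[ℂ] StateC}

/-- The semigroup `e^{𝒜t}` of the parabolic system. -/
def extrapSemigroup (hR : IsResolventAt (parabolicOp A₀) ω R) :
    C0Semigroup (Extrap (parabolicOp A₀)) :=
  (heatSemigroup A₀).extrapolate (shiftEquiv dense_domain_parabolicOp hR)

/-- Conjugation gives e^{𝒜t}(ω - 𝒜)D = (ω - 𝒜)e^{At}D. For t > 0 the vector is in dom A, and ω
e^{At}D - A e^{At}D is the kernel. -/
theorem IsDirichletMap.extrapSemigroup_apply (hD : IsDirichletMap A₀ B₀ ω D)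
    (hR : IsResolventAt (parabolicOp A₀) ω R) {t : ℝ} (ht : 0 < t) (a : ℂ) :
    (extrapSemigroup hR).op t ((shift (parabolicOp A₀) ω).comp D a) =
      embed (parabolicOp A₀) (a • kernelC A₀ B₀ t) := by
  obtain ⟨hx, hA⟩ := hD.exists_heatSemigroup_mem_domain ht a
  have h := (heatSemigroup A₀).extrapolate_op_apply
    (shiftEquiv dense_domain_parabolicOp hR) t (D a)
  rw [shiftEquiv_apply, shiftEquiv_apply] at h
  refine h.trans ?_
  rw [shift_eq_embed dense_domain_parabolicOp ⟨_, hx⟩, hA, sub_sub_cancel]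

theorem IsDirichletMap.integral_extrapSemigroup (hD : IsDirichletMap A₀ B₀ ω D)
    (hR : IsResolventAt (parabolicOp A₀) ω R) {t : ℝ} (ht : 0 < t) {u : ℝ → ℂ}
    (hu : IntervalIntegrable (fun s => u s • kernelC A₀ B₀ (t - s)) volume 0 t) :
    IntervalIntegrable (fun s => (extrapSemigroup hR).op (t - s)
        ((shift (parabolicOp A₀) ω).comp D (u s))) volume 0 t ∧
      embed (parabolicOp A₀) (causalConv (kernelC A₀ B₀) u t) =
        ∫ s in (0)..t, (extrapSemigroup hR).op (t - s)
          ((shift (parabolicOp A₀) ω).comp D (u s)) := by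
  -- The identification needs t - s > 0, so the integrals are compared on the open interval.
  have he : ∀ s ∈ Ioo 0 t, embed (parabolicOp A₀) (u s • kernelC A₀ B₀ (t - s)) =
      (extrapSemigroup hR).op (t - s) ((shift (parabolicOp A₀) ω).comp D (u s)) := fun s hs =>
    (hD.extrapSemigroup_apply hR (sub_pos.2 hs.2) (u s)).symm
  constructor
  · rw [intervalIntegrable_iff_integrableOn_Ioo_of_le ht.le] at hu ⊢
    exact ((embed (parabolicOp A₀)).integrable_comp hu).congr
      ((ae_restrict_mem measurableSet_Ioo).mono fun s hs => he s hs)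
  · rw [causalConv, ← ContinuousLinearMap.intervalIntegral_comp_comm _ hu,
      ← integral_Ioo_eq_intervalIntegral ht.le, ← integral_Ioo_eq_intervalIntegral ht.le]
    exact setIntegral_congr_fun measurableSet_Ioo he

theorem IsDirichletMap.regularityHypothesis (hD : IsDirichletMap A₀ B₀ ω D)
    (hR : IsResolventAt (parabolicOp A₀) ω R) :
    RegularityHypothesis (parabolicOp A₀) (extrapSemigroup hR)
      ((shift (parabolicOp A₀) ω).comp D) := by
  intro T _
  have hK := integrableOn_boundaryKernel (opC A₀) (vecC B₀) T
  obtain ⟨L, hL⟩ := exists_causalConv_clm (𝕜 := ℂ) hK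
  refine ⟨L, fun u => ?_⟩
  filter_upwards [hL u, ae_intervalIntegrable_causalConv hK (Lp.memLp u),
    ae_restrict_mem measurableSet_Ioo] with t h1 h2 ht
  rw [h1]
  exact hD.integral_extrapSemigroup hR ht.1 h2

/-! ### The real system -/

/-- The response in `L²(0,π)²` to a unit impulse of the control. -/
abbrev kernelR (A₀ : Matrix (Fin 2) (Fin 2) ℝ) (B₀ : EuclideanSpace ℝ (Fin 2)) : ℝ → StateR :=
  boundaryKernel (matOp A₀) B₀

/-- The solution of the boundary control system. -/
def controlState (A₀ : Matrix (Fin 2) (Fin 2) ℝ) (B₀ : EuclideanSpace ℝ (Fin 2)) (y₀ : StateR)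
    (u : ℝ → ℝ) (t : ℝ) : StateR :=
  heatOp (matOp A₀) t y₀ + causalConv (kernelR A₀ B₀) u t

theorem vecC_matOp (A₀ : Matrix (Fin 2) (Fin 2) ℝ) (c : EuclideanSpace ℝ (Fin 2)) :
    vecC (matOp A₀ c) = opC A₀ (vecC c) := by
  ext i
  fin_cases i <;> simp [vecC, matOp, opC, matC, Matrix.mulVec, dotProduct]

theorem vecC_modeExp (A₀ : Matrix (Fin 2) (Fin 2) ℝ) (k : ℕ) (t : ℝ)
    (c : EuclideanSpace ℝ (Fin 2)) :
    vecC (modeExp (matOp A₀) k t c) = modeExp (opC A₀) k t (vecC c) := by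
  rw [modeExp_apply, modeExp_apply, map_smul, expOp_intertwine (vecC_matOp A₀)]

theorem stateC_heatOp (A₀ : Matrix (Fin 2) (Fin 2) ℝ) {t : ℝ} (ht : 0 ≤ t) (f : StateR) :
    stateC (heatOp (matOp A₀) t f) = heatOp (opC A₀) t (stateC f) := by
  refine L2_ext_coef ℂ fun k => ?_
  rw [coef_stateC, coef_heatOp _ ht, coef_heatOp _ ht, vecC_modeExp, coef_stateC]

theorem stateC_kernelR (A₀ : Matrix (Fin 2) (Fin 2) ℝ) (B₀ : EuclideanSpace ℝ (Fin 2)) {t : ℝ}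
    (ht : 0 < t) : stateC (kernelR A₀ B₀ t) = kernelC A₀ B₀ t := by
  refine L2_ext_coef ℂ fun k => ?_
  rw [coef_stateC, coef_boundaryKernel _ _ ht, coef_boundaryKernel _ _ ht, vecC_modeExp, map_smul]

theorem stateC_causalConv {t : ℝ} (ht : 0 < t) {u : ℝ → ℝ}
    (hu : IntervalIntegrable (fun s => u s • kernelR A₀ B₀ (t - s)) volume 0 t) :
    stateC (causalConv (kernelR A₀ B₀) u t) =
      causalConv (kernelC A₀ B₀) (fun s => (u s : ℂ)) t := by
  rw [causalConv, ← ContinuousLinearMap.intervalIntegral_comp_comm _ hu, causalConv,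
      ← integral_Ioo_eq_intervalIntegral ht.le, ← integral_Ioo_eq_intervalIntegral ht.le]
  refine setIntegral_congr_fun measurableSet_Ioo fun s hs => ?_
  change stateC (u s • kernelR A₀ B₀ (t - s)) = (u s : ℂ) • kernelC A₀ B₀ (t - s)
  rw [map_smul, stateC_kernelR _ _ (sub_pos.2 hs.2)]
  rfl

variable {T : ℝ} {u : ℝ → ℝ}

theorem memLp_controlState (y₀ : StateR) (hu : MemLp u 2 (volume.restrict (Ioo 0 T))) :
    MemLp (controlState A₀ B₀ y₀ u) 2 (volume.restrict (Ioo 0 T)) :=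
  (memLp_of_continuousOn_Icc (continuousOn_heatOp_apply (matOp A₀) T y₀)).add
    (memLp_causalConv (integrableOn_boundaryKernel (matOp A₀) B₀ T) hu)

theorem IsDirichletMap.isMildSolution (hD : IsDirichletMap A₀ B₀ ω D)
    (hR : IsResolventAt (parabolicOp A₀) ω R) (y₀ : StateR)
    (hu : MemLp u 2 (volume.restrict (Ioo 0 T))) :
    IsMildSolution (parabolicOp A₀) (heatSemigroup A₀) (extrapSemigroup hR)
      ((shift (parabolicOp A₀) ω).comp D) T (stateC y₀) (fun t => (u t : ℂ))
      (fun t => stateC (controlState A₀ B₀ y₀ u t)) := by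
  refine ⟨stateC.comp_memLp' (memLp_controlState y₀ hu), ?_⟩
  have huC : MemLp (fun t => (u t : ℂ)) 2 (volume.restrict (Ioo 0 T)) := hu.ofReal
  filter_upwards [ae_intervalIntegrable_causalConv
    (integrableOn_boundaryKernel (opC A₀) (vecC B₀) T) huC,
    ae_intervalIntegrable_causalConv (integrableOn_boundaryKernel (matOp A₀) B₀ T) hu,
    ae_restrict_mem measurableSet_Ioo] with t h1 h2 ht
  obtain ⟨h3, h4⟩ := hD.integral_extrapSemigroup hR ht.1 h1
  refine ⟨h3, ?_⟩
  rw [controlState, map_add, map_add, stateC_heatOp _ ht.1.le, stateC_causalConv ht.1 h2, h4]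
  rfl

end Control

/-! ## Duality on a single mode -/

section ModeDuality

theorem intervalIntegrable_bilin {E F G : Type*} [NormedAddCommGroup E] [NormedSpace ℝ E]
    [NormedAddCommGroup F] [NormedSpace ℝ F] [NormedAddCommGroup G] [NormedSpace ℝ G]
    (B : E →L[ℝ] F →L[ℝ] G) {a b : ℝ} (hab : a ≤ b) {f : ℝ → E} {g : ℝ → F}
    (hf : ContinuousOn f (Icc a b)) (hg : IntervalIntegrable g volume a b) :
    IntervalIntegrable (fun t => B (f t) (g t)) volume a b := by
  rw [intervalIntegrable_iff_integrableOn_Ioo_of_le hab] at hg ⊢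
  obtain ⟨C, hC⟩ := isCompact_Icc.exists_bound_of_continuousOn hf
  refine Integrable.mono' (hg.norm.const_mul (‖B‖ * C))
    (B.aestronglyMeasurable_comp₂ ((hf.mono Ioo_subset_Icc_self).aestronglyMeasurable
      measurableSet_Ioo) hg.1) ?_
  filter_upwards [ae_restrict_mem measurableSet_Ioo] with t ht
  refine (B.le_opNorm₂ _ _).trans ?_
  have := hC t (Ioo_subset_Icc_self ht)
  gcongr

variable {E : Type*} [NormedAddCommGroup E] [InnerProductSpace ℝ E] [CompleteSpace E]

theorem hasDerivAt_modeExp (a : E →L[ℝ] E) (k : ℕ) (t : ℝ) :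
    HasDerivAt (modeExp a k) (modeOp a k * modeExp a k t) t := by
  have h1 : HasDerivAt (expOp a) (a * expOp a t) t := hasDerivAt_exp_smul_const' a t
  have h2 : HasDerivAt (fun t => Real.exp (-(freqSq k * t)))
      (Real.exp (-(freqSq k * t)) * -(freqSq k * 1)) t :=
    (((hasDerivAt_id t).const_mul (freqSq k)).neg).exp
  refine (h2.smul h1).congr_deriv ?_
  simp only [modeOp, modeExp, RCLike.ofReal_real_eq_id, id, sub_mul, mul_smul_comm, smul_mul_assoc,
    one_mul, mul_one]
  rw [smul_sub, smul_smul, mul_neg, neg_smul, ← sub_eq_add_neg]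

theorem modeExp_adjoint (a : E →L[ℝ] E) (k : ℕ) (t : ℝ) :
    (modeExp a k t).adjoint = modeExp a.adjoint k t := by
  have h : star (expOp a t) = expOp (star a) t := by
    rw [expOp, expOp, NormedSpace.star_exp, star_smul]
    simp
  rw [← ContinuousLinearMap.star_eq_adjoint, ← ContinuousLinearMap.star_eq_adjoint, modeExp,
    star_smul, h]
  simp [modeExp]

theorem inner_modeExp_left (a : E →L[ℝ] E) (k : ℕ) (t : ℝ) (x y : E) :
    inner ℝ (modeExp a k t x) y = inner ℝ x (modeExp a.adjoint k t y) := by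
  rw [← modeExp_adjoint, ContinuousLinearMap.adjoint_inner_right]

theorem continuous_modeExp (a : E →L[ℝ] E) (k : ℕ) : Continuous (modeExp a k) :=
  continuous_iff_continuousAt.2 fun t => (hasDerivAt_modeExp a k t).continuousAt

/-- Multiplying an absolutely continuous function with the exponential. -/
theorem modeExp_apply_eq_integral (a : E →L[ℝ] E) (k : ℕ) {T : ℝ} {φ φ' : ℝ → E}
    (hφ' : IntervalIntegrable φ' volume 0 T)
    (hφ : ∀ t ∈ Icc 0 T, φ t = φ 0 + ∫ s in (0)..t, φ' s) {t : ℝ} (ht : t ∈ Icc 0 T) :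
    modeExp a k t (φ t) = φ 0 + ∫ s in (0)..t, modeExp a k s (modeOp a k (φ s) + φ' s) := by
  have hc : Continuous fun s => modeOp a k * modeExp a k s := (continuous_modeExp a k).const_mul _
  have hsub : uIcc 0 t ⊆ uIcc 0 T := by
    rw [uIcc_of_le ht.1, uIcc_of_le (ht.1.trans ht.2)]
    exact Icc_subset_Icc_right ht.2
  have h := integral_bilin_by_parts (ContinuousLinearMap.id ℝ (E →L[ℝ] E)) ht.1
    (f := modeExp a k) (f' := fun s => modeOp a k * modeExp a k s) (g := φ) (g' := φ')
    (hc.intervalIntegrable _ _) (hφ'.mono_set hsub)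
    (fun s _ => by
      rw [intervalIntegral.integral_eq_sub_of_hasDerivAt (fun x _ => hasDerivAt_modeExp a k x)
        (hc.intervalIntegrable _ _), add_sub_cancel])
    (fun s hs => hφ s ⟨hs.1, hs.2.trans ht.2⟩)
  simp only [ContinuousLinearMap.id_apply, modeExp_zero] at h
  rw [eq_sub_iff_add_eq] at h
  rw [← h, add_comm]
  congr 1
  refine intervalIntegral.integral_congr fun s _ => ?_
  simp only [map_add]
  rw [← modeOp_modeExp_comm]
  rfl

/-- The identity of transposition on a single mode. -/
theorem integral_inner_mode (a : E →L[ℝ] E) (k : ℕ) {T : ℝ} (hT : 0 ≤ T) (x₀ b : E) {u : ℝ → ℝ}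
    (hu : IntervalIntegrable u volume 0 T) {φ φ' γ : ℝ → E}
    (hφ' : IntervalIntegrable φ' volume 0 T)
    (hφ : ∀ t ∈ Icc 0 T, φ t = φ 0 + ∫ s in (0)..t, φ' s) (hT0 : φ T = 0)
    (hγ : ∀ᵐ t ∂(volume.restrict (Ioo 0 T)), modeOp a.adjoint k (φ t) + φ' t = -γ t) :
    ∫ t in Ioo 0 T, inner ℝ (modeExp a k t (x₀ + ∫ s in (0)..t, u s • modeExp a k (-s) b)) (γ t) =
      inner ℝ x₀ (φ 0) + ∫ t in Ioo 0 T, u t * inner ℝ b (φ t) := by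
  have hφc : ContinuousOn φ (Icc 0 T) := (continuousOn_primitive hT hφ' (φ 0)).congr hφ
  -- Variation of constants on both sides: the state is e^{t a(k)} r with a(k) the block, and q =
  -- e^{t a(k)^*} φ. The unbalanced growth cancels, and the identity is the integrated derivative of
  -- ⟨r, q⟩ with q(T) = 0.
  set r' : ℝ → E := fun s => u s • modeExp a k (-s) b with hr'
  set r : ℝ → E := fun t => x₀ + ∫ s in (0)..t, r' s with hr
  set q : ℝ → E := fun t => modeExp a.adjoint k t (φ t) with hq
  set q' : ℝ → E := fun s => modeExp a.adjoint k s (modeOp a.adjoint k (φ s) + φ' s) with hq'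
  have hmc : Continuous fun s => modeExp a k (-s) b :=
    (continuous_modeExp_apply a k b).comp continuous_neg
  have hr'i : IntervalIntegrable r' volume 0 T :=
    intervalIntegrable_bilin (ContinuousLinearMap.lsmul ℝ ℝ (E := E)).flip hT hmc.continuousOn hu
  have hq'i : IntervalIntegrable q' volume 0 T :=
    intervalIntegrable_bilin (ContinuousLinearMap.id ℝ (E →L[ℝ] E)) hT
      (continuous_modeExp a.adjoint k).continuousOn
      ((((modeOp a.adjoint k).continuous.comp_continuousOn hφc).intervalIntegrable_of_Icc hT).add hφ')
  have hq0 : q 0 = φ 0 := by rw [hq]; simp [modeExp_zero]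
  have hr0 : r 0 = x₀ := by rw [hr]; simp
  have hr1 : ∀ t ∈ Icc 0 T, r t = r 0 + ∫ s in (0)..t, r' s := fun t _ => by rw [hr0]
  have hq1 : ∀ t ∈ Icc 0 T, q t = q 0 + ∫ s in (0)..t, q' s := fun t ht => by
    rw [hq0]
    exact modeExp_apply_eq_integral a.adjoint k hφ' hφ ht
  have hrc : ContinuousOn r (Icc 0 T) := continuousOn_primitive hT hr'i x₀
  have hqc : ContinuousOn q (Icc 0 T) := (continuousOn_primitive hT hq'i (q 0)).congr hq1
  have h := integral_bilin_by_parts (innerSL ℝ) hT hr'i hq'i hr1 hq1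
  have hi1 : IntervalIntegrable (fun t => innerSL ℝ (r' t) (q t)) volume 0 T :=
    intervalIntegrable_bilin (innerSL ℝ (E := E)).flip hT hqc hr'i
  rw [intervalIntegral.integral_add hi1 (intervalIntegrable_bilin (innerSL ℝ) hT hrc hq'i)] at h
  have hqT : q T = 0 := by rw [hq]; simp [hT0]
  have e1 : ∫ t in (0)..T, innerSL ℝ (r' t) (q t) = ∫ t in Ioo 0 T, u t * inner ℝ b (φ t) := by
    rw [integral_Ioo_eq_intervalIntegral hT]
    refine intervalIntegral.integral_congr fun t _ => ?_
    simp only [hr', hq, innerSL_apply_apply, inner_smul_left]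
    rw [inner_modeExp_left, ← modeExp_add_apply, neg_add_cancel, modeExp_zero]
    rfl
  have e2 : ∫ t in (0)..T, innerSL ℝ (r t) (q' t) =
      -∫ t in Ioo 0 T, inner ℝ (modeExp a k t (r t)) (γ t) := by
    rw [← integral_Ioo_eq_intervalIntegral hT, ← integral_neg]
    refine integral_congr_ae ?_
    filter_upwards [hγ] with t ht
    simp only [hq', innerSL_apply_apply]
    rw [ht, inner_modeExp_left, map_neg, inner_neg_right]
  rw [e1, e2, hqT, hr0, hq0] at h
  simp only [map_zero, zero_sub] at h
  have h' : (∫ t in Ioo 0 T, u t * inner ℝ b (φ t)) +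
      -∫ t in Ioo 0 T, inner ℝ (modeExp a k t (r t)) (γ t) = -inner ℝ x₀ (φ 0) := h
  change ∫ t in Ioo 0 T, inner ℝ (modeExp a k t (r t)) (γ t) = _
  linarith

end ModeDuality

/-! ## The solution is a solution by transposition -/

section Transposition

/-! ### Parseval's identity under the time integral -/

section Parseval

variable {E : Type*} [NormedAddCommGroup E] [InnerProductSpace ℝ E]

theorem integrable_inner_of_memLp {α : Type*} [MeasurableSpace α] {μ : Measure α} {X Y : α → E}
    (hY : MemLp Y 2 μ) (hX : MemLp X 2 μ) : Integrable (fun t => inner ℝ (Y t) (X t)) μ :=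
  (hY.norm.integrable_mul hX.norm).mono' (hY.1.inner hX.1)
    (Eventually.of_forall fun t => norm_inner_le_norm (Y t) (X t))

variable [CompleteSpace E]

theorem memLp_coef {α : Type*} [MeasurableSpace α] {μ : Measure α} {X : α → L2 E}
    (hX : MemLp X 2 μ) (k : ℕ) : MemLp (fun t => coef ℝ k (X t)) 2 μ :=
  ContinuousLinearMap.comp_memLp' (coef ℝ k : L2 E →L[ℝ] E) hX

theorem intervalIntegrable_coef {a b : ℝ} {X : ℝ → L2 E} (hX : IntervalIntegrable X volume a b)
    (k : ℕ) : IntervalIntegrable (fun t => coef ℝ k (X t)) volume a b :=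
  ⟨ContinuousLinearMap.integrable_comp (coef ℝ k : L2 E →L[ℝ] E) hX.1,
    ContinuousLinearMap.integrable_comp (coef ℝ k : L2 E →L[ℝ] E) hX.2⟩

theorem inner_cutoff (N : ℕ) (f g : L2 E) :
    inner ℝ f (cutoff ℝ N g) = ∑ k ∈ Finset.range N, inner ℝ (coef ℝ k f) (coef ℝ k g) := by
  rw [cutoff_apply, inner_sum]
  exact Finset.sum_congr rfl fun k _ => inner_sineEmb_right ℝ k _ _

/-- Cutoffs are contractions, so ‖Y‖‖X‖ dominates the truncated pairings and Parseval passes under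
the integral. -/
theorem tendsto_sum_integral_inner_coef {T : ℝ} {X Y : ℝ → L2 E}
    (hY : MemLp Y 2 (volume.restrict (Ioo 0 T))) (hX : MemLp X 2 (volume.restrict (Ioo 0 T))) :
    Tendsto (fun N => ∑ k ∈ Finset.range N,
        ∫ t in Ioo 0 T, inner ℝ (coef ℝ k (Y t)) (coef ℝ k (X t))) atTop
      (𝓝 (∫ t in Ioo 0 T, inner ℝ (Y t) (X t))) := by
  have hi : ∀ k, Integrable (fun t => inner ℝ (coef ℝ k (Y t)) (coef ℝ k (X t)))
      (volume.restrict (Ioo 0 T)) := fun k =>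
    integrable_inner_of_memLp (memLp_coef hY k) (memLp_coef hX k)
  have hcX : ∀ N, MemLp (fun t => cutoff ℝ N (X t)) 2 (volume.restrict (Ioo 0 T)) := fun N =>
    ContinuousLinearMap.comp_memLp' (cutoff ℝ N : L2 E →L[ℝ] L2 E) hX
  have h := tendsto_integral_of_dominated_convergence (μ := volume.restrict (Ioo 0 T))
    (F := fun N t => inner ℝ (Y t) (cutoff ℝ N (X t))) (f := fun t => inner ℝ (Y t) (X t))
    (fun t => ‖Y t‖ * ‖X t‖) (fun N => hY.1.inner (hcX N).1) (hY.norm.integrable_mul hX.norm)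
    (fun N => Eventually.of_forall fun t => (norm_inner_le_norm _ _).trans
      (mul_le_mul_of_nonneg_left (norm_cutoff_apply_le ℝ N _) (norm_nonneg _)))
    (Eventually.of_forall fun t => tendsto_const_nhds.inner (tendsto_cutoff ℝ (X t)))
  refine h.congr fun N => ?_
  simp_rw [inner_cutoff]
  exact integral_finsetSum _ fun k _ => hi k

end Parseval

/-- The affine profile `(1 - x/π) c` with boundary values `c` and `0`. -/
def affineLift {E : Type*} [NormedAddCommGroup E] [InnerProductSpace ℝ E] (c : E) : L2 E :=
  smulConst ℝ (fun x => 1 - x / Real.pi) (by fun_prop) c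

/-- The affine profile solves h'' = 0, the case N = 0 of `coef_of_dirichlet`. The boundary amplitude
thus becomes (k+1)² times an L² coefficient. -/
theorem freqSq_smul_coef_affineLift {E : Type*} [NormedAddCommGroup E] [InnerProductSpace ℝ E]
    [CompleteSpace E] (c : E) (k : ℕ) :
    freqSq k • coef ℝ k (affineLift c) = sineAmp k • c := by
  have hd : ∀ x : ℝ, HasDerivAt (fun x : ℝ => (1 - x / Real.pi) • c) (-(1 / Real.pi) • c) x :=
    fun x => (((hasDerivAt_id x).div_const Real.pi).const_sub 1).smul_const c
  have h := coef_of_dirichlet (𝕜 := ℝ) (h := fun x : ℝ => (1 - x / Real.pi) • c)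
    (h' := fun _ => -(1 / Real.pi) • c) (N := (0 : E →L[ℝ] E)) (by fun_prop) (by fun_prop)
    (fun x _ => hd x) (fun x _ => by simpa using hasDerivAt_const x _)
    (by rw [div_self Real.pi_ne_zero]; simp) (f := affineLift c) (coeFn_smulConst ℝ _ c) k
  simpa using h

theorem matOp_transpose (A₀ : Matrix (Fin 2) (Fin 2) ℝ) :
    matOp A₀.transpose = (matOp A₀).adjoint := by
  rw [← ContinuousLinearMap.star_eq_adjoint, matOp, matOp, ← map_star, Matrix.star_eq_conjTranspose,
    Matrix.conjTranspose_eq_transpose_of_trivial]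

variable {A₀ : Matrix (Fin 2) (Fin 2) ℝ} {B₀ : EuclideanSpace ℝ (Fin 2)} {T : ℝ} {u : ℝ → ℝ}
  {y₀ : StateR}

/-- The group law e^{(t-s)a(k)} = e^{t a(k)} e^{-s a(k)} of the block a(k) pulls the time dependence
out of the integral, the form needed by `integral_inner_mode`. The convolution is only known to
converge for almost every t. -/
theorem ae_coef_controlState (y₀ : StateR) (hu : MemLp u 2 (volume.restrict (Ioo 0 T))) (k : ℕ) :
    ∀ᵐ t ∂(volume.restrict (Ioo 0 T)), coef ℝ k (controlState A₀ B₀ y₀ u t) =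
      modeExp (matOp A₀) k t (coef ℝ k y₀ +
        ∫ s in (0)..t, u s • modeExp (matOp A₀) k (-s) (sineAmp k • B₀)) := by
  filter_upwards [ae_intervalIntegrable_causalConv
    (integrableOn_boundaryKernel (matOp A₀) B₀ T) hu, ae_restrict_mem measurableSet_Ioo] with t h ht
  have hut : IntervalIntegrable u volume 0 t := by
    rw [intervalIntegrable_iff_integrableOn_Ioo_of_le ht.1.le]
    exact IntegrableOn.mono_set (hu.integrable (by norm_num)) (Ioo_subset_Ioo_right ht.2.le)
  have hi : IntervalIntegrable (fun s => u s • modeExp (matOp A₀) k (-s) (sineAmp k • B₀))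
      volume 0 t :=
    intervalIntegrable_bilin (ContinuousLinearMap.lsmul ℝ ℝ (E := EuclideanSpace ℝ (Fin 2))).flip
      ht.1.le ((continuous_modeExp_apply (matOp A₀) k _).comp continuous_neg).continuousOn hut
  rw [controlState, map_add, coef_heatOp _ ht.1.le, map_add]
  congr 1
  rw [causalConv, ← ContinuousLinearMap.intervalIntegral_comp_comm _ h,
    ← ContinuousLinearMap.intervalIntegral_comp_comm _ hi,
    ← integral_Ioo_eq_intervalIntegral ht.1.le, ← integral_Ioo_eq_intervalIntegral ht.1.le]
  refine setIntegral_congr_fun measurableSet_Ioo fun s hs => ?_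
  simp only [map_smul]
  rw [coef_boundaryKernel _ _ (sub_pos.2 hs.2), sub_eq_add_neg, modeExp_add_apply, map_smul, map_smul]

/-- On one mode the boundary forcing pairs √(2/π)(k+1) B₀ with φ. Since φ_xx has coefficients
-(k+1)² times those of φ, this is minus the pairing of the affine lift with φ_xx, a term that
Parseval can sum over k. -/
theorem integral_inner_coef_controlState (hT : 0 < T)
    (hu : MemLp u 2 (volume.restrict (Ioo 0 T))) {g φ φx φxx φt : ℝ → StateR}
    (h : IsStrongAdjointSolution A₀ T g φ φx)
    (hφt : MemLp φt 2 (volume.restrict (Ioo 0 T)))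
    (hw : ∀ᵐ t ∂(volume.restrict (Ioo 0 T)), IsWeakDeriv (φx t) (φxx t))
    (hφ : ∀ t ∈ Icc 0 T, φ t = φ 0 + ∫ s in (0)..t, φt s)
    (heq : ∀ᵐ t ∂(volume.restrict (Ioo 0 T)), -φt t - φxx t = matMul A₀.transpose (φ t) + g t)
    (k : ℕ) :
    (∫ t in Ioo 0 T, inner ℝ (coef ℝ k (controlState A₀ B₀ y₀ u t)) (coef ℝ k (g t))) +
      (∫ t in Ioo 0 T, inner ℝ (coef ℝ k (u t • affineLift B₀)) (coef ℝ k (φxx t))) =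
      inner ℝ (coef ℝ k y₀) (coef ℝ k (φ 0)) := by
  have hui : IntervalIntegrable u volume 0 T :=
    intervalIntegrable_of_integrableOn_Ioo hT.le (hu.integrable (by norm_num))
  have hφti : IntervalIntegrable φt volume 0 T :=
    intervalIntegrable_of_integrableOn_Ioo hT.le (hφt.integrable (by norm_num))
  have hH2 : ∀ᵐ t ∂(volume.restrict (Ioo 0 T)), coef ℝ k (φxx t) = -(freqSq k • coef ℝ k (φ t)) := by
    filter_upwards [hw, ae_restrict_mem measurableSet_Ioo] with t h1 ht
    have ht' := Ioo_subset_Icc_self ht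
    exact IsH2H10.coef_deriv₂ ⟨h.deriv_x t ht', h1, h.trace_zero t ht', h.trace_pi t ht'⟩ k
  have hm := integral_inner_mode (matOp A₀) k hT.le (coef ℝ k y₀) (sineAmp k • B₀) hui
    (φ := fun t => coef ℝ k (φ t)) (φ' := fun t => coef ℝ k (φt t)) (γ := fun t => coef ℝ k (g t))
    (intervalIntegrable_coef hφti k)
    (fun t ht => by
      have hsub : uIcc 0 t ⊆ uIcc 0 T := by
        rw [uIcc_of_le ht.1, uIcc_of_le hT.le]
        exact Icc_subset_Icc_right ht.2
      rw [ContinuousLinearMap.intervalIntegral_comp_comm _ (hφti.mono_set hsub), ← map_add,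
        ← hφ t ht])
    (by simp only [h.final, map_zero])
    (by
      filter_upwards [hH2, heq] with t h1 h2
      have h3 := congrArg (coef ℝ k) h2
      rw [map_sub, map_neg, map_add, h1, coef_matMul, matOp_transpose] at h3
      rw [modeOp_apply, ← sub_eq_iff_eq_add'.2 h3]
      abel)
  have e1 : ∫ t in Ioo 0 T, inner ℝ (coef ℝ k (controlState A₀ B₀ y₀ u t)) (coef ℝ k (g t)) =
      ∫ t in Ioo 0 T, inner ℝ (modeExp (matOp A₀) k t (coef ℝ k y₀ +
        ∫ s in (0)..t, u s • modeExp (matOp A₀) k (-s) (sineAmp k • B₀))) (coef ℝ k (g t)) :=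
    integral_congr_ae ((ae_coef_controlState (A₀ := A₀) (B₀ := B₀) y₀ hu k).mono fun t ht => by simp only [ht])
  have e2 : ∫ t in Ioo 0 T, inner ℝ (coef ℝ k (u t • affineLift B₀)) (coef ℝ k (φxx t)) =
      -∫ t in Ioo 0 T, u t * inner ℝ (sineAmp k • B₀) (coef ℝ k (φ t)) := by
    rw [← integral_neg]
    refine integral_congr_ae (hH2.mono fun t ht => ?_)
    simp only [ht]
    rw [map_smul, ← freqSq_smul_coef_affineLift, inner_neg_right, inner_smul_left, inner_smul_right,
      inner_smul_left]
    simp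
  rw [e1, hm, e2]
  ring

/-- Sum the single-mode identities over k, then recover φ_x(0,t) from φ_xx with
`IsH2H10.trace_deriv_eq`. -/
theorem isTranspositionSolution_controlState (hT : 0 < T)
    (hu : MemLp u 2 (volume.restrict (Ioo 0 T))) :
    IsTranspositionSolution A₀ B₀ T y₀ u (controlState A₀ B₀ y₀ u) := by
  refine ⟨memLp_controlState y₀ hu, fun g hg φ φx p h hp => ?_⟩
  obtain ⟨φxx, φt, hφxx, hφt, hw, hφ, heq⟩ := h.eqn
  have huℓ : MemLp (fun t => u t • affineLift B₀) 2 (volume.restrict (Ioo 0 T)) :=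
    ((ContinuousLinearMap.id ℝ ℝ).smulRight (affineLift B₀)).comp_memLp' hu
  have h1 := (tendsto_sum_integral_inner_coef (memLp_controlState (A₀ := A₀) (B₀ := B₀) y₀ hu) hg).add
    (tendsto_sum_integral_inner_coef huℓ hφxx)
  simp_rw [← Finset.sum_add_distrib,
    integral_inner_coef_controlState hT hu h hφt hw hφ heq] at h1
  have h2 := tendsto_nhds_unique h1 (hasSum_inner_coef ℝ y₀ (φ 0)).tendsto_sum_nat
  have h3 : ∫ t in Ioo 0 T, inner ℝ (u t • affineLift B₀) (φxx t) =
      -∫ t in Ioo 0 T, inner ℝ B₀ (p t) * u t := by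
    rw [← integral_neg]
    refine integral_congr_ae ?_
    filter_upwards [hw, hp, ae_restrict_mem measurableSet_Ioo] with t h4 h5 ht
    have ht' := Ioo_subset_Icc_self ht
    have h6 := IsH2H10.trace_deriv_eq
      ⟨h.deriv_x t ht', h4, h.trace_zero t ht', h.trace_pi t ht'⟩ h5
    rw [inner_smul_left, affineLift, inner_smulConst_left, h6, inner_neg_right]
    simp [mul_comm]
  rw [h3] at h2
  linarith

end Transposition

/-! ## Uniqueness of the solution by transposition -/

section Uniqueness

/-- The derivative of `sineFun k`. -/
def cosineFun (k : ℕ) (x : ℝ) : ℝ := sineAmp k * Real.cos (((k + 1 : ℕ) : ℝ) * x)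

theorem continuous_cosineFun (k : ℕ) : Continuous (cosineFun k) := by
  unfold cosineFun
  fun_prop

theorem hasDerivAt_sineFun (k : ℕ) (x : ℝ) : HasDerivAt (sineFun k) (cosineFun k x) x := by
  have h := (((hasDerivAt_id x).const_mul ((k + 1 : ℕ) : ℝ)).sin).const_mul √(2 / Real.pi)
  refine h.congr_deriv ?_
  simp only [cosineFun, sineAmp, id]
  push_cast
  ring

theorem hasDerivAt_cosineFun (k : ℕ) (x : ℝ) :
    HasDerivAt (cosineFun k) (-(freqSq k * sineFun k x)) x := by
  have h := (((hasDerivAt_id x).const_mul ((k + 1 : ℕ) : ℝ)).cos).const_mul (sineAmp k)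
  refine h.congr_deriv ?_
  simp only [sineFun, sineAmp, freqSq, id]
  push_cast
  ring

variable {E : Type*} [NormedAddCommGroup E] [InnerProductSpace ℝ E] [CompleteSpace E]

/-- The derivative of `sineEmb ℝ k c`. -/
def cosineEmb (k : ℕ) : E →ₗ[ℝ] L2 E := smulConst ℝ (cosineFun k) (continuous_cosineFun k)

theorem coeFn_cosineEmb (k : ℕ) (c : E) :
    cosineEmb k c =ᵐ[volume.restrict (Ioo (0 : ℝ) Real.pi)] fun x => cosineFun k x • c :=
  coeFn_smulConst ℝ (continuous_cosineFun k) c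

theorem isWeakDeriv_sineEmb (k : ℕ) (c : E) : IsWeakDeriv (sineEmb ℝ k c) (cosineEmb k c) :=
  isWeakDeriv_of_hasDerivAt (fun x => (hasDerivAt_sineFun k x).smul_const c)
    ((continuous_cosineFun k).smul continuous_const) (coeFn_sineEmb ℝ k c) (coeFn_cosineEmb k c)

theorem isWeakDeriv_cosineEmb (k : ℕ) (c : E) :
    IsWeakDeriv (cosineEmb k c) (-(freqSq k • sineEmb ℝ k c)) := by
  refine isWeakDeriv_of_hasDerivAt (fun x => (hasDerivAt_cosineFun k x).smul_const c)
    ((continuous_const.mul (continuous_sineFun k)).neg.smul continuous_const) (coeFn_cosineEmb k c) ?_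
  filter_upwards [Lp.coeFn_neg (freqSq k • sineEmb ℝ k c), Lp.coeFn_smul (freqSq k) (sineEmb ℝ k c),
    coeFn_sineEmb ℝ k c] with x h1 h2 h3
  rw [h1, Pi.neg_apply, h2, Pi.smul_apply, h3, smul_smul, neg_smul]

theorem hasTrace_sineEmb (k : ℕ) (c : E) (x : ℝ) : HasTrace (sineEmb ℝ k c) x (sineFun k x • c) :=
  ⟨fun x => sineFun k x • c, ((continuous_sineFun k).smul continuous_const).continuousOn,
    coeFn_sineEmb ℝ k c, rfl⟩

theorem hasTrace_cosineEmb (k : ℕ) (c : E) (x : ℝ) :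
    HasTrace (cosineEmb k c) x (cosineFun k x • c) :=
  ⟨fun x => cosineFun k x • c, ((continuous_cosineFun k).smul continuous_const).continuousOn,
    coeFn_cosineEmb k c, rfl⟩

theorem sineFun_zero (k : ℕ) : sineFun k 0 = 0 := by simp [sineFun]

theorem sineFun_pi (k : ℕ) : sineFun k Real.pi = 0 := by
  rw [sineFun, Real.sin_nat_mul_pi, mul_zero]

/-- The backward equation on a single mode. -/
theorem exists_backward_mode (a : E →L[ℝ] E) (k : ℕ) {η : ℝ → ℝ} (hη : Continuous η) (c : E)
    (T : ℝ) : ∃ q : ℝ → E, q T = 0 ∧ ∀ t, HasDerivAt q (-(modeOp a k (q t)) - η t • c) t := by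
  have hf : Continuous fun s => (-η s) • modeExp a k s c :=
    hη.neg.smul (continuous_modeExp_apply a k c)
  -- Duhamel's formula run backwards from T, so that the final value is zero.
  refine ⟨fun t => modeExp a k (-t) (∫ s in T..t, (-η s) • modeExp a k s c), by simp, fun t => ?_⟩
  have h1 : HasDerivAt (fun t => modeExp a k (-t)) (-(modeOp a k * modeExp a k (-t))) t := by
    have h := (hasDerivAt_modeExp a k (-t)).scomp t (hasDerivAt_neg t)
    simpa [Function.comp_def] using h
  have h2 := (hf.integral_hasStrictDerivAt T t).hasDerivAt
  refine (h1.clm_apply h2).congr_deriv ?_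
  rw [map_smul, ← modeExp_add_apply, neg_add_cancel, modeExp_zero, sub_eq_add_neg, neg_smul]
  rfl

variable {A₀ : Matrix (Fin 2) (Fin 2) ℝ} {B₀ : EuclideanSpace ℝ (Fin 2)} {T : ℝ} {u : ℝ → ℝ}
  {y₀ : StateR}

theorem matMul_sineEmb (M : Matrix (Fin 2) (Fin 2) ℝ) (k : ℕ) (c : EuclideanSpace ℝ (Fin 2)) :
    matMul M (sineEmb ℝ k c) = sineEmb ℝ k (matOp M c) := by
  refine L2_ext_coef ℝ fun j => ?_
  rw [coef_matMul, coef_sineEmb, coef_sineEmb]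
  split_ifs
  · rfl
  · rw [map_zero]

theorem isStrongAdjointSolution_mode (k : ℕ) {η : ℝ → ℝ} (hη : Continuous η)
    (c : EuclideanSpace ℝ (Fin 2)) {q : ℝ → EuclideanSpace ℝ (Fin 2)} (hqT : q T = 0)
    (hq : ∀ t, HasDerivAt q (-(modeOp (matOp A₀.transpose) k (q t)) - η t • c) t) :
    IsStrongAdjointSolution A₀ T (fun t => η t • sineEmb ℝ k c) (fun t => sineEmb ℝ k (q t))
      (fun t => cosineEmb k (q t)) := by
  have hqc : Continuous q := continuous_iff_continuousAt.2 fun t => (hq t).continuousAt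
  have hq'c : Continuous fun t => -(modeOp (matOp A₀.transpose) k (q t)) - η t • c :=
    ((modeOp (matOp A₀.transpose) k).continuous.comp hqc).neg.sub (hη.smul continuous_const)
  have hs : Continuous fun t => sineEmb ℝ k (q t) := (sineEmb ℝ k).continuous.comp hqc
  have hs' : Continuous fun t =>
      sineEmb ℝ k (-(modeOp (matOp A₀.transpose) k (q t)) - η t • c) :=
    (sineEmb ℝ k).continuous.comp hq'c
  have hsx : Continuous fun t => -(freqSq k • sineEmb ℝ k (q t)) :=
    (hs.const_smul (freqSq k)).neg
  have hcx : Continuous fun t => (cosineEmb k (q t) : StateR) :=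
    (LinearMap.continuous_of_finiteDimensional (cosineEmb k)).comp hqc
  refine ⟨fun t _ => isWeakDeriv_sineEmb k _, fun t _ => ?_, fun t _ => ?_, hs.continuousOn,
    hcx.continuousOn,
    ⟨fun t => -(freqSq k • sineEmb ℝ k (q t)),
      fun t => sineEmb ℝ k (-(modeOp (matOp A₀.transpose) k (q t)) - η t • c),
      memLp_of_continuousOn_Icc hsx.continuousOn,
      memLp_of_continuousOn_Icc hs'.continuousOn,
      Eventually.of_forall fun t => isWeakDeriv_cosineEmb k _, fun t _ => ?_,
      Eventually.of_forall fun t => ?_⟩, by simp only [hqT, map_zero]⟩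
  · have h := hasTrace_sineEmb k (q t) 0
    rwa [sineFun_zero, zero_smul] at h
  · have h := hasTrace_sineEmb k (q t) Real.pi
    rwa [sineFun_pi, zero_smul] at h
  · have hd : ∀ x, HasDerivAt (fun t => sineEmb ℝ k (q t))
        (sineEmb ℝ k (-(modeOp (matOp A₀.transpose) k (q x)) - η x • c)) x := fun x =>
      HasFDerivAt.comp_hasDerivAt x (sineEmb (E := EuclideanSpace ℝ (Fin 2)) ℝ
        k).toContinuousLinearMap.hasFDerivAt (hq x)
    rw [intervalIntegral.integral_eq_sub_of_hasDerivAt (fun x _ => hd x)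
      (hs'.intervalIntegrable _ _), add_sub_cancel]
  · simp only
    rw [matMul_sineEmb, modeOp_apply, map_sub, map_neg, map_sub, map_smul, map_smul]
    abel

/-- Testing with g = η(t) sin((k+1)x) c requires only the explicit adjoint solution on one mode. The
right-hand sides coincide for y and y', so every coefficient of y' - y is orthogonal to all test
functions in time. -/
theorem IsTranspositionSolution.ae_eq {y y' : ℝ → StateR}
    (hy : IsTranspositionSolution A₀ B₀ T y₀ u y) (hy' : IsTranspositionSolution A₀ B₀ T y₀ u y') :
    y' =ᵐ[volume.restrict (Ioo 0 T)] y := by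
  have hcoef : ∀ k, ∀ᵐ t ∂(volume.restrict (Ioo 0 T)), coef ℝ k (y' t) - coef ℝ k (y t) = 0 := by
    intro k
    have hi : ∀ {z : ℝ → StateR}, MemLp z 2 (volume.restrict (Ioo 0 T)) →
        Integrable (fun t => coef ℝ k (z t)) (volume.restrict (Ioo 0 T)) := fun hz =>
      (memLp_coef hz k).integrable (by norm_num)
    have hd : IntegrableOn (fun t => coef ℝ k (y' t) - coef ℝ k (y t)) (Ioo 0 T) :=
      (hi hy'.1).sub (hi hy.1)
    refine (ae_restrict_iff' measurableSet_Ioo).2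
      (isOpen_Ioo.ae_eq_zero_of_integral_contDiff_smul_eq_zero hd.locallyIntegrableOn ?_)
    intro η h1 h2 h3
    have hηi : IntegrableOn (fun t => η t • (coef ℝ k (y' t) - coef ℝ k (y t))) (Ioo 0 T) := by
      obtain ⟨C, hC⟩ := h1.continuous.bounded_above_of_compact_support h2
      exact Integrable.bdd_smul hd C h1.continuous.aestronglyMeasurable (Eventually.of_forall hC)
    rw [← setIntegral_eq_integral_of_forall_compl_eq_zero (s := Ioo 0 T) fun x hx => by
      rw [image_eq_zero_of_notMem_tsupport fun h => hx (h3 h), zero_smul]]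
    refine ext_inner_left ℝ fun c => ?_
    rw [inner_zero_right, ← integral_inner hηi]
    obtain ⟨q, hqT, hq⟩ := exists_backward_mode (matOp A₀.transpose) k h1.continuous c T
    have hadj := isStrongAdjointSolution_mode (A₀ := A₀) k h1.continuous c hqT hq
    have hg : MemLp (fun t => η t • sineEmb ℝ k c) 2 (volume.restrict (Ioo 0 T)) :=
      memLp_of_continuousOn_Icc (h1.continuous.smul continuous_const).continuousOn
    have htr : ∀ᵐ t ∂(volume.restrict (Ioo 0 T)),
        HasTrace (cosineEmb k (q t)) 0 (cosineFun k 0 • q t) :=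
      Eventually.of_forall fun t => hasTrace_cosineEmb k _ 0
    have e := (hy'.2 _ hg _ _ _ hadj htr).trans (hy.2 _ hg _ _ _ hadj htr).symm
    rw [← sub_eq_zero, ← integral_sub (integrable_inner_of_memLp hy'.1 hg)
      (integrable_inner_of_memLp hy.1 hg)] at e
    refine Eq.trans ?_ e
    refine integral_congr_ae (Eventually.of_forall fun t => ?_)
    simp only [inner_smul_right, inner_sineEmb_right, inner_sub_right]
    rw [real_inner_comm c, real_inner_comm c, mul_sub]
  filter_upwards [ae_all_iff.2 hcoef] with t ht
  exact L2_ext_coef ℝ fun k => sub_eq_zero.1 (ht k)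

end Uniqueness

end BoundaryControl

end

/-! ### Assembly of the theorem -/

open BoundaryControl in
theorem mainTheorem8 (A₀ : Matrix (Fin 2) (Fin 2) ℝ) (B₀ : EuclideanSpace ℝ (Fin 2)) :
    ∃ (S : C0Semigroup StateC) (S' : C0Semigroup (Extrap (parabolicOp A₀)))
      (B : ℂ →L[ℂ] Extrap (parabolicOp A₀)),
      -- `A` generates `S = e^{At}` on `H`, and `𝒜` generates `S' = e^{𝒜t}` on `(dom A^*)'`
      S.HasGenerator (parabolicOp A₀).graph ∧
      S'.HasGenerator (extendGraph (parabolicOp A₀)) ∧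
      -- the control operator is `B = (ω I - 𝒜) D_ω`, `D_ω` the Dirichlet map
      -- (so `B = -𝒜 C` with `C = D_0` if `ω = 0` is admissible), with the singular estimate
      (∀ ω : ℂ, NonResonant A₀ ω →
        ω ∈ resolventSet (parabolicOp A₀) ∧
        (∀ a : ℂ, ∃ h, IsDirichletLift A₀ B₀ ω a h ∧
          ∀ h', IsDirichletLift A₀ B₀ ω a h' → Set.EqOn h' h (Set.Icc 0 Real.pi)) ∧
        ∃ D : ℂ →L[ℂ] StateC,
          (∀ a h, IsDirichletLift A₀ B₀ ω a h →
            D a =ᵐ[volume.restrict (Set.Ioo 0 Real.pi)] h) ∧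
          B = (ω • embed (parabolicOp A₀) - extend (parabolicOp A₀)).comp D ∧
          ∀ θ ∈ Set.Ioo (0 : ℝ) (1 / 4), ∀ T : ℝ, 0 < T → ∃ M : ℝ, ∀ t ∈ Set.Ioo 0 T, ∀ a : ℂ,
            ∃ hd : S.op t (D a) ∈ (parabolicOp A₀).domain,
              ‖parabolicOp A₀ ⟨S.op t (D a), hd⟩‖ ≤ M * ‖a‖ / t ^ (1 - θ)) ∧
      -- the solution by transposition exists, is unique and solves `ẏ = 𝒜 y + B u`, `y(0) = y₀`
      (∀ T : ℝ, 0 < T → ∀ (y₀ : StateR) (u : ℝ → ℝ),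
        MemLp u 2 (volume.restrict (Set.Ioo 0 T)) →
        ∃ y : ℝ → StateR,
          IsTranspositionSolution A₀ B₀ T y₀ u y ∧
          (∀ y', IsTranspositionSolution A₀ B₀ T y₀ u y' →
            y' =ᵐ[volume.restrict (Set.Ioo 0 T)] y) ∧
          IsMildSolution (parabolicOp A₀) S S' B T (stateC y₀) (fun t => (u t : ℂ))
            (fun t => stateC (y t))) ∧
      RegularityHypothesis (parabolicOp A₀) S' B ∧
      HasCompactResolvent (parabolicOp A₀) ∧
      SpectralHypothesis (parabolicOp A₀) S := by
  -- One admissible ω₀ fixes B and the isomorphism defining e^{𝒜t}; every other admissible ω gives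
  -- the same B by `IsDirichletMap.shift_comp_eq`.
  obtain ⟨ω₀, hω₀⟩ := exists_nonResonant A₀
  obtain ⟨R, hR, -⟩ := hω₀.exists_resolvent
  obtain ⟨D₀, -, hD₀⟩ := hω₀.exists_dirichletMap B₀
  have hD₀' : IsDirichletMap A₀ B₀ ω₀ D₀ := hD₀
  refine ⟨heatSemigroup A₀, extrapSemigroup hR, (shift (parabolicOp A₀) ω₀).comp D₀,
    heatSemigroup_hasGenerator A₀,
    C0Semigroup.extrapolate_hasGenerator dense_domain_parabolicOp hR (heatSemigroup_hasGenerator A₀),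
    fun ω hω => ?_, fun T hT y₀ u hu => ?_, hD₀'.regularityHypothesis hR,
    hasCompactResolvent_parabolicOp A₀, spectralHypothesis_parabolicOp A₀⟩
  · obtain ⟨D, hDlift, hD⟩ := hω.exists_dirichletMap B₀
    have hD' : IsDirichletMap A₀ B₀ ω D := hD
    refine ⟨hω.exists_resolvent.imp fun _ h => h.1, fun a => ?_, D, hDlift,
      hD₀'.shift_comp_eq hD', fun θ hθ T _ => hD'.exists_norm_le hθ T⟩
    obtain ⟨h, hh⟩ := hω.exists_isDirichletLift B₀ a
    exact ⟨h, hh, fun h' hh' => hω.eqOn_of_isDirichletLift hh hh'⟩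
  · have hy := isTranspositionSolution_controlState (A₀ := A₀) (B₀ := B₀) (y₀ := y₀) hT hu
    exact ⟨controlState A₀ B₀ y₀ u, hy, fun y' hy' => hy.ae_eq hy', hD₀'.isMildSolution hR y₀ hu⟩
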